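/- Let $X$ be a complex manifold of dimension $n\ge 2$ and let $\Omega\Subset X$ be a relatively compact domain (non-empty, open and connected) with $\mathcal C^3$-smooth boundary. A defining function of $\Omega$ is a function $\rho:\overline\Omega\to\mathbb R$ of class $\mathcal C^2$ (up to the boundary, i.e. with a $\mathcal C^2$ extension to a neighbourhood of $\overline\Omega$) such that $\Omega=\{\rho<0\}$ and $d\rho\neq 0$ at every point of $\partial\Omega$. The Diederich--Fornaess exponent of $\rho$ is the supremum of all $\eta\in(0,1)$ such that $-(-\rho)^{\eta}$ is a bounded, strictly plurisubharmonic exhaustion function of $\Omega$ (and $0$ if there is no such $\eta$), and the Diederich--Fornaess index $\eta(\Omega)$ is the supremum of the Diederich--Fornaess exponents of all defining functions of $\Omega$. The boundary $\partial\Omega$ is called Levi-flat if its Levi form vanishes identically at every point of $\partial\Omega$, i.e. if for every $p\in\partial\Omega$ and every $\mathcal C^2$ local defining function $r$ of $\Omega$ near $p$ the form $\partial\bar\partial r(p)$ vanishes on the complex tangent space $\{v\in T^{1,0}_pX:\partial r(p)(v)=0\}$. If $\eta(\Omega)>\frac1n$, then $\partial\Omega$ is not Levi-flat. -/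

import Mathlib

open scoped Manifold ContDiff

noncomputable section

namespace DF

/-- The model space `ℂⁿ`. -/
abbrev Cn (n : ℕ) : Type := EuclideanSpace ℂ (Fin n)

/-! ### Wirtinger calculus on `ℂⁿ` -/

/-- `∂f/∂z_j = (∂f/∂x_j - i ∂f/∂y_j) / 2`. -/
def dz {n : ℕ} (j : Fin n) (f : Cn n → ℂ) (z : Cn n) : ℂ :=
  (1 / 2) * (fderiv ℝ f z (EuclideanSpace.single j 1)
    - Complex.I * fderiv ℝ f z (EuclideanSpace.single j Complex.I))

/-- `∂f/∂z̄_j = (∂f/∂x_j + i ∂f/∂y_j) / 2`. -/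
def dzbar {n : ℕ} (j : Fin n) (f : Cn n → ℂ) (z : Cn n) : ℂ :=
  (1 / 2) * (fderiv ℝ f z (EuclideanSpace.single j 1)
    + Complex.I * fderiv ℝ f z (EuclideanSpace.single j Complex.I))

/-- The complex Hessian form `∑_{j,k} (∂²f/∂z_j∂z̄_k)(z) v_j w̄_k`. -/
def complexHessian {n : ℕ} (f : Cn n → ℝ) (z v w : Cn n) : ℂ :=
  ∑ j, ∑ k, dz j (dzbar k (fun ζ => (f ζ : ℂ))) z * v j * (starRingEnd ℂ) (w k)

/-- The value `∂f_z(v) = ∑_j (∂f/∂z_j)(z) v_j` of the `(1,0)`-part of `df` at `z`. -/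
def delForm {n : ℕ} (f : Cn n → ℝ) (z v : Cn n) : ℂ :=
  ∑ j, dz j (fun ζ => (f ζ : ℂ)) z * v j

section Manifold

/-- `f` is of class `C^k` on `s` in the real sense. -/
def CkOn (n : ℕ) {X : Type*} [TopologicalSpace X] [ChartedSpace (Cn n) X]
    (k : ℕ∞) (f : X → ℝ) (s : Set X) : Prop :=
  ContMDiffOn 𝓘(ℝ, Cn n) 𝓘(ℝ, ℝ) (k : WithTop ℕ∞) f s

/-- The real differential of `f` at `p` does not vanish. -/
def DiffNeZero (n : ℕ) {X : Type*} [TopologicalSpace X] [ChartedSpace (Cn n) X]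
    (f : X → ℝ) (p : X) : Prop :=
  mfderiv 𝓘(ℝ, Cn n) 𝓘(ℝ, ℝ) f p ≠ 0

/-- `u` is a strictly plurisubharmonic function of class `C²` on the open set `Ω`: in holomorphic
coordinates its complex Hessian is positive definite at every point of `Ω`. -/
def StrictlyPSHOn (n : ℕ) {X : Type*} [TopologicalSpace X] [ChartedSpace (Cn n) X]
    (u : X → ℝ) (Ω : Set X) : Prop :=
  CkOn n 2 u Ω ∧
  ∀ p ∈ Ω, ∀ e ∈ atlas (Cn n) X, p ∈ e.source → ∀ v : Cn n, v ≠ 0 →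
    0 < (complexHessian (u ∘ e.symm) (e p) v v).re

/-- `u` is a bounded exhaustion function of `Ω`: it is bounded on `Ω` and the sublevel sets
`{u < c}`, `c < sup_Ω u`, are relatively compact in `Ω`. -/
def IsBoundedExhaustion {X : Type*} [TopologicalSpace X] (u : X → ℝ) (Ω : Set X) : Prop :=
  (∃ M : ℝ, ∀ x ∈ Ω, |u x| ≤ M) ∧
  ∀ c : ℝ, (∃ y ∈ Ω, c < u y) →
    IsCompact (closure {x ∈ Ω | u x < c}) ∧ closure {x ∈ Ω | u x < c} ⊆ Ω

/-- `ρ` is a (global) defining function of `Ω`: it is of class `C²` on the closure of `Ω`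
(that is, on a neighbourhood of it), it is negative on `Ω`
and not on the rest of the closure, and its differential vanishes nowhere on the boundary.
Only the values of `ρ` near the closure of `Ω` matter. -/
structure IsDefiningFunction (n : ℕ) {X : Type*} [TopologicalSpace X] [ChartedSpace (Cn n) X]
    (ρ : X → ℝ) (Ω : Set X) : Prop where
  contDiff : ∃ U : Set X, IsOpen U ∧ closure Ω ⊆ U ∧ CkOn n 2 ρ U
  eq_neg : Ω = {x ∈ closure Ω | ρ x < 0}
  diff_ne_zero : ∀ p ∈ frontier Ω, DiffNeZero n ρ p

/-- The Diederich–Fornaess exponent of the defining function `ρ`: the supremum of the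
`η ∈ (0,1)` such that `-(-ρ)^η` is a bounded strictly plurisubharmonic exhaustion function of `Ω`,
and `0` if there is no such `η` (the supremum of the empty set of reals is `0` in Mathlib). -/
def dfExponent (n : ℕ) {X : Type*} [TopologicalSpace X] [ChartedSpace (Cn n) X]
    (ρ : X → ℝ) (Ω : Set X) : ℝ :=
  sSup {η : ℝ | 0 < η ∧ η < 1 ∧
    StrictlyPSHOn n (fun x => -((-ρ x) ^ η)) Ω ∧
    IsBoundedExhaustion (fun x => -((-ρ x) ^ η)) Ω}

/-- The Diederich–Fornaess index of `Ω`: the supremum of the exponents of its defining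
functions (all of which lie in `[0,1]`). -/
def dfIndex (n : ℕ) {X : Type*} [TopologicalSpace X] [ChartedSpace (Cn n) X]
    (Ω : Set X) : ℝ :=
  sSup {a : ℝ | ∃ ρ : X → ℝ, IsDefiningFunction n ρ Ω ∧ a = dfExponent n ρ Ω}

/-- `r` is a local defining function of class `C^k` of `Ω` on the open neighbourhood `U` of the
boundary point `p`. -/
structure IsLocalDefiningFunction (n : ℕ) {X : Type*} [TopologicalSpace X]
    [ChartedSpace (Cn n) X] (k : ℕ∞) (Ω : Set X) (p : X) (U : Set X) (r : X → ℝ) : Prop where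
  isOpen : IsOpen U
  mem : p ∈ U
  contDiff : CkOn n k r U
  inter_eq : Ω ∩ U = {x ∈ U | r x < 0}
  diff_ne_zero : DiffNeZero n r p

/-- The open set `Ω` has boundary of class `C^k`. -/
def HasCkBoundary (n : ℕ) {X : Type*} [TopologicalSpace X] [ChartedSpace (Cn n) X]
    (k : ℕ∞) (Ω : Set X) : Prop :=
  ∀ p ∈ frontier Ω, ∃ (U : Set X) (r : X → ℝ), IsLocalDefiningFunction n k Ω p U r

/-- The Levi form of `r` at `p`, i.e. the restriction of `∂∂̄r` to the complex tangent space
`{v | ∂r_p(v) = 0}`, is identically zero, in every holomorphic chart around `p`. -/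
def LeviFormVanishesAt (n : ℕ) {X : Type*} [TopologicalSpace X] [ChartedSpace (Cn n) X]
    (r : X → ℝ) (p : X) : Prop :=
  ∀ e ∈ atlas (Cn n) X, p ∈ e.source → ∀ v w : Cn n,
    delForm (r ∘ e.symm) (e p) v = 0 → delForm (r ∘ e.symm) (e p) w = 0 →
    complexHessian (r ∘ e.symm) (e p) v w = 0

/-- The boundary of `Ω` (of class at least `C²`) is Levi-flat: its Levi form vanishes identically
at each boundary point. The Levi form is computed with an arbitrary local defining
function of class `C²`; another choice multiplies it by a positive factor. -/
def IsLeviFlatBoundary (n : ℕ) {X : Type*} [TopologicalSpace X] [ChartedSpace (Cn n) X]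
    (Ω : Set X) : Prop :=
  ∀ p ∈ frontier Ω, ∀ (U : Set X) (r : X → ℝ),
    IsLocalDefiningFunction n 2 Ω p U r → LeviFormVanishesAt n r p

end Manifold

end DF

end

open scoped Manifold ContDiff
open scoped ComplexOrder MatrixOrder
open DF MeasureTheory Filter Topology

noncomputable section

namespace DF

variable {n : ℕ}

/-! ### First order operators -/

/-! Suppose the boundary is Levi-flat and the index exceeds 1/n. Then some φ = -(-ρ)^η with η > 1/n
is strictly plurisubharmonic on Ω (`exists_exponent_of_lt_dfIndex`), and its Monge–Ampère mass leads
to a contradiction. Fix a C³ function r on X with Ω = {r < 0} and dr ≠ 0 on the boundary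
(`exists_global_defining`), and let χ_ε = step(-r/ε), which is 0 at depth at most ε and 1 at depth
at least 2ε. Integration by parts gives ∫ χ_ε (i∂∂̄φ)^n = ∫ φ i∂∂̄χ_ε ∧ (i∂∂̄φ)^(n-1). The left side
does not decrease as ε decreases, and it is positive for small ε (`exists_mass_lower_bound`). The
right side is O(ε^(nη-1)), which tends to 0.

The bound on the right side rests on three facts about depths comparable to ε. First, ρ is dominated
by r, so φ = O(ε^η). Second, Levi-flatness and r ∈ C³ give |∂∂̄r(v,v)| = O(|r||v|² + |∂r(v)||v|)
(`levi_form_bound`). Hence ∂∂̄χ_ε is dominated by the anisotropic form |v|² + ε⁻²|∂r(v)|²; without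
flatness there would be tangential terms of size ε⁻¹|v|². Third, this form is comparable to ∂∂̄w for
the weight w = A|z|² + (r/ε)², which is bounded on the strip (`stripWeight_bounds`).

Consequently, exchanging one factor i∂∂̄φ for i∂∂̄w costs a factor ε^η, by a Chern–Levine–Nirenberg
integration by parts against a cutoff (`StripChart.mass_le`). When only copies of w remain, the
density is O(ε⁻²), because only one complex direction is stretched, and the strip has volume O(ε).
This yields ε^((n-1)η-1) for n-1 copies of φ. The factor φ in front contributes the last ε^η
(`StripChart.boundary_term_le`).

Wedge products are expressed as mixed discriminants of complex Hessian matrices. Their positivity is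
`mixedDisc_re_nonneg`, and integration by parts comes from determinants of first derivatives being
null Lagrangians (`integral_det_wirt`). A holomorphic change of coordinates multiplies the density
by the real Jacobian (`mixedMA_comp_holo`), so integrals in charts patch together through a
partition of unity (`sum_chartIntegral_parts`). -/

/-- The first order operator `(∂/∂x_j + c ∂/∂y_j) / 2`; the values `c = -i` and `c = i` give the
two Wirtinger derivatives. -/
def wirt (c : ℂ) (j : Fin n) (f : Cn n → ℂ) (z : Cn n) : ℂ :=
  (1 / 2) * (fderiv ℝ f z (EuclideanSpace.single j 1)
    + c * fderiv ℝ f z (EuclideanSpace.single j Complex.I))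

theorem dz_eq_wirt (j : Fin n) : dz j = wirt (-Complex.I) j := by
  ext f z; simp only [dz, wirt]; ring

theorem dzbar_eq_wirt (j : Fin n) : dzbar j = wirt Complex.I j := rfl

theorem wirt_congr {c : ℂ} {j : Fin n} {f g : Cn n → ℂ} {z : Cn n} (h : f =ᶠ[𝓝 z] g) :
    wirt c j f z = wirt c j g z := by
  simp only [wirt, h.fderiv_eq]

theorem wirt_eventuallyEq {c : ℂ} {j : Fin n} {f g : Cn n → ℂ} {z : Cn n} (h : f =ᶠ[𝓝 z] g) :
    wirt c j f =ᶠ[𝓝 z] wirt c j g :=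
  h.eventuallyEq_nhds.mono fun _ hy => wirt_congr hy

theorem wirt_add {c : ℂ} {j : Fin n} {f g : Cn n → ℂ} {z : Cn n}
    (hf : DifferentiableAt ℝ f z) (hg : DifferentiableAt ℝ g z) :
    wirt c j (fun x => f x + g x) z = wirt c j f z + wirt c j g z := by
  simp only [wirt, fderiv_fun_add hf hg, add_apply]; ring

theorem wirt_mul {c : ℂ} {j : Fin n} {f g : Cn n → ℂ} {z : Cn n}
    (hf : DifferentiableAt ℝ f z) (hg : DifferentiableAt ℝ g z) :
    wirt c j (fun x => f x * g x) z = f z * wirt c j g z + g z * wirt c j f z := by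
  simp only [wirt, fderiv_fun_mul hf hg, add_apply, FunLike.coe_smul, Pi.smul_apply, smul_eq_mul]
  ring

theorem wirt_sum {ι : Type*} {c : ℂ} {j : Fin n} (s : Finset ι) {f : ι → Cn n → ℂ} {z : Cn n}
    (hf : ∀ i ∈ s, DifferentiableAt ℝ (f i) z) :
    wirt c j (fun x => ∑ i ∈ s, f i x) z = ∑ i ∈ s, wirt c j (f i) z := by
  simp only [wirt, fderiv_fun_sum hf, FunLike.coe_sum, Finset.sum_apply, Finset.mul_sum,
    ← Finset.sum_add_distrib]

theorem wirt_const {c : ℂ} {j : Fin n} (a : ℂ) (z : Cn n) : wirt c j (fun _ => a) z = 0 := by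
  simp [wirt]

theorem wirt_contDiffAt {c : ℂ} {j : Fin n} {f : Cn n → ℂ} {z : Cn n} {m k : WithTop ℕ∞}
    (hf : ContDiffAt ℝ k f z) (h : m + 1 ≤ k) : ContDiffAt ℝ m (wirt c j f) z := by
  have h1 := hf.fderiv_right h
  unfold wirt
  exact contDiffAt_const.mul ((h1.clm_apply contDiffAt_const).add
    (contDiffAt_const.mul (h1.clm_apply contDiffAt_const)))

theorem wirt_contDiff {c : ℂ} {j : Fin n} {f : Cn n → ℂ} {m k : WithTop ℕ∞}
    (hf : ContDiff ℝ k f) (h : m + 1 ≤ k) : ContDiff ℝ m (wirt c j f) :=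
  contDiff_iff_contDiffAt.2 fun _ => wirt_contDiffAt hf.contDiffAt h

theorem tsupport_wirt_subset (c : ℂ) (j : Fin n) (f : Cn n → ℂ) :
    tsupport (wirt c j f) ⊆ tsupport f := by
  refine closure_minimal (fun x hx => ?_) (isClosed_tsupport f)
  by_contra h
  apply hx
  have : fderiv ℝ f x = 0 := by
    by_contra h2
    exact h (support_fderiv_subset ℝ h2)
  simp [wirt, this]

theorem wirt_hasCompactSupport {c : ℂ} {j : Fin n} {f : Cn n → ℂ} (hf : HasCompactSupport f) :
    HasCompactSupport (wirt c j f) :=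
  hf.of_isClosed_subset (isClosed_tsupport _) (tsupport_wirt_subset c j f)

theorem fderiv_fderiv_apply {f : Cn n → ℂ} {z : Cn n} (hf : ContDiffAt ℝ 2 f z) (v w : Cn n) :
    fderiv ℝ (fun x => fderiv ℝ f x v) z w = fderiv ℝ (fderiv ℝ f) z w v := by
  have h1 : DifferentiableAt ℝ (fderiv ℝ f) z :=
    (hf.fderiv_right (m := 1) (by norm_num)).differentiableAt (by norm_num)
  rw [fderiv_clm_apply h1 (differentiableAt_const v)]
  simp

theorem wirt_comm {c d : ℂ} {j k : Fin n} {f : Cn n → ℂ} {z : Cn n} (hf : ContDiffAt ℝ 2 f z) :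
    wirt c j (wirt d k f) z = wirt d k (wirt c j f) z := by
  have h1 : DifferentiableAt ℝ (fderiv ℝ f) z :=
    (hf.fderiv_right (m := 1) (by norm_num)).differentiableAt (by norm_num)
  have h2 : ∀ v : Cn n, DifferentiableAt ℝ (fun x => fderiv ℝ f x v) z :=
    fun v => h1.clm_apply (differentiableAt_const v)
  have hs : IsSymmSndFDerivAt ℝ f z := hf.isSymmSndFDerivAt (by simp)
  have key : ∀ (d : ℂ) (k : Fin n) (w : Cn n), fderiv ℝ (wirt d k f) z w =
      (1 / 2) * (fderiv ℝ (fderiv ℝ f) z w (EuclideanSpace.single k 1)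
        + d * fderiv ℝ (fderiv ℝ f) z w (EuclideanSpace.single k Complex.I)) := by
    intro d k w
    unfold wirt
    have h3 := fun v : Cn n => (h2 v).hasFDerivAt
    have h4 := (((h3 (EuclideanSpace.single k 1)).fun_add
      ((h3 (EuclideanSpace.single k Complex.I)).const_mul d)).const_mul (1 / 2))
    rw [h4.fderiv]
    simp [fderiv_fderiv_apply hf]
    ring
  rw [wirt, key, key, wirt, key, key, hs.eq (EuclideanSpace.single j 1) (EuclideanSpace.single k 1),
    hs.eq (EuclideanSpace.single j 1) (EuclideanSpace.single k Complex.I),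
    hs.eq (EuclideanSpace.single j Complex.I) (EuclideanSpace.single k 1),
    hs.eq (EuclideanSpace.single j Complex.I) (EuclideanSpace.single k Complex.I)]
  ring

theorem conj_wirt (c : ℂ) (j : Fin n) (f : Cn n → ℂ) (z : Cn n) :
    (starRingEnd ℂ) (wirt c j f z) =
      wirt ((starRingEnd ℂ) c) j (fun x => (starRingEnd ℂ) (f x)) z := by
  have : fderiv ℝ (fun x => (starRingEnd ℂ) (f x)) z =
      (Complex.conjCLE : ℂ →L[ℝ] ℂ).comp (fderiv ℝ f z) := by
    have := Complex.conjCLE.comp_fderiv (f := f) (x := z)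
    exact this
  simp only [wirt, this, map_mul, map_add, map_div₀, map_one, map_ofNat]
  rfl

theorem wirt_comp_real {c : ℂ} {j : Fin n} {κ : ℝ → ℝ} {r : Cn n → ℝ} {z : Cn n}
    (hκ : DifferentiableAt ℝ κ (r z)) (hr : DifferentiableAt ℝ r z) :
    wirt c j (fun x => ((κ (r x) : ℝ) : ℂ)) z =
      ((deriv κ (r z) : ℝ) : ℂ) * wirt c j (fun x => (r x : ℂ)) z := by
  have h1 : HasFDerivAt (fun x => ((κ (r x) : ℝ) : ℂ))
      (Complex.ofRealCLM.comp (deriv κ (r z) • fderiv ℝ r z)) z :=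
    Complex.ofRealCLM.hasFDerivAt.comp z (hκ.hasDerivAt.comp_hasFDerivAt z hr.hasFDerivAt)
  have h2 : HasFDerivAt (fun x => (r x : ℂ)) (Complex.ofRealCLM.comp (fderiv ℝ r z)) z :=
    Complex.ofRealCLM.hasFDerivAt.comp z hr.hasFDerivAt
  simp only [wirt, h1.fderiv, h2.fderiv]
  simp
  ring

/-! ### The complex Hessian matrix -/

/-- The matrix of second derivatives `∂²f/∂z_j∂z̄_k`. -/
def hess (f : Cn n → ℝ) (z : Cn n) : Matrix (Fin n) (Fin n) ℂ :=
  fun j k => wirt (-Complex.I) j (wirt Complex.I k (fun ζ => (f ζ : ℂ))) z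

/-- The sesquilinear form attached to a matrix. -/
def sesq (A : Matrix (Fin n) (Fin n) ℂ) (v w : Cn n) : ℂ :=
  ∑ j, ∑ k, A j k * v j * (starRingEnd ℂ) (w k)

/-- The gradient `(∂f/∂z_j)_j` of a real function. -/
def grad (f : Cn n → ℝ) (z : Cn n) : Fin n → ℂ :=
  fun j => wirt (-Complex.I) j (fun ζ => (f ζ : ℂ)) z

theorem complexHessian_eq_sesq (f : Cn n → ℝ) (z v w : Cn n) :
    complexHessian f z v w = sesq (hess f z) v w := by
  simp only [complexHessian, sesq, hess, dz_eq_wirt, dzbar_eq_wirt]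

theorem delForm_eq_grad (f : Cn n → ℝ) (z v : Cn n) : delForm f z v = ∑ j, grad f z j * v j := by
  simp only [delForm, grad, dz_eq_wirt]

theorem wirt_I_eq_conj_grad (f : Cn n → ℝ) (z : Cn n) (k : Fin n) :
    wirt Complex.I k (fun ζ => (f ζ : ℂ)) z = (starRingEnd ℂ) (grad f z k) := by
  simp [grad, conj_wirt]

theorem ofReal_contDiffAt {f : Cn n → ℝ} {z : Cn n} {k : WithTop ℕ∞} (hf : ContDiffAt ℝ k f z) :
    ContDiffAt ℝ k (fun ζ => (f ζ : ℂ)) z :=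
  Complex.ofRealCLM.contDiff.contDiffAt.comp z hf

theorem hess_congr {f g : Cn n → ℝ} {z : Cn n} (h : f =ᶠ[𝓝 z] g) : hess f z = hess g z := by
  ext j k
  exact wirt_congr (wirt_eventuallyEq (h.fun_comp (fun x : ℝ => (x : ℂ))))

theorem hess_isHermitian {f : Cn n → ℝ} {z : Cn n} (hf : ContDiffAt ℝ 2 f z) :
    (hess f z).IsHermitian := by
  ext j k
  rw [Matrix.conjTranspose_apply, hess, RCLike.star_def, conj_wirt]
  simp only [conj_wirt, map_neg, Complex.conj_I, neg_neg, Complex.conj_ofReal]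
  exact (wirt_comm (ofReal_contDiffAt hf)).symm

theorem hess_contDiffAt {f : Cn n → ℝ} {z : Cn n} {m k : WithTop ℕ∞} (hf : ContDiffAt ℝ k f z)
    (h : m + 1 + 1 ≤ k) (i j : Fin n) : ContDiffAt ℝ m (fun z => hess f z i j) z :=
  wirt_contDiffAt (wirt_contDiffAt (ofReal_contDiffAt hf) h) le_rfl

theorem grad_contDiffAt {f : Cn n → ℝ} {z : Cn n} {m k : WithTop ℕ∞} (hf : ContDiffAt ℝ k f z)
    (h : m + 1 ≤ k) (j : Fin n) : ContDiffAt ℝ m (fun z => grad f z j) z :=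
  wirt_contDiffAt (ofReal_contDiffAt hf) h

theorem eventually_diffAt {f : Cn n → ℝ} {z : Cn n} (hf : ContDiffAt ℝ 2 f z) :
    ∀ᶠ x in 𝓝 z, ContDiffAt ℝ 2 f x := hf.eventually (by simp)

theorem hess_add {f g : Cn n → ℝ} {z : Cn n} (hf : ContDiffAt ℝ 2 f z) (hg : ContDiffAt ℝ 2 g z) :
    hess (fun x => f x + g x) z = hess f z + hess g z := by
  ext j k
  have h1 : wirt Complex.I k (fun x => ((f x + g x : ℝ) : ℂ)) =ᶠ[𝓝 z]
      fun x => wirt Complex.I k (fun x => (f x : ℂ)) x + wirt Complex.I k (fun x => (g x : ℂ)) x := by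
    filter_upwards [eventually_diffAt hf, eventually_diffAt hg] with x hx hy
    simp only [Complex.ofReal_add]
    exact wirt_add ((ofReal_contDiffAt hx).differentiableAt (by norm_num))
      ((ofReal_contDiffAt hy).differentiableAt (by norm_num))
  rw [hess, wirt_congr h1, wirt_add]
  · rfl
  · exact (wirt_contDiffAt (m := 1) (ofReal_contDiffAt hf) (by norm_num)).differentiableAt
      (by norm_num)
  · exact (wirt_contDiffAt (m := 1) (ofReal_contDiffAt hg) (by norm_num)).differentiableAt
      (by norm_num)

theorem hess_mul {f g : Cn n → ℝ} {z : Cn n} (hf : ContDiffAt ℝ 2 f z) (hg : ContDiffAt ℝ 2 g z)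
    (j k : Fin n) :
    hess (fun x => f x * g x) z j k = f z * hess g z j k + g z * hess f z j k
      + grad f z j * (starRingEnd ℂ) (grad g z k) + grad g z j * (starRingEnd ℂ) (grad f z k) := by
  have h1 : wirt Complex.I k (fun x => ((f x * g x : ℝ) : ℂ)) =ᶠ[𝓝 z]
      fun x => (f x : ℂ) * wirt Complex.I k (fun x => (g x : ℂ)) x
        + (g x : ℂ) * wirt Complex.I k (fun x => (f x : ℂ)) x := by
    filter_upwards [eventually_diffAt hf, eventually_diffAt hg] with x hx hy
    simp only [Complex.ofReal_mul]
    exact wirt_mul ((ofReal_contDiffAt hx).differentiableAt (by norm_num))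
      ((ofReal_contDiffAt hy).differentiableAt (by norm_num))
  have e1 := (ofReal_contDiffAt hf).differentiableAt (by norm_num)
  have e2 := (ofReal_contDiffAt hg).differentiableAt (by norm_num)
  have e3 := (wirt_contDiffAt (m := 1) (c := Complex.I) (j := k) (ofReal_contDiffAt hf)
    (by norm_num)).differentiableAt (by norm_num)
  have e4 := (wirt_contDiffAt (m := 1) (c := Complex.I) (j := k) (ofReal_contDiffAt hg)
    (by norm_num)).differentiableAt (by norm_num)
  rw [hess, wirt_congr h1, wirt_add (e1.fun_mul e4) (e2.fun_mul e3), wirt_mul e1 e4, wirt_mul e2 e3,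
    wirt_I_eq_conj_grad, wirt_I_eq_conj_grad]
  simp only [hess, grad]
  ring

theorem grad_comp {κ : ℝ → ℝ} {r : Cn n → ℝ} {z : Cn n} (hκ : DifferentiableAt ℝ κ (r z))
    (hr : DifferentiableAt ℝ r z) (j : Fin n) :
    grad (fun x => κ (r x)) z j = ((deriv κ (r z) : ℝ) : ℂ) * grad r z j :=
  wirt_comp_real hκ hr

theorem hess_comp {κ : ℝ → ℝ} {r : Cn n → ℝ} {z : Cn n} (hκ : ContDiff ℝ 2 κ)
    (hr : ContDiffAt ℝ 2 r z) (j k : Fin n) :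
    hess (fun x => κ (r x)) z j k = ((deriv κ (r z) : ℝ) : ℂ) * hess r z j k
      + ((deriv (deriv κ) (r z) : ℝ) : ℂ) * (grad r z j * (starRingEnd ℂ) (grad r z k)) := by
  have hκ' : ContDiff ℝ 1 (deriv κ) := hκ.deriv'
  have h1 : wirt Complex.I k (fun x => ((κ (r x) : ℝ) : ℂ)) =ᶠ[𝓝 z]
      fun x => ((deriv κ (r x) : ℝ) : ℂ) * wirt Complex.I k (fun x => (r x : ℂ)) x := by
    filter_upwards [eventually_diffAt hr] with x hx
    exact wirt_comp_real (hκ.differentiable (by norm_num) _) (hx.differentiableAt (by norm_num))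
  have e0 := hr.differentiableAt (by norm_num)
  have e1 : DifferentiableAt ℝ (fun x => ((deriv κ (r x) : ℝ) : ℂ)) z :=
    Complex.ofRealCLM.differentiableAt.comp z
      ((hκ'.differentiable (by norm_num) _).comp z e0)
  have e3 := (wirt_contDiffAt (m := 1) (c := Complex.I) (j := k) (ofReal_contDiffAt hr)
    (by norm_num)).differentiableAt (by norm_num)
  rw [hess, wirt_congr h1, wirt_mul e1 e3,
    wirt_comp_real (hκ'.differentiable (by norm_num) _) e0, wirt_I_eq_conj_grad]
  simp only [hess, grad]
  ring

/-! ### Holomorphic changes of coordinates -/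

/-- The left side is the antilinear part of ℓ up to a factor 2: replacing w by iw multiplies it by
-i. It is therefore determined by its values on the complex basis. -/
theorem clm_wirt_eq_sum (ℓ : Cn n →L[ℝ] ℂ) (w : Cn n) :
    ℓ w + Complex.I * ℓ (Complex.I • w) = ∑ m, (starRingEnd ℂ) (w m) *
      (ℓ (EuclideanSpace.single m 1) + Complex.I * ℓ (EuclideanSpace.single m Complex.I)) := by
  have key : ∀ w : Cn n, ℓ w = ∑ m, ((w m).re * ℓ (EuclideanSpace.single m 1)
      + (w m).im * ℓ (EuclideanSpace.single m Complex.I)) := by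
    intro w
    have : w = ∑ m, ((w m).re • (EuclideanSpace.single m (1 : ℂ) : Cn n)
        + (w m).im • (EuclideanSpace.single m Complex.I : Cn n)) := by
      ext i
      simp [Finset.sum_add_distrib, Pi.single_apply, Complex.re_add_im]
    conv_lhs => rw [this]
    simp [map_sum]
  rw [key w, key (Complex.I • w), Finset.mul_sum, ← Finset.sum_add_distrib]
  refine Finset.sum_congr rfl fun m _ => ?_
  have : (starRingEnd ℂ) (w m) = (w m).re - (w m).im * Complex.I := by
    apply Complex.ext <;> simp
  rw [this]
  simp
  ring_nf
  simp

theorem clm_wirt_neg_eq_sum (ℓ : Cn n →L[ℝ] ℂ) (w : Cn n) :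
    ℓ w + -Complex.I * ℓ (Complex.I • w) = ∑ m, w m *
      (ℓ (EuclideanSpace.single m 1) + -Complex.I * ℓ (EuclideanSpace.single m Complex.I)) := by
  have h := congrArg (starRingEnd ℂ)
    (clm_wirt_eq_sum ((Complex.conjCLE : ℂ →L[ℝ] ℂ).comp ℓ) w)
  simpa using h

theorem single_I_eq (k : Fin n) :
    (EuclideanSpace.single k Complex.I : Cn n) = Complex.I • EuclideanSpace.single k (1 : ℂ) := by
  ext i
  simp

theorem fderiv_comp_holo {T : Cn n → Cn n} {g : Cn n → ℂ} {z : Cn n}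
    (hT : DifferentiableAt ℂ T z) (hg : DifferentiableAt ℝ g (T z)) (v : Cn n) :
    fderiv ℝ (fun x => g (T x)) z v = fderiv ℝ g (T z) (fderiv ℂ T z v) := by
  have h := hg.hasFDerivAt.comp z (hT.hasFDerivAt.restrictScalars ℝ)
  rw [show (fun x => g (T x)) = g ∘ T from rfl, h.fderiv]
  rfl

theorem wirt_I_comp_holo {T : Cn n → Cn n} {g : Cn n → ℂ} {z : Cn n}
    (hT : DifferentiableAt ℂ T z) (hg : DifferentiableAt ℝ g (T z)) (k : Fin n) :
    wirt Complex.I k (fun x => g (T x)) z = ∑ m,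
      (starRingEnd ℂ) (fderiv ℂ T z (EuclideanSpace.single k 1) m) * wirt Complex.I m g (T z) := by
  simp only [wirt, fderiv_comp_holo hT hg]
  rw [single_I_eq, map_smul, clm_wirt_eq_sum, Finset.mul_sum]
  exact Finset.sum_congr rfl fun m _ => by ring

theorem wirt_neg_I_comp_holo {T : Cn n → Cn n} {g : Cn n → ℂ} {z : Cn n}
    (hT : DifferentiableAt ℂ T z) (hg : DifferentiableAt ℝ g (T z)) (k : Fin n) :
    wirt (-Complex.I) k (fun x => g (T x)) z = ∑ m,
      fderiv ℂ T z (EuclideanSpace.single k 1) m * wirt (-Complex.I) m g (T z) := by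
  simp only [wirt, fderiv_comp_holo hT hg]
  rw [single_I_eq, map_smul, clm_wirt_neg_eq_sum, Finset.mul_sum]
  exact Finset.sum_congr rfl fun m _ => by ring

/-- ∂ annihilates antiholomorphic functions. This removes the second derivatives of T from the
transformation law of the complex Hessian, which is thus tensorial. -/
theorem wirt_neg_I_conj_holo {g : Cn n → ℂ} {z : Cn n} (hg : DifferentiableAt ℂ g z) (k : Fin n) :
    wirt (-Complex.I) k (fun x => (starRingEnd ℂ) (g x)) z = 0 := by
  have h := conj_wirt Complex.I k g z
  rw [Complex.conj_I] at h
  rw [← h, wirt, (hg.hasFDerivAt.restrictScalars ℝ).fderiv]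
  simp only [single_I_eq, ContinuousLinearMap.coe_restrictScalars', map_smul, smul_eq_mul]
  rw [← mul_assoc, Complex.I_mul_I]
  simp

/-- Transformation of the complex Hessian under a holomorphic map. -/
theorem hess_comp_holo {T : Cn n → Cn n} {f : Cn n → ℝ} {z : Cn n} (hT : ContDiffAt ℂ 2 T z)
    (hf : ContDiffAt ℝ 2 f (T z)) (j k : Fin n) :
    hess (fun x => f (T x)) z j k = ∑ b, ∑ a,
      fderiv ℂ T z (EuclideanSpace.single j 1) a * hess f (T z) a b *
        (starRingEnd ℂ) (fderiv ℂ T z (EuclideanSpace.single k 1) b) := by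
  have hT1 : DifferentiableAt ℂ T z := hT.differentiableAt (by norm_num)
  have h1 : wirt Complex.I k (fun x => (f (T x) : ℂ)) =ᶠ[𝓝 z] fun x => ∑ m,
      (starRingEnd ℂ) (fderiv ℂ T x (EuclideanSpace.single k 1) m) *
        wirt Complex.I m (fun ζ => (f ζ : ℂ)) (T x) := by
    filter_upwards [hT.eventually (by simp), hT.continuousAt.eventually (eventually_diffAt hf)]
      with x hx hy
    exact wirt_I_comp_holo (g := fun ζ => (f ζ : ℂ)) (hx.differentiableAt (by norm_num))
      ((ofReal_contDiffAt hy).differentiableAt (by norm_num)) k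
  have e1 : ∀ m, DifferentiableAt ℂ (fun x => fderiv ℂ T x (EuclideanSpace.single k 1) m) z := by
    intro m
    have h2 : DifferentiableAt ℂ (fun x => fderiv ℂ T x (EuclideanSpace.single k 1)) z :=
      ((hT.fderiv_right (m := 1) (by norm_num)).differentiableAt (by norm_num)).clm_apply
        (differentiableAt_const _)
    exact (EuclideanSpace.proj (𝕜 := ℂ) m).differentiableAt.comp z h2
  have e2 : ∀ m, DifferentiableAt ℝ
      (fun x => (starRingEnd ℂ) (fderiv ℂ T x (EuclideanSpace.single k 1) m)) z := fun m =>
    (Complex.conjCLE.toContinuousLinearMap.differentiableAt).comp z ((e1 m).restrictScalars ℝ)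
  have e3 : ∀ m, DifferentiableAt ℝ (wirt Complex.I m (fun ζ => (f ζ : ℂ))) (T z) := fun m =>
    (wirt_contDiffAt (m := 1) (ofReal_contDiffAt hf) (by norm_num)).differentiableAt (by norm_num)
  have e4 : ∀ m, DifferentiableAt ℝ (fun x => wirt Complex.I m (fun ζ => (f ζ : ℂ)) (T x)) z :=
    fun m => (e3 m).comp z (hT1.restrictScalars ℝ)
  rw [hess, wirt_congr h1, wirt_sum _ fun m _ => (e2 m).fun_mul (e4 m)]
  refine Finset.sum_congr rfl fun b _ => ?_
  rw [wirt_mul (e2 b) (e4 b), wirt_neg_I_conj_holo (e1 b), mul_zero, add_zero,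
    wirt_neg_I_comp_holo hT1 (e3 b), Finset.mul_sum]
  refine Finset.sum_congr rfl fun a _ => ?_
  rw [hess]
  ring

/-! ### Mixed discriminants -/

/-- The mixed discriminant (up to the factor `n!`) of `n` complex `n × n` matrices. -/
def mixedDisc (A : Fin n → Matrix (Fin n) (Fin n) ℂ) : ℂ :=
  ∑ τ : Equiv.Perm (Fin n), ∑ σ : Equiv.Perm (Fin n),
    ((Equiv.Perm.sign τ : ℤ) : ℂ) * ((Equiv.Perm.sign σ : ℤ) : ℂ) * ∏ i, A i (σ i) (τ i)

/-- For fixed τ the i-th column is column τ i of A i. When A i is the Hessian of u_i, it consists of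
the ∂-derivatives of ∂̄_(τ i) u_i, so each determinant is built from first derivatives of n
functions. The companion expansion below plays the same role for ∂̄. -/
theorem mixedDisc_eq_sum_det (A : Fin n → Matrix (Fin n) (Fin n) ℂ) :
    mixedDisc A = ∑ τ : Equiv.Perm (Fin n), ((Equiv.Perm.sign τ : ℤ) : ℂ) *
      Matrix.det (Matrix.of fun j i => A i j (τ i)) := by
  simp only [mixedDisc, Matrix.det_apply', Matrix.of_apply, Finset.mul_sum, mul_assoc]

theorem mixedDisc_eq_sum_det' (A : Fin n → Matrix (Fin n) (Fin n) ℂ) :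
    mixedDisc A = ∑ σ : Equiv.Perm (Fin n), ((Equiv.Perm.sign σ : ℤ) : ℂ) *
      Matrix.det (Matrix.of fun k i => A i (σ i) k) := by
  simp only [mixedDisc, Matrix.det_apply', Matrix.of_apply, Finset.mul_sum]
  rw [Finset.sum_comm]
  refine Finset.sum_congr rfl fun _ _ => Finset.sum_congr rfl fun _ _ => by ring

theorem mixedDisc_update_add (A : Fin n → Matrix (Fin n) (Fin n) ℂ) (i : Fin n)
    (B C : Matrix (Fin n) (Fin n) ℂ) :
    mixedDisc (Function.update A i (B + C)) =
      mixedDisc (Function.update A i B) + mixedDisc (Function.update A i C) := by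
  have key : ∀ (B : Matrix (Fin n) (Fin n) ℂ) (σ τ : Equiv.Perm (Fin n)),
      ∏ k, Function.update A i B k (σ k) (τ k) =
        B (σ i) (τ i) * ∏ k ∈ Finset.univ.erase i, A k (σ k) (τ k) := by
    intro B σ τ
    rw [← Finset.mul_prod_erase _ _ (Finset.mem_univ i)]
    congr 1
    · simp
    · exact Finset.prod_congr rfl fun k hk => by
        rw [Function.update_of_ne (Finset.ne_of_mem_erase hk)]
  simp only [mixedDisc, key, ← Finset.sum_add_distrib, Matrix.add_apply]
  refine Finset.sum_congr rfl fun _ _ => Finset.sum_congr rfl fun _ _ => by ring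

theorem mixedDisc_update_smul (A : Fin n → Matrix (Fin n) (Fin n) ℂ) (i : Fin n)
    (c : ℂ) (B : Matrix (Fin n) (Fin n) ℂ) :
    mixedDisc (Function.update A i (c • B)) = c * mixedDisc (Function.update A i B) := by
  have key : ∀ (B : Matrix (Fin n) (Fin n) ℂ) (σ τ : Equiv.Perm (Fin n)),
      ∏ k, Function.update A i B k (σ k) (τ k) =
        B (σ i) (τ i) * ∏ k ∈ Finset.univ.erase i, A k (σ k) (τ k) := by
    intro B σ τ
    rw [← Finset.mul_prod_erase _ _ (Finset.mem_univ i)]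
    congr 1
    · simp
    · exact Finset.prod_congr rfl fun k hk => by
        rw [Function.update_of_ne (Finset.ne_of_mem_erase hk)]
  simp only [mixedDisc, key, Finset.mul_sum, Matrix.smul_apply, smul_eq_mul]
  refine Finset.sum_congr rfl fun _ _ => Finset.sum_congr rfl fun _ _ => by ring

/-- With the version for right multiplication, this gives the factor |det J|² when every Hessian is
replaced by J A J*. -/
theorem mixedDisc_mul_left (P : Matrix (Fin n) (Fin n) ℂ) (A : Fin n → Matrix (Fin n) (Fin n) ℂ) :
    mixedDisc (fun i => P * A i) = P.det * mixedDisc A := by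
  simp only [mixedDisc_eq_sum_det, Finset.mul_sum]
  refine Finset.sum_congr rfl fun τ _ => ?_
  have : Matrix.of (fun j i => (P * A i) j (τ i)) =
      P * Matrix.of (fun j i => A i j (τ i)) := by
    ext j i; simp [Matrix.mul_apply]
  rw [this, Matrix.det_mul]
  ring

theorem mixedDisc_mul_right (A : Fin n → Matrix (Fin n) (Fin n) ℂ) (Q : Matrix (Fin n) (Fin n) ℂ) :
    mixedDisc (fun i => A i * Q) = Q.det * mixedDisc A := by
  simp only [mixedDisc_eq_sum_det', Finset.mul_sum]
  refine Finset.sum_congr rfl fun σ _ => ?_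
  have : Matrix.of (fun k i => (A i * Q) (σ i) k) =
      Q.transpose * Matrix.of (fun k i => A i (σ i) k) := by
    ext j i; simp [Matrix.mul_apply, mul_comm]
  rw [this, Matrix.det_mul, Matrix.det_transpose]
  ring

theorem mixedDisc_const (A : Matrix (Fin n) (Fin n) ℂ) :
    mixedDisc (fun _ => A) = n.factorial * A.det := by
  have h : ∀ τ : Equiv.Perm (Fin n), ((Equiv.Perm.sign τ : ℤ) : ℂ) *
      Matrix.det (Matrix.of fun j i => A j (τ i)) = A.det := by
    intro τ
    have := Matrix.det_permute' τ A
    rw [show Matrix.of (fun j i => A j (τ i)) = A.submatrix id τ from rfl, this,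
      ← mul_assoc, ← Int.cast_mul, ← Units.val_mul, Int.units_mul_self]
    simp
  rw [mixedDisc_eq_sum_det]
  simp only [h]
  simp [Fintype.card_perm]

/-- The mixed discriminant of positive semidefinite matrices is nonnegative. -/
theorem mixedDisc_re_nonneg {A : Fin n → Matrix (Fin n) (Fin n) ℂ} (hA : ∀ i, (A i).PosSemidef) :
    0 ≤ (mixedDisc A).re := by
  have h : ∀ i, ∃ B : Matrix (Fin n) (Fin n) ℂ, A i = B.conjTranspose * B := fun i => by
    obtain ⟨B, hB⟩ := CStarAlgebra.nonneg_iff_eq_star_mul_self.mp ((hA i).nonneg)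
    exact ⟨B, hB⟩
  choose B hB using h
  -- B*B is a sum of rank-one matrices, one for each row of B. Choosing a row κ i of B i in each
  -- slot and expanding gives a sum of squared moduli of determinants.
  have key : mixedDisc A = ∑ κ ∈ Fintype.piFinset (fun _ : Fin n => (Finset.univ : Finset (Fin n))),
      star (Matrix.det (Matrix.of fun j i => B i (κ i) j)) * Matrix.det (Matrix.of fun j i => B i (κ i) j) := by
    simp only [Matrix.det_apply', Matrix.of_apply, mixedDisc, hB, Matrix.mul_apply, Matrix.conjTranspose_apply,
      star_sum, Finset.prod_univ_sum, Finset.mul_sum]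
    rw [Finset.sum_comm]
    simp_rw [Finset.sum_comm (s := Finset.univ) (t := Fintype.piFinset _)]
    refine Finset.sum_congr rfl fun κ _ => ?_
    rw [Finset.sum_comm]
    refine Finset.sum_congr rfl fun τ _ => ?_
    rw [Finset.sum_mul]
    refine Finset.sum_congr rfl fun σ _ => ?_
    rw [Finset.prod_mul_distrib]
    simp only [star_mul', star_prod, RCLike.star_def, map_intCast]
    ring
  rw [key, Complex.re_sum]
  refine Finset.sum_nonneg fun κ _ => ?_
  rw [RCLike.star_def, mul_comm, Complex.mul_conj]
  simp [Complex.normSq_nonneg]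

/-- Monotonicity of the mixed discriminant in one entry. -/
theorem mixedDisc_abs_le {A : Fin n → Matrix (Fin n) (Fin n) ℂ} (i : Fin n)
    {B C : Matrix (Fin n) (Fin n) ℂ} (hA : ∀ k, k ≠ i → (A k).PosSemidef)
    (h1 : (C - B).PosSemidef) (h2 : (C + B).PosSemidef) :
    |(mixedDisc (Function.update A i B)).re| ≤ (mixedDisc (Function.update A i C)).re := by
  have key : ∀ D : Matrix (Fin n) (Fin n) ℂ, D.PosSemidef →
      0 ≤ (mixedDisc (Function.update A i D)).re := by
    intro D hD
    refine mixedDisc_re_nonneg fun k => ?_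
    by_cases hk : k = i
    · subst hk; simpa using hD
    · rw [Function.update_of_ne hk]; exact hA k hk
  have e1 := key _ h1
  have e2 := key _ h2
  rw [sub_eq_add_neg, ← neg_one_smul ℂ B, mixedDisc_update_add, mixedDisc_update_smul] at e1
  rw [mixedDisc_update_add] at e2
  simp at e1 e2
  rw [abs_le]
  constructor <;> linarith

/-- `sesq` is linear in the vector paired with the row index, whereas star x ⬝ᵥ A x is antilinear
there; hence the conjugated vector. -/
theorem star_dotProduct_mulVec_eq_sesq (A : Matrix (Fin n) (Fin n) ℂ) (x : Fin n → ℂ) :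
    star x ⬝ᵥ A.mulVec x = sesq A (WithLp.toLp 2 (star x)) (WithLp.toLp 2 (star x)) := by
  simp only [sesq, dotProduct, Matrix.mulVec, Finset.mul_sum, Pi.star_apply, RCLike.star_def,
    Complex.conj_conj]
  exact Finset.sum_congr rfl fun _ _ => Finset.sum_congr rfl fun _ _ => by ring

theorem posSemidef_of_sesq {A : Matrix (Fin n) (Fin n) ℂ} (hA : A.IsHermitian)
    (h : ∀ v : Cn n, 0 ≤ (sesq A v v).re) : A.PosSemidef := by
  refine Matrix.PosSemidef.of_dotProduct_mulVec_nonneg hA fun x => ?_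
  rw [Complex.le_def]
  refine ⟨?_, by simpa using (hA.im_star_dotProduct_mulVec_self x).symm⟩
  rw [star_dotProduct_mulVec_eq_sesq]
  exact h _

theorem posDef_of_sesq {A : Matrix (Fin n) (Fin n) ℂ} (hA : A.IsHermitian)
    (h : ∀ v : Cn n, v ≠ 0 → 0 < (sesq A v v).re) : A.PosDef := by
  refine Matrix.PosDef.of_dotProduct_mulVec_pos hA fun x hx => ?_
  rw [Complex.lt_def]
  refine ⟨?_, by simpa using (hA.im_star_dotProduct_mulVec_self x).symm⟩
  rw [star_dotProduct_mulVec_eq_sesq]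
  refine h _ fun h0 => hx ?_
  have := congrArg WithLp.ofLp h0
  simpa using this

theorem sesq_add (A B : Matrix (Fin n) (Fin n) ℂ) (v w : Cn n) :
    sesq (A + B) v w = sesq A v w + sesq B v w := by
  simp only [sesq, Matrix.add_apply, ← Finset.sum_add_distrib]
  exact Finset.sum_congr rfl fun _ _ => Finset.sum_congr rfl fun _ _ => by ring

theorem sesq_sub (A B : Matrix (Fin n) (Fin n) ℂ) (v w : Cn n) :
    sesq (A - B) v w = sesq A v w - sesq B v w := by
  simp only [sesq, Matrix.sub_apply, ← Finset.sum_sub_distrib]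
  exact Finset.sum_congr rfl fun _ _ => Finset.sum_congr rfl fun _ _ => by ring

theorem sesq_smul (c : ℂ) (A : Matrix (Fin n) (Fin n) ℂ) (v w : Cn n) :
    sesq (c • A) v w = c * sesq A v w := by
  simp only [sesq, Matrix.smul_apply, smul_eq_mul, Finset.mul_sum, mul_assoc]

theorem sesq_vecMulVec (a b : Fin n → ℂ) (v w : Cn n) :
    sesq (Matrix.vecMulVec a (fun k => (starRingEnd ℂ) (b k))) v w =
      (∑ j, a j * v j) * (starRingEnd ℂ) (∑ k, b k * w k) := by
  simp only [sesq, Matrix.vecMulVec_apply, map_sum, map_mul, Finset.sum_mul_sum]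
  exact Finset.sum_congr rfl fun _ _ => Finset.sum_congr rfl fun _ _ => by ring

theorem sesq_one (v : Cn n) : sesq 1 v v = ((‖v‖ ^ 2 : ℝ) : ℂ) := by
  simp only [sesq, Matrix.one_apply, ite_mul, one_mul, zero_mul, Finset.sum_ite_eq,
    Finset.mem_univ, if_true, Complex.mul_conj, Complex.normSq_eq_norm_sq]
  rw [EuclideanSpace.norm_sq_eq]
  push_cast
  rfl

/-! ### Integration by parts -/

theorem wirt_prod {ι : Type*} [DecidableEq ι] {c : ℂ} {j : Fin n} (s : Finset ι)
    {f : ι → Cn n → ℂ} {z : Cn n} (hf : ∀ i ∈ s, DifferentiableAt ℝ (f i) z) :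
    wirt c j (fun x => ∏ i ∈ s, f i x) z =
      ∑ k ∈ s, (∏ i ∈ s.erase k, f i z) * wirt c j (f k) z := by
  have h := HasFDerivAt.finsetProd (u := s) (g := f) (x := z)
    (fun i hi => (hf i hi).hasFDerivAt)
  have h' : fderiv ℝ (fun x => ∏ i ∈ s, f i x) z =
      ∑ i ∈ s, (∏ j ∈ s.erase i, f j z) • fderiv ℝ (f i) z := h.fderiv
  simp only [wirt, h', FunLike.coe_sum, Finset.sum_apply, FunLike.coe_smul, Pi.smul_apply,
    smul_eq_mul, Finset.mul_sum, ← Finset.sum_add_distrib]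
  exact Finset.sum_congr rfl fun _ _ => by ring

theorem wirt_continuous {c : ℂ} {j : Fin n} {f : Cn n → ℂ} (hf : ContDiff ℝ 1 f) :
    Continuous (wirt c j f) :=
  (wirt_contDiff (m := 0) hf (by norm_num)).continuous

theorem integral_mul_wirt {c : ℂ} {j : Fin n} {P F : Cn n → ℂ} (hP : ContDiff ℝ 1 P)
    (hF : ContDiff ℝ 1 F) (hs : HasCompactSupport F) :
    ∫ z, P z * wirt c j F z = -∫ z, wirt c j P z * F z := by
  have hF' := hF.continuous_fderiv (by norm_num)
  have hP' := hP.continuous_fderiv (by norm_num)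
  have i1 : ∀ v : Cn n, Integrable (fun x => fderiv ℝ P x v * F x) := fun v =>
    ((hP'.clm_apply continuous_const).mul hF.continuous).integrable_of_hasCompactSupport
      hs.mul_left
  have i2 : ∀ v : Cn n, Integrable (fun x => P x * fderiv ℝ F x v) := fun v =>
    (hP.continuous.mul (hF'.clm_apply continuous_const)).integrable_of_hasCompactSupport
      ((hs.fderiv_apply ℝ v).mul_left)
  have i3 : Integrable (fun x => P x * F x) :=
    (hP.continuous.mul hF.continuous).integrable_of_hasCompactSupport hs.mul_left
  have key : ∀ v : Cn n, ∫ x, P x * fderiv ℝ F x v = -∫ x, fderiv ℝ P x v * F x := fun v =>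
    integral_mul_fderiv_eq_neg_fderiv_mul_of_integrable (i1 v) (i2 v) i3
      (fun x _ => hP.differentiable (by norm_num) x)
      (fun x _ => hF.differentiable (by norm_num) x)
  have e1 : ∀ z, P z * wirt c j F z = (1 / 2) * (P z * fderiv ℝ F z (EuclideanSpace.single j 1))
      + (1 / 2 * c) * (P z * fderiv ℝ F z (EuclideanSpace.single j Complex.I)) := by
    intro z; simp only [wirt]; ring
  have e2 : ∀ z, wirt c j P z * F z = (1 / 2) * (fderiv ℝ P z (EuclideanSpace.single j 1) * F z)
      + (1 / 2 * c) * (fderiv ℝ P z (EuclideanSpace.single j Complex.I) * F z) := by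
    intro z; simp only [wirt]; ring
  simp only [e1, e2]
  rw [integral_add ((i2 _).const_mul _) ((i2 _).const_mul _),
    integral_add ((i1 _).const_mul _) ((i1 _).const_mul _), integral_const_mul, integral_const_mul,
    integral_const_mul, integral_const_mul, key, key]
  ring

/-- The Piola identity: cofactors are divergence free. In the term where the product rule hits the
factor k, composing σ with the transposition of i₀ and k leaves the product unchanged, because
second derivatives commute, and reverses the sign. -/
theorem sum_sign_wirt_prod_eq_zero (c : ℂ) (g : Fin n → Cn n → ℂ)
    (hg : ∀ i, ContDiff ℝ 2 (g i)) (i₀ : Fin n) (z : Cn n) :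
    ∑ σ : Equiv.Perm (Fin n), ((Equiv.Perm.sign σ : ℤ) : ℂ) *
      wirt c (σ i₀) (fun x => ∏ i ∈ Finset.univ.erase i₀, wirt c (σ i) (g i) x) z = 0 := by
  have hd : ∀ (σ : Equiv.Perm (Fin n)) (i : Fin n), DifferentiableAt ℝ (wirt c (σ i) (g i)) z :=
    fun σ i => (wirt_contDiff (m := 1) (hg i) (by norm_num)).differentiable (by norm_num) z
  simp only [wirt_prod _ fun i _ => hd _ i, Finset.mul_sum]
  rw [Finset.sum_comm]
  refine Finset.sum_eq_zero fun k hk => ?_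
  have hk0 : k ≠ i₀ := Finset.ne_of_mem_erase hk
  have hneg : ∀ S : ℂ, S = -S → S = 0 := fun S h => by
    have : (2 : ℂ) * S = 0 := by linear_combination h
    simpa using this
  apply hneg
  rw [← Finset.sum_neg_distrib]
  conv_lhs => rw [← Equiv.sum_comp (Equiv.mulRight (Equiv.swap i₀ k))]
  refine Finset.sum_congr rfl fun σ _ => ?_
  simp only [Equiv.coe_mulRight, Equiv.Perm.coe_mul, Function.comp_apply, Equiv.swap_apply_left,
    Equiv.swap_apply_right, Equiv.Perm.sign_mul, Equiv.Perm.sign_swap hk0.symm]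
  rw [wirt_comm (hg k).contDiffAt]
  have : ∏ i ∈ (Finset.univ.erase i₀).erase k, wirt c (σ (Equiv.swap i₀ k i)) (g i) z =
      ∏ i ∈ (Finset.univ.erase i₀).erase k, wirt c (σ i) (g i) z := by
    refine Finset.prod_congr rfl fun i hi => ?_
    simp only [Finset.mem_erase] at hi
    rw [Equiv.swap_apply_of_ne_of_ne hi.2.1 hi.1]
  rw [this]
  simp

/-- Expanding the determinant and moving the derivative off g i₀ leaves the divergence of a
cofactor, which vanishes. Compact support of the single function g i₀ removes the boundary terms. -/
theorem integral_det_wirt_of_contDiff_two (c : ℂ) (i₀ : Fin n) {g : Fin n → Cn n → ℂ}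
    (hg : ∀ i, ContDiff ℝ 2 (g i)) (hs : HasCompactSupport (g i₀)) :
    ∫ z, Matrix.det (Matrix.of fun j i => wirt c j (g i) z) = 0 := by
  have hg1 : ∀ i, ContDiff ℝ 1 (g i) := fun i => (hg i).of_le (by norm_num)
  have hw : ∀ j i, ContDiff ℝ 1 (wirt c j (g i)) := fun j i =>
    wirt_contDiff (hg i) (by norm_num)
  have hP : ∀ σ : Equiv.Perm (Fin n), ContDiff ℝ 1
      (fun x => ∏ i ∈ Finset.univ.erase i₀, wirt c (σ i) (g i) x) := fun σ =>
    contDiff_prod fun i _ => hw _ i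
  have e1 : ∀ z, Matrix.det (Matrix.of fun j i => wirt c j (g i) z) =
      ∑ σ : Equiv.Perm (Fin n), ((Equiv.Perm.sign σ : ℤ) : ℂ) *
        ((∏ i ∈ Finset.univ.erase i₀, wirt c (σ i) (g i) z) * wirt c (σ i₀) (g i₀) z) := by
    intro z
    simp only [Matrix.det_apply', Matrix.of_apply]
    refine Finset.sum_congr rfl fun σ _ => ?_
    rw [Finset.prod_erase_mul _ _ (Finset.mem_univ i₀)]
  simp only [e1]
  have i1 : ∀ σ : Equiv.Perm (Fin n), Integrable (fun z => ((Equiv.Perm.sign σ : ℤ) : ℂ) *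
      ((∏ i ∈ Finset.univ.erase i₀, wirt c (σ i) (g i) z) * wirt c (σ i₀) (g i₀) z)) := fun σ =>
    (((hP σ).continuous.mul (hw _ i₀).continuous).integrable_of_hasCompactSupport
      (wirt_hasCompactSupport hs).mul_left).const_mul _
  have i2 : ∀ σ : Equiv.Perm (Fin n), Integrable (fun z => ((Equiv.Perm.sign σ : ℤ) : ℂ) *
      (wirt c (σ i₀) (fun x => ∏ i ∈ Finset.univ.erase i₀, wirt c (σ i) (g i) x) z * g i₀ z)) :=
    fun σ => (((wirt_continuous (hP σ)).mul (hg i₀).continuous).integrable_of_hasCompactSupport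
      hs.mul_left).const_mul _
  rw [integral_finsetSum _ fun σ _ => i1 σ]
  have e2 : ∀ σ : Equiv.Perm (Fin n), ∫ z, ((Equiv.Perm.sign σ : ℤ) : ℂ) *
      ((∏ i ∈ Finset.univ.erase i₀, wirt c (σ i) (g i) z) * wirt c (σ i₀) (g i₀) z) =
      -∫ z, ((Equiv.Perm.sign σ : ℤ) : ℂ) * (wirt c (σ i₀)
        (fun x => ∏ i ∈ Finset.univ.erase i₀, wirt c (σ i) (g i) x) z * g i₀ z) := by
    intro σ
    rw [integral_const_mul, integral_const_mul, integral_mul_wirt (hP σ) (hg1 i₀) hs]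
    ring
  simp only [e2]
  rw [Finset.sum_neg_distrib, ← integral_finsetSum _ fun σ _ => i2 σ, neg_eq_zero]
  have e3 : ∀ z, ∑ σ : Equiv.Perm (Fin n), ((Equiv.Perm.sign σ : ℤ) : ℂ) * (wirt c (σ i₀)
      (fun x => ∏ i ∈ Finset.univ.erase i₀, wirt c (σ i) (g i) x) z * g i₀ z) = 0 := by
    intro z
    simp only [← mul_assoc]
    rw [← Finset.sum_mul, sum_sign_wirt_prod_eq_zero c g hg i₀ z, zero_mul]
  simp [e3]


/-- The functions entering the determinants are first derivatives of C² functions, hence only C¹,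
while the Piola identity differentiates twice. The uniform bounds and the common ball allow
dominated convergence. -/
theorem exists_mollification {g : Cn n → ℂ} (hg : ContDiff ℝ 1 g) (hs : HasCompactSupport g) :
    ∃ (G : ℕ → Cn n → ℂ) (M R : ℝ), (∀ k, ContDiff ℝ 2 (G k)) ∧ (∀ k, HasCompactSupport (G k)) ∧
      (∀ k x, ‖fderiv ℝ (G k) x‖ ≤ M) ∧ (∀ k x, R < ‖x‖ → fderiv ℝ (G k) x = 0) ∧
      ∀ x, Tendsto (fun k => fderiv ℝ (G k) x) atTop (𝓝 (fderiv ℝ g x)) := by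
  let φ : ℕ → ContDiffBump (0 : Cn n) := fun k =>
    ⟨1 / (2 * ((k : ℝ) + 1)), 1 / ((k : ℝ) + 1), by positivity, by
      apply one_div_lt_one_div_of_lt <;> nlinarith [(Nat.cast_nonneg k : (0 : ℝ) ≤ k)]⟩
  have hφ1 : ∀ k, (φ k).rOut ≤ 1 := fun k => by
    change 1 / ((k : ℝ) + 1) ≤ 1
    rw [div_le_one (by positivity)]
    linarith [(Nat.cast_nonneg k : (0 : ℝ) ≤ k)]
  have hφ0 : Tendsto (fun k => (φ k).rOut) atTop (𝓝 0) := tendsto_one_div_add_atTop_nhds_zero_nat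
  let L : ℝ →L[ℝ] ℂ →L[ℝ] ℂ := ContinuousLinearMap.lsmul ℝ ℝ
  have hli : ∀ k, LocallyIntegrable ((φ k).normed (volume : Measure (Cn n))) := fun k =>
    (φ k).continuous_normed.locallyIntegrable
  have hL : L.precompR (Cn n) = ContinuousLinearMap.lsmul ℝ ℝ := by
    ext a f; rfl
  have hfd : ∀ k x, fderiv ℝ (convolution ((φ k).normed volume) g L volume) x =
      convolution ((φ k).normed volume) (fderiv ℝ g) (ContinuousLinearMap.lsmul ℝ ℝ) volume x := by
    intro k x
    rw [(hs.hasFDerivAt_convolution_right L (hli k) hg x).fderiv, hL]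
  have hc : Continuous (fderiv ℝ g) := hg.continuous_fderiv (by norm_num)
  obtain ⟨M, hM⟩ := (hs.fderiv ℝ).exists_bound_of_continuous hc
  obtain ⟨R, hR⟩ := (hs.fderiv ℝ).isCompact.isBounded.subset_closedBall (0 : Cn n)
  have hR0 : ∀ x, R < ‖x‖ → fderiv ℝ g x = 0 := by
    intro x hx
    by_contra h
    have := hR (subset_tsupport _ h)
    simp at this
    linarith
  -- Averages of `fderiv ℝ g` differ from its value at x by at most 2M, which gives 3M. The bumps
  -- have radius at most 1, so the support grows by at most 1.
  refine ⟨fun k => convolution ((φ k).normed volume) g L volume, 3 * M, R + 1, ?_, ?_, ?_, ?_, ?_⟩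
  · intro k
    exact (φ k).hasCompactSupport_normed.contDiff_convolution_left L (φ k).contDiff_normed
      hg.continuous.locallyIntegrable
  · intro k
    exact (φ k).hasCompactSupport_normed.convolution L hs
  · intro k x
    rw [hfd]
    have := (φ k).dist_normed_convolution_le (μ := (volume : Measure (Cn n)))
      (g := fderiv ℝ g) (x₀ := x) (ε := 2 * M) hc.aestronglyMeasurable (fun y _ => by
        rw [dist_eq_norm]
        linarith [norm_sub_le (fderiv ℝ g y) (fderiv ℝ g x), hM x, hM y])
    rw [dist_eq_norm] at this
    have h2 := norm_le_norm_add_norm_sub' (convolution ((φ k).normed volume) (fderiv ℝ g)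
      (ContinuousLinearMap.lsmul ℝ ℝ) volume x) (fderiv ℝ g x)
    linarith [hM x]
  · intro k x hx
    rw [hfd]
    have h0 := hR0 x (by linarith)
    have := (φ k).dist_normed_convolution_le (μ := (volume : Measure (Cn n)))
      (g := fderiv ℝ g) (x₀ := x) (ε := 0) hc.aestronglyMeasurable (fun y hy => by
        rw [h0, hR0 y, dist_self]
        rw [Metric.mem_ball, dist_comm, dist_eq_norm] at hy
        have := norm_sub_norm_le x y
        linarith [hφ1 k])
    rw [h0] at this
    exact dist_le_zero.1 this
  · intro x
    simp only [hfd]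
    exact ContDiffBump.convolution_tendsto_right_of_continuous hφ0 hc x

/-- The determinant of first derivatives is a null Lagrangian. -/
theorem integral_det_wirt (c : ℂ) (i₀ : Fin n) {g : Fin n → Cn n → ℂ}
    (hg : ∀ i, ContDiff ℝ 1 (g i)) (hs : ∀ i, HasCompactSupport (g i)) :
    ∫ z, Matrix.det (Matrix.of fun j i => wirt c j (g i) z) = 0 := by
  choose G M R hG hGs hM hR hlim using fun i => exists_mollification (hg i) (hs i)
  have hlimw : ∀ j i z, Tendsto (fun k => wirt c j (G i k) z) atTop (𝓝 (wirt c j (g i) z)) := by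
    intro j i z
    have h := fun v : Cn n => ((ContinuousLinearMap.apply ℝ ℂ v).continuous.tendsto _).comp
      (hlim i z)
    exact ((h _).add ((h _).const_mul c)).const_mul (1 / 2)
  have hdet : ∀ z, Tendsto (fun k => Matrix.det (Matrix.of fun j i => wirt c j (G i k) z)) atTop
      (𝓝 (Matrix.det (Matrix.of fun j i => wirt c j (g i) z))) := by
    intro z
    refine ((continuous_id.matrix_det).tendsto _).comp ?_
    exact tendsto_pi_nhds.2 fun j => tendsto_pi_nhds.2 fun i => hlimw j i z
  obtain ⟨M₀, hM₀⟩ : ∃ M₀ : ℝ, ∀ i, M i ≤ M₀ :=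
    ⟨∑ i, |M i|, fun i => (le_abs_self _).trans
      (Finset.single_le_sum (f := fun i => |M i|) (fun _ _ => abs_nonneg _) (Finset.mem_univ i))⟩
  let B : ℝ := 1 / 2 * (M₀ + ‖c‖ * M₀)
  have hB : ∀ i k j z, ‖wirt c j (G i k) z‖ ≤ B := by
    intro i k j z
    have h1 : ∀ v : Cn n, ‖v‖ = 1 → ‖fderiv ℝ (G i k) z v‖ ≤ M₀ := fun v hv => by
      have := (fderiv ℝ (G i k) z).le_opNorm v
      rw [hv, mul_one] at this
      exact this.trans ((hM i k z).trans (hM₀ i))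
    rw [wirt, norm_mul]
    have h2 := norm_add_le (fderiv ℝ (G i k) z (EuclideanSpace.single j 1))
      (c * fderiv ℝ (G i k) z (EuclideanSpace.single j Complex.I))
    rw [norm_mul] at h2
    have h3 := h1 (EuclideanSpace.single j 1) (by simp)
    have h4 := h1 (EuclideanSpace.single j Complex.I) (by simp)
    have h5 := mul_le_mul_of_nonneg_left h4 (norm_nonneg c)
    simp only [B]
    norm_num
    linarith
  have hdom : ∀ k z, ‖Matrix.det (Matrix.of fun j i => wirt c j (G i k) z)‖ ≤
      (Metric.closedBall (0 : Cn n) (R i₀)).indicator (fun _ => n.factorial * B ^ n) z := by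
    intro k z
    by_cases hz : z ∈ Metric.closedBall (0 : Cn n) (R i₀)
    · rw [Set.indicator_of_mem hz]
      have := Matrix.det_le (A := Matrix.of fun j i => wirt c j (G i k) z)
        (abv := NormedField.toAbsoluteValue ℂ) (x := B) (fun j i => hB i k j z)
      rw [Fintype.card_fin, nsmul_eq_mul] at this
      exact this
    · rw [Set.indicator_of_notMem hz, norm_le_zero_iff]
      refine Matrix.det_eq_zero_of_column_eq_zero i₀ fun j => ?_
      have : fderiv ℝ (G i₀ k) z = 0 := hR i₀ k z (by simpa using hz)
      simp [wirt, this]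
  have hcont : ∀ k, Continuous fun z => Matrix.det (Matrix.of fun j i => wirt c j (G i k) z) :=
    fun k => Continuous.matrix_det (continuous_pi fun j => continuous_pi fun i =>
      wirt_continuous ((hG i k).of_le (by norm_num)))
  have hfin := tendsto_integral_of_dominated_convergence (μ := (volume : Measure (Cn n))) _
    (fun k => (hcont k).aestronglyMeasurable)
    ((integrable_indicator_iff measurableSet_closedBall).2
      (integrableOn_const (s := Metric.closedBall (0 : Cn n) (R i₀))
        (μ := (volume : Measure (Cn n))) (C := n.factorial * B ^ n)
        (isCompact_closedBall _ _).measure_lt_top.ne))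
    (fun k => Eventually.of_forall (hdom k)) (Eventually.of_forall hdet)
  have h0 : ∀ k, ∫ z, Matrix.det (Matrix.of fun j i => wirt c j (G i k) z) = 0 := fun k =>
    integral_det_wirt_of_contDiff_two c i₀ (fun i => hG i k) (hGs i₀ k)
  simp only [h0] at hfin
  exact tendsto_nhds_unique hfin tendsto_const_nhds

/-- The product rule in column i₀ together with multilinearity of the determinant in its columns.
Integrated, it becomes the integration by parts that follows. -/
theorem det_wirt_update_mul (c : ℂ) (i₀ : Fin n) {F : Cn n → ℂ} {g : Fin n → Cn n → ℂ} {z : Cn n}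
    (hF : DifferentiableAt ℝ F z) (hg : DifferentiableAt ℝ (g i₀) z) :
    Matrix.det (Matrix.of fun j i =>
      wirt c j (Function.update g i₀ (fun x => F x * g i₀ x) i) z) =
    F z * Matrix.det (Matrix.of fun j i => wirt c j (g i) z) +
      g i₀ z * Matrix.det (Matrix.of fun j i => wirt c j (Function.update g i₀ F i) z) := by
  let A : Matrix (Fin n) (Fin n) ℂ := Matrix.of fun j i => wirt c j (g i) z
  have h : ∀ G : Cn n → ℂ, (Matrix.of fun j i => wirt c j (Function.update g i₀ G i) z) =
      A.updateCol i₀ (fun j => wirt c j G z) := by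
    intro G
    ext j i
    by_cases hi : i = i₀
    · subst hi; simp
    · simp [hi, A]
  have h0 : A.updateCol i₀ (fun j => wirt c j (g i₀) z) = A := by
    ext j i
    by_cases hi : i = i₀
    · subst hi; simp [A]
    · simp [hi]
  rw [h, h]
  have e : (fun j => wirt c j (fun x => F x * g i₀ x) z) =
      F z • (fun j => wirt c j (g i₀) z) + g i₀ z • (fun j => wirt c j F z) := by
    ext j
    simp [wirt_mul hF hg]
  rw [e, Matrix.det_updateCol_add, Matrix.det_updateCol_smul, Matrix.det_updateCol_smul, h0]

theorem continuous_det_wirt (c : ℂ) {g : Fin n → Cn n → ℂ} (hg : ∀ i, ContDiff ℝ 1 (g i)) :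
    Continuous fun z => Matrix.det (Matrix.of fun j i => wirt c j (g i) z) :=
  Continuous.matrix_det (continuous_pi fun _ => continuous_pi fun i => wirt_continuous (hg i))

theorem integral_mul_det_wirt (c : ℂ) (i₀ : Fin n) {F : Cn n → ℂ} {g : Fin n → Cn n → ℂ}
    (hF : ContDiff ℝ 1 F) (hFs : HasCompactSupport F)
    (hg : ∀ i, ContDiff ℝ 1 (g i)) (hs : ∀ i, HasCompactSupport (g i)) :
    ∫ z, F z * Matrix.det (Matrix.of fun j i => wirt c j (g i) z) =
      -∫ z, g i₀ z * Matrix.det (Matrix.of fun j i => wirt c j (Function.update g i₀ F i) z) := by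
  have hu : ∀ G : Cn n → ℂ, ContDiff ℝ 1 G → ∀ i, ContDiff ℝ 1 (Function.update g i₀ G i) := by
    intro G hG i
    by_cases hi : i = i₀
    · subst hi; simpa using hG
    · simpa [hi] using hg i
  have hus : ∀ G : Cn n → ℂ, HasCompactSupport G →
      ∀ i, HasCompactSupport (Function.update g i₀ G i) := by
    intro G hG i
    by_cases hi : i = i₀
    · subst hi; simpa using hG
    · simpa [hi] using hs i
  have h := integral_det_wirt c i₀ (hu _ (hF.mul (hg i₀))) (hus _ hFs.mul_right)
  have e := fun z => det_wirt_update_mul c i₀ (z := z) (hF.differentiable (by norm_num) z)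
    ((hg i₀).differentiable (by norm_num) z)
  simp only [e] at h
  rw [integral_add] at h
  · linear_combination h
  · exact (hF.continuous.mul (continuous_det_wirt c hg)).integrable_of_hasCompactSupport
      hFs.mul_right
  · exact ((hg i₀).continuous.mul (continuous_det_wirt c (hu F hF))).integrable_of_hasCompactSupport
      (hs i₀).mul_right

/-- Both sides equal -∫ ∂u₀ ∧ ∂̄u_(i₀) ∧ (the remaining Hessians), up to normalisation. On the left
a ∂ moves from ∂̄u_(i₀) to u₀; on the right a ∂̄ moves from ∂u₀ to u_(i₀). The other factors
contribute nothing, being closed. -/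
theorem integral_mul_mixedDisc_of_hasCompactSupport (i₀ : Fin n) {u₀ : Cn n → ℝ}
    {u : Fin n → Cn n → ℝ} (hu₀ : ContDiff ℝ 2 u₀) (hs₀ : HasCompactSupport u₀)
    (hu : ∀ i, ContDiff ℝ 2 (u i)) (hs : ∀ i, HasCompactSupport (u i)) :
    ∫ z, (u₀ z : ℂ) * mixedDisc (fun i => hess (u i) z) =
      ∫ z, (u i₀ z : ℂ) *
        mixedDisc (Function.update (fun i => hess (u i) z) i₀ (hess u₀ z)) := by
  let U₀ : Cn n → ℂ := fun z => (u₀ z : ℂ)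
  let U : Fin n → Cn n → ℂ := fun i z => (u i z : ℂ)
  have hU₀ : ContDiff ℝ 2 U₀ := Complex.ofRealCLM.contDiff.comp hu₀
  have hU : ∀ i, ContDiff ℝ 2 (U i) := fun i => Complex.ofRealCLM.contDiff.comp (hu i)
  have hU₀s : HasCompactSupport U₀ := hs₀.comp_left (g := fun x : ℝ => (x : ℂ)) (by simp)
  have hUs : ∀ i, HasCompactSupport (U i) := fun i =>
    (hs i).comp_left (g := fun x : ℝ => (x : ℂ)) (by simp)
  have hle : (1 : WithTop ℕ∞) ≤ 2 := by norm_num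
  have hw : ∀ c j i, ContDiff ℝ 1 (wirt c j (U i)) := fun c j i =>
    wirt_contDiff (hU i) (by norm_num)
  have hw₀ : ∀ c j, ContDiff ℝ 1 (wirt c j U₀) := fun c j => wirt_contDiff hU₀ (by norm_num)
  let S : Cn n → ℂ := fun z => ∑ τ : Equiv.Perm (Fin n), ∑ σ : Equiv.Perm (Fin n),
    ((Equiv.Perm.sign τ : ℤ) : ℂ) * ((Equiv.Perm.sign σ : ℤ) : ℂ) *
      (wirt Complex.I (τ i₀) (U i₀) z * wirt (-Complex.I) (σ i₀) U₀ z *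
        ∏ i ∈ Finset.univ.erase i₀, hess (u i) z (σ i) (τ i))
  have h1 : ∫ z, (u₀ z : ℂ) * mixedDisc (fun i => hess (u i) z) = -∫ z, S z := by
    have e1 : ∀ z, (u₀ z : ℂ) * mixedDisc (fun i => hess (u i) z) =
        ∑ τ : Equiv.Perm (Fin n), ((Equiv.Perm.sign τ : ℤ) : ℂ) * (U₀ z *
          Matrix.det (Matrix.of fun j i =>
            wirt (-Complex.I) j ((fun i => wirt Complex.I (τ i) (U i)) i) z)) := by
      intro z
      rw [mixedDisc_eq_sum_det, Finset.mul_sum]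
      exact Finset.sum_congr rfl fun τ _ => mul_left_comm _ _ _
    have i1 : ∀ τ : Equiv.Perm (Fin n), Integrable fun z => U₀ z *
          Matrix.det (Matrix.of fun j i =>
            wirt (-Complex.I) j ((fun i => wirt Complex.I (τ i) (U i)) i) z) := fun τ =>
      (hU₀.continuous.mul (continuous_det_wirt _ fun i =>
        hw _ _ i)).integrable_of_hasCompactSupport hU₀s.mul_right
    have hup : ∀ (τ : Equiv.Perm (Fin n)) i, ContDiff ℝ 1
        (Function.update (fun i => wirt Complex.I (τ i) (U i)) i₀ U₀ i) := by
      intro τ i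
      by_cases hi : i = i₀
      · subst hi; simpa using hU₀.of_le hle
      · simpa [hi] using hw _ _ i
    have i2 : ∀ τ : Equiv.Perm (Fin n), Integrable fun z => wirt Complex.I (τ i₀) (U i₀) z *
          Matrix.det (Matrix.of fun j i => wirt (-Complex.I) j
            (Function.update (fun i => wirt Complex.I (τ i) (U i)) i₀ U₀ i) z) := fun τ =>
      ((hw _ _ _).continuous.mul (continuous_det_wirt _
        (hup τ))).integrable_of_hasCompactSupport (wirt_hasCompactSupport (hUs i₀)).mul_right
    simp only [e1]
    rw [integral_finsetSum _ fun τ _ => (i1 τ).const_mul _]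
    simp only [integral_const_mul]
    have e2 : ∀ τ : Equiv.Perm (Fin n), _ := fun τ =>
      integral_mul_det_wirt (-Complex.I) i₀ (hU₀.of_le hle) hU₀s
        (g := fun i => wirt Complex.I (τ i) (U i)) (fun i => hw _ _ i)
        (fun i => wirt_hasCompactSupport (hUs i))
    simp only [e2, mul_neg, Finset.sum_neg_distrib, ← integral_const_mul]
    rw [← integral_finsetSum _ fun τ _ => (i2 τ).const_mul _]
    congr 2
    ext z
    simp only [S, Matrix.det_apply', Matrix.of_apply, Finset.mul_sum]
    refine Finset.sum_congr rfl fun τ _ => Finset.sum_congr rfl fun σ _ => ?_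
    rw [← Finset.mul_prod_erase _ _ (Finset.mem_univ i₀), Function.update_self]
    have : ∏ i ∈ Finset.univ.erase i₀, wirt (-Complex.I) (σ i)
        (Function.update (fun i => wirt Complex.I (τ i) (U i)) i₀ U₀ i) z =
        ∏ i ∈ Finset.univ.erase i₀, hess (u i) z (σ i) (τ i) :=
      Finset.prod_congr rfl fun i hi => by
        rw [Function.update_of_ne (Finset.ne_of_mem_erase hi)]; rfl
    rw [this]
    ring
  have h2 : ∫ z, (u i₀ z : ℂ) *
        mixedDisc (Function.update (fun i => hess (u i) z) i₀ (hess u₀ z)) = -∫ z, S z := by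
    let g : Equiv.Perm (Fin n) → Fin n → Cn n → ℂ := fun σ =>
      Function.update (fun i => wirt (-Complex.I) (σ i) (U i)) i₀ (wirt (-Complex.I) (σ i₀) U₀)
    have hg : ∀ σ i, ContDiff ℝ 1 (g σ i) := by
      intro σ i
      by_cases hi : i = i₀
      · subst hi; simpa [g] using hw₀ _ _
      · simpa [hi, g] using hw _ _ i
    have hgs : ∀ σ i, HasCompactSupport (g σ i) := by
      intro σ i
      by_cases hi : i = i₀
      · subst hi; simpa [g] using wirt_hasCompactSupport hU₀s
      · simpa [hi, g] using wirt_hasCompactSupport (hUs i)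
    have e1 : ∀ z, (u i₀ z : ℂ) *
        mixedDisc (Function.update (fun i => hess (u i) z) i₀ (hess u₀ z)) =
        ∑ σ : Equiv.Perm (Fin n), ((Equiv.Perm.sign σ : ℤ) : ℂ) * (U i₀ z *
          Matrix.det (Matrix.of fun k i => wirt Complex.I k (g σ i) z)) := by
      intro z
      rw [mixedDisc_eq_sum_det', Finset.mul_sum]
      refine Finset.sum_congr rfl fun σ _ => ?_
      rw [mul_left_comm]
      congr 4
      ext k i
      by_cases hi : i = i₀
      · subst hi
        simp only [Function.update_self, g, hess]
        exact wirt_comm hU₀.contDiffAt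
      · simp only [Function.update_of_ne hi, g, hess]
        exact wirt_comm (hU i).contDiffAt
    have i1 : ∀ σ : Equiv.Perm (Fin n), Integrable fun z => U i₀ z *
          Matrix.det (Matrix.of fun k i => wirt Complex.I k (g σ i) z) := fun σ =>
      ((hU i₀).continuous.mul (continuous_det_wirt _ (hg σ))).integrable_of_hasCompactSupport
        (hUs i₀).mul_right
    have hup : ∀ σ i, ContDiff ℝ 1 (Function.update (g σ) i₀ (U i₀) i) := by
      intro σ i
      by_cases hi : i = i₀
      · subst hi; simpa using (hU _).of_le hle
      · simpa [hi] using hg σ i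
    have i2 : ∀ σ : Equiv.Perm (Fin n), Integrable fun z => g σ i₀ z *
          Matrix.det (Matrix.of fun k i => wirt Complex.I k
            (Function.update (g σ) i₀ (U i₀) i) z) := fun σ =>
      ((hg σ i₀).continuous.mul (continuous_det_wirt _
        (hup σ))).integrable_of_hasCompactSupport (hgs σ i₀).mul_right
    simp only [e1]
    rw [integral_finsetSum _ fun τ _ => (i1 τ).const_mul _]
    simp only [integral_const_mul]
    have e2 : ∀ σ : Equiv.Perm (Fin n), _ := fun σ =>
      integral_mul_det_wirt Complex.I i₀ ((hU i₀).of_le hle) (hUs i₀) (hg σ) (hgs σ)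
    simp only [e2, mul_neg, Finset.sum_neg_distrib, ← integral_const_mul]
    rw [← integral_finsetSum _ fun τ _ => (i2 τ).const_mul _]
    congr 2
    ext z
    simp only [S, Matrix.det_apply', Matrix.of_apply, Finset.mul_sum]
    rw [Finset.sum_comm]
    refine Finset.sum_congr rfl fun τ _ => Finset.sum_congr rfl fun σ _ => ?_
    rw [← Finset.mul_prod_erase _ _ (Finset.mem_univ i₀), Function.update_self]
    have : ∏ i ∈ Finset.univ.erase i₀, wirt Complex.I (τ i)
        (Function.update (g σ) i₀ (U i₀) i) z =
        ∏ i ∈ Finset.univ.erase i₀, hess (u i) z (σ i) (τ i) :=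
      Finset.prod_congr rfl fun i hi => by
        have hi' := Finset.ne_of_mem_erase hi
        simp only [Function.update_of_ne hi', g, hess]
        exact wirt_comm (hU i).contDiffAt
    rw [this]
    simp only [g, Function.update_self]
    ring
  rw [h1, h2]

/-! ### Cutoff functions and integration by parts on open sets -/

/-- A smooth cutoff function which is `1` on a neighbourhood of `K` and supported in `G`. -/
theorem exists_cutoff {K G : Set (Cn n)} (hK : IsCompact K) (hG : IsOpen G) (hKG : K ⊆ G) :
    ∃ ψ : Cn n → ℝ, ContDiff ℝ ∞ ψ ∧ HasCompactSupport ψ ∧ tsupport ψ ⊆ G ∧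
      (∀ z ∈ K, ∀ᶠ x in 𝓝 z, ψ x = 1) ∧ ∀ z, ψ z ∈ Set.Icc (0 : ℝ) 1 := by
  obtain ⟨K₁, hK₁, hKK₁, hK₁G⟩ := exists_compact_between hK hG hKG
  obtain ⟨K₂, hK₂, hKK₂, hK₂G⟩ := exists_compact_between hK₁ hG hK₁G
  obtain ⟨f, hf0, hf1, hf⟩ := exists_contMDiffMap_zero_one_of_isClosed (n := ⊤) 𝓘(ℝ, Cn n)
    (s := (interior K₂)ᶜ) (t := K₁) isOpen_interior.isClosed_compl hK₁.isClosed
    (Set.disjoint_compl_left_iff_subset.2 hKK₂)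
  have hsub : tsupport f ⊆ K₂ := by
    refine closure_minimal (fun x hx => ?_) hK₂.isClosed
    by_contra h
    exact hx (hf0 (fun h' => h (interior_subset h')))
  refine ⟨f, contMDiff_iff_contDiff.1 f.contMDiff, hK₂.of_isClosed_subset (isClosed_tsupport _) hsub,
    hsub.trans hK₂G, fun z hz => ?_, hf⟩
  filter_upwards [isOpen_interior.mem_nhds (hKK₁ hz)] with x hx
  exact hf1 (interior_subset hx)

theorem contDiff_mul_of_tsupport_subset {k : WithTop ℕ∞} {G : Set (Cn n)} {ψ u : Cn n → ℝ}
    (hG : IsOpen G) (hψ : ContDiff ℝ k ψ) (hs : tsupport ψ ⊆ G) (hu : ContDiffOn ℝ k u G) :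
    ContDiff ℝ k (fun z => ψ z * u z) := by
  refine contDiff_iff_contDiffAt.2 fun z => ?_
  by_cases hz : z ∈ tsupport ψ
  · exact hψ.contDiffAt.mul (hu.contDiffAt (hG.mem_nhds (hs hz)))
  · have : (fun z => ψ z * u z) =ᶠ[𝓝 z] fun _ => 0 := by
      filter_upwards [(isClosed_tsupport ψ).isOpen_compl.mem_nhds hz] with x hx
      rw [image_eq_zero_of_notMem_tsupport hx, zero_mul]
    exact contDiffAt_const.congr_of_eventuallyEq this

theorem hess_const (c : ℝ) (z : Cn n) : hess (fun _ : Cn n => c) z = 0 := by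
  ext j k
  have : wirt Complex.I k (fun _ : Cn n => (c : ℂ)) = fun _ => 0 := by
    ext x; exact wirt_const _ _
  rw [hess, this, wirt_const]
  rfl

theorem mixedDisc_update_zero (A : Fin n → Matrix (Fin n) (Fin n) ℂ) (i : Fin n) :
    mixedDisc (Function.update A i 0) = 0 := by
  have := mixedDisc_update_smul A i 0 0
  simpa using this

theorem continuous_mixedDisc :
    Continuous (mixedDisc : (Fin n → Matrix (Fin n) (Fin n) ℂ) → ℂ) := by
  unfold mixedDisc
  refine continuous_finsetSum _ fun τ _ => continuous_finsetSum _ fun σ _ =>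
    continuous_const.mul (continuous_finsetProd _ fun i _ => ?_)
  exact (continuous_apply_apply (σ i) (τ i)).comp (continuous_apply i)

/-- Integration by parts for the mixed Monge--Ampère operator on an open set. -/
theorem setIntegral_mul_mixedDisc {G K : Set (Cn n)} (hG : IsOpen G) (hK : IsCompact K)
    (hKG : K ⊆ G) (i₀ : Fin n) {ζ : Cn n → ℝ} {u : Fin n → Cn n → ℝ} (hζ : ContDiffOn ℝ 2 ζ G)
    (hζK : ∀ z ∈ G, z ∉ K → ζ z = 0) (hu : ∀ i, ContDiffOn ℝ 2 (u i) G) :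
    ∫ z in G, ζ z * (mixedDisc (fun i => hess (u i) z)).re =
      ∫ z in G, u i₀ z *
        (mixedDisc (Function.update (fun i => hess (u i) z) i₀ (hess ζ z))).re := by
  -- Multiplying every function by ψ makes all of them globally C² with compact support. Neither
  -- integrand changes: ψ is 1 near K, and off K both ζ and its Hessian vanish.
  obtain ⟨ψ, hψ, hψc, hψs, hψ1, -⟩ := exists_cutoff hK hG hKG
  have hψ2 : ContDiff ℝ 2 ψ := contDiff_infty.1 hψ 2
  have hψ0 : ∀ z, z ∉ G → ψ z = 0 := fun z hz =>
    image_eq_zero_of_notMem_tsupport fun h => hz (hψs h)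
  have h := integral_mul_mixedDisc_of_hasCompactSupport i₀
    (contDiff_mul_of_tsupport_subset hG hψ2 hψs hζ) hψc.mul_right
    (fun i => contDiff_mul_of_tsupport_subset hG hψ2 hψs (hu i)) (fun i => hψc.mul_right)
  have hζψ : ∀ z ∈ G, ψ z * ζ z = ζ z := by
    intro z hz
    by_cases hzK : z ∈ K
    · rw [(hψ1 z hzK).self_of_nhds, one_mul]
    · rw [hζK z hz hzK, mul_zero]
  have hhζ : ∀ z ∈ G, hess (fun x => ψ x * ζ x) z = hess ζ z := fun z hz =>
    hess_congr (by filter_upwards [hG.mem_nhds hz] with x hx using hζψ x hx)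
  have hhζ0 : ∀ z ∈ G, z ∉ K → hess ζ z = 0 := fun z hz hzK => by
    rw [← hess_const 0 z]
    refine hess_congr ?_
    filter_upwards [hG.mem_nhds hz, hK.isClosed.isOpen_compl.mem_nhds hzK] with x hx hx'
    exact hζK x hx hx'
  have hhu : ∀ z ∈ K, ∀ i, hess (fun x => ψ x * u i x) z = hess (u i) z := fun z hz i =>
    hess_congr (by filter_upwards [hψ1 z hz] with x hx using by rw [hx, one_mul])
  rw [← integral_indicator hG.measurableSet, ← integral_indicator hG.measurableSet]
  have e1 : ∀ z, ((G.indicator (fun z => ζ z * (mixedDisc (fun i => hess (u i) z)).re) z : ℝ) : ℂ)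
      = (((((ψ z * ζ z : ℝ) : ℂ) *
        mixedDisc (fun i => hess (fun x => ψ x * u i x) z)).re : ℝ) : ℂ) := by
    intro z
    rw [Complex.re_ofReal_mul]
    by_cases hz : z ∈ G
    · rw [Set.indicator_of_mem hz, hζψ z hz]
      by_cases hzK : z ∈ K
      · simp only [hhu z hzK]
      · simp [hζK z hz hzK]
    · simp [Set.indicator_of_notMem hz, hψ0 z hz]
  have e2 : ∀ z, ((G.indicator (fun z => u i₀ z *
        (mixedDisc (Function.update (fun i => hess (u i) z) i₀ (hess ζ z))).re) z : ℝ) : ℂ)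
      = (((((ψ z * u i₀ z : ℝ) : ℂ) * mixedDisc (Function.update
        (fun i => hess (fun x => ψ x * u i x) z) i₀ (hess (fun x => ψ x * ζ x) z))).re : ℝ) : ℂ) := by
    intro z
    rw [Complex.re_ofReal_mul]
    by_cases hz : z ∈ G
    · rw [Set.indicator_of_mem hz, hhζ z hz]
      by_cases hzK : z ∈ K
      · simp only [hhu z hzK, (hψ1 z hzK).self_of_nhds, one_mul]
      · simp [hhζ0 z hz hzK, mixedDisc_update_zero]
    · simp [Set.indicator_of_notMem hz, hψ0 z hz]
  have e1' := fun z => Complex.ofReal_injective (e1 z)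
  have e2' := fun z => Complex.ofReal_injective (e2 z)
  simp only [e1', e2']
  have r1 : ∀ f : Cn n → ℂ, Integrable f → ∫ z, (f z).re = (∫ z, f z).re := fun f hf =>
    integral_re (𝕜 := ℂ) hf
  have hcd : ∀ u : Cn n → ℝ, ContDiffOn ℝ 2 u G → ContDiff ℝ 2 (fun x => ψ x * u x) :=
    fun u hu => contDiff_mul_of_tsupport_subset hG hψ2 hψs hu
  have hch : ∀ u : Cn n → ℝ, ContDiffOn ℝ 2 u G →
      Continuous (fun z => hess (fun x => ψ x * u x) z) := fun u hu =>
    continuous_pi fun j => continuous_pi fun k => continuous_iff_continuousAt.2 fun z =>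
      (hess_contDiffAt (m := 0) (hcd u hu).contDiffAt (by norm_num) j k).continuousAt
  have hcm : ∀ A : Cn n → Fin n → Matrix (Fin n) (Fin n) ℂ, (∀ i, Continuous fun z => A z i) →
      Continuous fun z => mixedDisc (A z) :=
    fun A hA => continuous_mixedDisc.comp (continuous_pi hA)
  rw [r1 _, r1 _, h]
  · refine ((Complex.continuous_ofReal.comp (hcd _ (hu i₀)).continuous).mul
      (hcm _ fun i => ?_)).integrable_of_hasCompactSupport ?_
    · by_cases hi : i = i₀
      · subst hi; simpa using hch _ hζ
      · simpa [hi] using hch _ (hu i)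
    · exact HasCompactSupport.mul_right ((hψc.mul_right (f' := u i₀)).comp_left
        (g := fun x : ℝ => (x : ℂ)) (by simp))
  · refine ((Complex.continuous_ofReal.comp (hcd _ hζ).continuous).mul
      (hcm _ fun i => hch _ (hu i))).integrable_of_hasCompactSupport ?_
    exact HasCompactSupport.mul_right ((hψc.mul_right (f' := ζ)).comp_left
      (g := fun x : ℝ => (x : ℂ)) (by simp))

/-! ### Estimates near a regular boundary -/

/-- The part of `V` where `r` is negative. -/
def region {E : Type*} (V : Set E) (r : E → ℝ) : Set E := {z ∈ V | r z < 0}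

theorem region_isOpen {E : Type*} [TopologicalSpace E] {V : Set E} {r : E → ℝ} (hV : IsOpen V)
    (hr : ContinuousOn r V) : IsOpen (region V r) :=
  hr.isOpen_inter_preimage hV isOpen_Iio

theorem region_le_zero_of_mem_closure {E : Type*} [TopologicalSpace E] {V : Set E} {r : E → ℝ} (hV : IsOpen V)
    (hr : ContinuousOn r V) {z : E} (hz : z ∈ V) (hc : z ∈ closure (region V r)) : r z ≤ 0 := by
  by_contra! h
  have h1 : ∀ᶠ x in 𝓝 z, 0 < r x := (hr.continuousAt (hV.mem_nhds hz)).eventually (lt_mem_nhds h)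
  obtain ⟨x, hx, hx'⟩ := mem_closure_iff_nhds.1 hc _ h1
  exact absurd hx'.2 (not_lt.2 (le_of_lt hx))

section Normed

variable {E F : Type*} [NormedAddCommGroup E] [NormedSpace ℝ E] [NormedAddCommGroup F]
  [NormedSpace ℝ F]

theorem exists_increasing_direction {r : E → ℝ} {p : E} (hr : ContDiffAt ℝ 1 r p)
    (h : fderiv ℝ r p ≠ 0) : ∃ v : E, ∃ s ∈ 𝓝 p, ∀ z ∈ s, ∀ t : ℝ, 0 ≤ t →
      z + t • v ∈ s → t ≤ r (z + t • v) - r z := by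
  obtain ⟨w, hw⟩ : ∃ w, fderiv ℝ r p w ≠ 0 := by
    by_contra! h'
    exact h (by ext w; simpa using h' w)
  -- The derivative along v is normalised to 2. With the constant 1 / (1 + ‖v‖), strict
  -- differentiability costs at most t over a displacement t v, which leaves slope at least 1.
  let v := (2 / fderiv ℝ r p w) • w
  have hv : fderiv ℝ r p v = 2 := by simp [v, hw]
  have hc : (0 : NNReal) < 1 / (1 + ‖v‖₊) := by positivity
  obtain ⟨s, hs, happ⟩ := (hr.hasStrictFDerivAt (by norm_num)).approximates_deriv_on_nhds
    (c := 1 / (1 + ‖v‖₊)) (Or.inr hc)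
  refine ⟨v, s, hs, fun z hz t ht hzt => ?_⟩
  have h1 := happ _ hzt _ hz
  rw [add_sub_cancel_left, map_smul, hv, norm_smul, Real.norm_eq_abs, Real.norm_eq_abs,
    abs_of_nonneg ht, smul_eq_mul] at h1
  have h2 : ((1 / (1 + ‖v‖₊) : NNReal) : ℝ) * (t * ‖v‖) ≤ t := by
    push_cast
    rw [div_mul_eq_mul_div, one_mul, div_le_iff₀ (by positivity)]
    nlinarith [norm_nonneg v]
  have h3 := (abs_le.1 (h1.trans h2)).1
  linarith

/-- A `C¹` function which vanishes on a regular boundary is dominated by the defining function. -/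
theorem norm_le_mul_abs_of_vanish {V K : Set E} {r : E → ℝ} {g : E → F} (hV : IsOpen V)
    (hr : ContDiffOn ℝ 1 r V)
    (hd : ∀ z ∈ V, z ∈ closure (region V r) → r z = 0 → fderiv ℝ r z ≠ 0)
    (hg : ContDiffOn ℝ 1 g V) (hg0 : ∀ z ∈ V, z ∈ closure (region V r) → r z = 0 → g z = 0)
    (hK : IsCompact K) (hKV : K ⊆ V) :
    ∃ C : ℝ, 0 ≤ C ∧ ∀ z ∈ K, z ∈ region V r → ‖g z‖ ≤ C * |r z| := by
  refine hK.induction_on (p := fun s => ∃ C : ℝ, 0 ≤ C ∧ ∀ z ∈ s, z ∈ region V r →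
    ‖g z‖ ≤ C * |r z|) ⟨0, le_rfl, by simp⟩ ?_ ?_ ?_
  · rintro s t hst ⟨C, hC, h⟩
    exact ⟨C, hC, fun z hz => h z (hst hz)⟩
  · rintro s t ⟨C, hC, h⟩ ⟨D, hD, h'⟩
    refine ⟨C + D, by positivity, fun z hz hzr => ?_⟩
    have := abs_nonneg (r z)
    rcases hz with hz | hz
    · nlinarith [h z hz hzr]
    · nlinarith [h' z hz hzr]
  · intro p hp
    have hpV := hKV hp
    have hrp : ContDiffAt ℝ 1 r p := hr.contDiffAt (hV.mem_nhds hpV)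
    have hgp : ContDiffAt ℝ 1 g p := hg.contDiffAt (hV.mem_nhds hpV)
    by_cases hpc : p ∈ closure (region V r)
    swap
    · refine ⟨(closure (region V r))ᶜ, mem_nhdsWithin_of_mem_nhds
        (isClosed_closure.isOpen_compl.mem_nhds hpc), 0, le_rfl, fun z hz hzr => ?_⟩
      exact absurd (subset_closure hzr) hz
    by_cases hp0 : r p = 0
    -- From x, follow v until r first becomes zero. Since r grows at least at unit rate, this takes
    -- time at most |r x|, and the Lipschitz bound for g turns that time into the estimate.
    · obtain ⟨v, s, hs, hv⟩ := exists_increasing_direction hrp (hd p hpV hpc hp0)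
      obtain ⟨M, t, ht, hM⟩ := hgp.exists_lipschitzOnWith
      obtain ⟨δ, hδ, hball⟩ := Metric.mem_nhds_iff.1
        (inter_mem (inter_mem hs ht) (hV.mem_nhds hpV))
      have hev : ∀ᶠ x in 𝓝 p, |r x| * ‖v‖ < δ / 2 := by
        have : ContinuousAt (fun x => |r x| * ‖v‖) p :=
          hrp.continuousAt.abs.mul continuousAt_const
        refine this.eventually (gt_mem_nhds ?_)
        simpa [hp0] using hδ
      refine ⟨{x | |r x| * ‖v‖ < δ / 2} ∩ Metric.ball p (δ / 2),
        mem_nhdsWithin_of_mem_nhds (inter_mem hev (Metric.ball_mem_nhds _ (by positivity))),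
        M * ‖v‖, by positivity, ?_⟩
      rintro x ⟨hx1, hx2⟩ hxr
      have hx1 : |r x| * ‖v‖ < δ / 2 := hx1
      have hrx : |r x| = -r x := abs_of_neg hxr.2
      have hin : ∀ t ∈ Set.Icc (0 : ℝ) |r x|, x + t • v ∈ Metric.ball p δ := by
        intro t ht
        rw [Metric.mem_ball, dist_eq_norm] at hx2 ⊢
        have h1 : ‖t • v‖ ≤ |r x| * ‖v‖ := by
          rw [norm_smul, Real.norm_eq_abs, abs_of_nonneg ht.1]
          exact mul_le_mul_of_nonneg_right ht.2 (norm_nonneg v)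
        calc ‖x + t • v - p‖ = ‖(x - p) + t • v‖ := by congr 1; abel
          _ ≤ ‖x - p‖ + ‖t • v‖ := norm_add_le _ _
          _ < δ := by linarith
      have hxB : x ∈ Metric.ball p δ := by simpa using hin 0 ⟨le_rfl, abs_nonneg _⟩
      have hcont : ContinuousOn (fun t : ℝ => r (x + t • v)) (Set.Icc 0 |r x|) := by
        refine hr.continuousOn.comp (by fun_prop) fun t ht => (hball (hin t ht)).2
      have hend : 0 ≤ r (x + |r x| • v) := by
        have := hv x (hball hxB).1.1 |r x| (abs_nonneg _)
          (hball (hin _ ⟨abs_nonneg _, le_rfl⟩)).1.1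
        linarith
      obtain ⟨t₀, ht₀, hzero⟩ := intermediate_value_Icc (abs_nonneg (r x)) hcont
        (show (0 : ℝ) ∈ Set.Icc _ _ from ⟨by simpa using hxr.2.le, hend⟩)
      have hzero : r (x + t₀ • v) = 0 := hzero
      have ht₀pos : 0 < t₀ := by
        rcases ht₀.1.lt_or_eq with h | h
        · exact h
        · rw [← h] at hzero
          simp at hzero
          exact absurd hxr.2 (by rw [hzero]; exact lt_irrefl _)
      have hreg : ∀ s ∈ Set.Ioo 0 t₀, x + s • v ∈ region V r := by
        intro s hs'
        have hsI : s ∈ Set.Icc (0 : ℝ) |r x| := ⟨hs'.1.le, hs'.2.le.trans ht₀.2⟩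
        refine ⟨(hball (hin s hsI)).2, ?_⟩
        have e : x + s • v + (t₀ - s) • v = x + t₀ • v := by
          rw [add_assoc, ← add_smul]; congr 2; ring
        have := hv _ (hball (hin s hsI)).1.1 (t₀ - s) (by linarith [hs'.2])
          (by rw [e]; exact (hball (hin _ ht₀)).1.1)
        rw [e, hzero] at this
        linarith [hs'.2]
      -- The vanishing of g is assumed only at zeros of r in the closure of the region; the endpoint
      -- qualifies as a limit of points of the segment.
      have hcl : x + t₀ • v ∈ closure (region V r) := by
        have ht : Tendsto (fun s : ℝ => x + s • v) (𝓝[<] t₀) (𝓝 (x + t₀ • v)) :=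
          tendsto_nhdsWithin_of_tendsto_nhds (Continuous.tendsto (by fun_prop) t₀)
        refine mem_closure_of_tendsto ht ?_
        filter_upwards [Ioo_mem_nhdsLT ht₀pos] with s hs' using hreg s hs'
      have hg00 := hg0 _ (hball (hin _ ht₀)).2 hcl hzero
      have hlip := hM.dist_le_mul _ (hball hxB).1.2 _ (hball (hin _ ht₀)).1.2
      rw [hg00, dist_zero_right, dist_eq_norm, show x - (x + t₀ • v) = -(t₀ • v) by abel, norm_neg,
        norm_smul, Real.norm_eq_abs, abs_of_pos ht₀pos] at hlip
      calc ‖g x‖ ≤ M * (t₀ * ‖v‖) := hlip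
        _ ≤ M * (|r x| * ‖v‖) := by gcongr; exact ht₀.2
        _ = M * ‖v‖ * |r x| := by ring
    · have h1 : ∀ᶠ x in 𝓝 p, |r p| / 2 < |r x| :=
        hrp.continuousAt.abs.eventually (lt_mem_nhds (by have := abs_pos.2 hp0; linarith))
      have h2 : ∀ᶠ x in 𝓝 p, ‖g x‖ < ‖g p‖ + 1 :=
        hgp.continuousAt.norm.eventually (gt_mem_nhds (by linarith))
      have hpos := abs_pos.2 hp0
      refine ⟨_, mem_nhdsWithin_of_mem_nhds (h1.and h2), 2 * (‖g p‖ + 1) / |r p|, by positivity, ?_⟩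
      rintro x ⟨hx1, hx2⟩ -
      rw [div_mul_eq_mul_div, le_div_iff₀ hpos]
      nlinarith [norm_nonneg (g p), norm_nonneg (g x)]

/-- The volume of a strip near a regular boundary is at most proportional to its width. -/
theorem measure_strip_le [MeasurableSpace E] [BorelSpace E] [FiniteDimensional ℝ E]
    (μ : Measure E) [μ.IsAddHaarMeasure] {V K : Set E} {r : E → ℝ}
    (hV : IsOpen V) (hr : ContDiffOn ℝ 1 r V)
    (hd : ∀ z ∈ V, z ∈ closure (region V r) → r z = 0 → fderiv ℝ r z ≠ 0)
    (hK : IsCompact K) (hKV : K ⊆ V) :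
    ∃ C : NNReal, ∀ ε : ℝ, 0 < ε →
      μ {z ∈ K | z ∈ region V r ∧ -ε < r z} ≤ C * ENNReal.ofReal ε := by
  refine hK.induction_on (p := fun s => ∃ C : NNReal, ∀ ε : ℝ, 0 < ε →
      μ {z ∈ s | z ∈ region V r ∧ -ε < r z} ≤ C * ENNReal.ofReal ε) ?_ ?_ ?_ ?_
  · exact ⟨0, by simp⟩
  · rintro s t hst ⟨C, h⟩
    refine ⟨C, fun ε hε => le_trans (measure_mono ?_) (h ε hε)⟩
    exact fun z hz => ⟨hst hz.1, hz.2⟩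
  · rintro s t ⟨C, h⟩ ⟨D, h'⟩
    refine ⟨C + D, fun ε hε => ?_⟩
    have : {z ∈ s ∪ t | z ∈ region V r ∧ -ε < r z} ⊆
        {z ∈ s | z ∈ region V r ∧ -ε < r z} ∪ {z ∈ t | z ∈ region V r ∧ -ε < r z} := by
      rintro z ⟨hz | hz, hz'⟩
      · exact Or.inl ⟨hz, hz'⟩
      · exact Or.inr ⟨hz, hz'⟩
    refine (measure_mono this).trans ((measure_union_le _ _).trans ?_)
    rw [ENNReal.coe_add, add_mul]
    exact add_le_add (h ε hε) (h' ε hε)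
  · intro p hp
    have hpV := hKV hp
    have hrp : ContDiffAt ℝ 1 r p := hr.contDiffAt (hV.mem_nhds hpV)
    by_cases hpc : p ∈ closure (region V r)
    swap
    · refine ⟨(closure (region V r))ᶜ, mem_nhdsWithin_of_mem_nhds
        (isClosed_closure.isOpen_compl.mem_nhds hpc), 0, fun ε hε => ?_⟩
      rw [ENNReal.coe_zero, zero_mul, nonpos_iff_eq_zero]
      refine measure_mono_null (fun z hz => ?_) (measure_empty (μ := μ))
      exact hz.1 (subset_closure hz.2.1)
    by_cases hp0 : r p = 0
    · obtain ⟨v, s, hs, hv⟩ := exists_increasing_direction hrp (hd p hpV hpc hp0)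
      obtain ⟨δ, hδ, hball⟩ := Metric.mem_nhds_iff.1 (inter_mem hs (hV.mem_nhds hpV))
      let W : ENNReal := μ (Metric.ball p (δ + 2 * ‖v‖))
      have hW : W ≠ ⊤ := measure_ball_lt_top.ne
      refine ⟨Metric.ball p δ, mem_nhdsWithin_of_mem_nhds (Metric.ball_mem_nhds _ hδ), W.toNNReal,
        fun ε hε => ?_⟩
      rw [ENNReal.coe_toNNReal hW]
      let S : Set E := Metric.ball p δ ∩ r ⁻¹' Set.Ioo (-ε) 0
      have hSo : IsOpen S := (hr.continuousOn.mono fun z hz => (hball hz).2).isOpen_inter_preimage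
        Metric.isOpen_ball isOpen_Ioo
      have hsub : {z ∈ Metric.ball p δ | z ∈ region V r ∧ -ε < r z} ⊆ S :=
        fun z hz => ⟨hz.1, hz.2.2, hz.2.1.2⟩
      refine (measure_mono hsub).trans ?_
      by_cases hε1 : 1 < ε
      · calc μ S ≤ W := measure_mono fun z hz => Metric.ball_subset_ball
              (by linarith [norm_nonneg v]) hz.1
          _ = W * ENNReal.ofReal 1 := by simp
          _ ≤ W * ENNReal.ofReal ε := by gcongr
      · push Not at hε1
        -- About 1/ε translates of the strip by multiples of εv are pairwise disjoint, because r
        -- varies by less than ε on the strip but rises by at least ε between translates. They all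
        -- fit in one fixed ball, as Nε ≤ 2.
        let N : ℕ := ⌈1 / ε⌉₊
        have hN : 1 / ε ≤ N := Nat.le_ceil _
        have hN2 : (N : ℝ) * ε ≤ 2 := by
          have h1 : (N : ℝ) < 1 / ε + 1 := Nat.ceil_lt_add_one (by positivity)
          have h2 : 1 / ε * ε = 1 := by field_simp
          nlinarith
        let T : ℕ → Set E := fun m => (fun z => ((m : ℝ) * ε) • v + z) '' S
        have hTm : ∀ m, μ (T m) = μ S := fun m => measure_vadd μ (((m : ℝ) * ε) • v) S
        have hTo : ∀ m, IsOpen (T m) := fun m => (isOpenMap_add_left _) _ hSo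
        have key : ∀ a b : ℕ, a < b → Disjoint (T a) (T b) := by
          intro a b hab
          rw [Set.disjoint_left]
          rintro _ ⟨x, hx, rfl⟩ ⟨y, hy, hxy⟩
          have hxy : ((b : ℝ) * ε) • v + y = ((a : ℝ) * ε) • v + x := hxy
          have e : x = y + (((b : ℝ) - a) * ε) • v := by
            rw [sub_mul, sub_smul, ← sub_eq_zero]
            rw [← sub_eq_zero] at hxy
            rw [← neg_eq_zero, ← hxy]; abel
          have hab1 : (1 : ℝ) ≤ (b : ℝ) - a := by
            have : (a : ℝ) + 1 ≤ b := by exact_mod_cast hab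
            linarith
          have h := hv y (hball hy.1).1 (((b : ℝ) - a) * ε) (by positivity)
            (by rw [← e]; exact (hball hx.1).1)
          rw [← e] at h
          have h1 := hx.2.2
          have h2 := hy.2.1
          nlinarith
        have hdisj : Set.PairwiseDisjoint (↑(Finset.range N) : Set ℕ) T := by
          intro a _ b _ hab
          rcases lt_or_gt_of_ne hab with h | h
          · exact key a b h
          · exact (key b a h).symm
        have hunion : (⋃ m ∈ Finset.range N, T m) ⊆ Metric.ball p (δ + 2 * ‖v‖) := by
          intro z hz
          simp only [Set.mem_iUnion, Finset.mem_range] at hz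
          obtain ⟨m, hm, x, hx, rfl⟩ := hz
          have hx1 := hx.1
          rw [Metric.mem_ball, dist_eq_norm] at hx1 ⊢
          have h1 : ‖((m : ℝ) * ε) • v‖ ≤ 2 * ‖v‖ := by
            rw [norm_smul, Real.norm_eq_abs, abs_of_nonneg (by positivity)]
            have : (m : ℝ) ≤ N := by exact_mod_cast hm.le
            gcongr
            nlinarith
          calc ‖((m : ℝ) * ε) • v + x - p‖ = ‖(x - p) + ((m : ℝ) * ε) • v‖ := by congr 1; abel
            _ ≤ ‖x - p‖ + ‖((m : ℝ) * ε) • v‖ := norm_add_le _ _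
            _ < δ + 2 * ‖v‖ := by linarith
        have hsum := measure_biUnion_finset (μ := μ) hdisj fun m _ => (hTo m).measurableSet
        simp only [hTm, Finset.sum_const, Finset.card_range, nsmul_eq_mul] at hsum
        have hle : (N : ENNReal) * μ S ≤ W := hsum ▸ measure_mono hunion
        have hNε : 1 ≤ ENNReal.ofReal ε * N := by
          rw [← ENNReal.ofReal_natCast, ← ENNReal.ofReal_mul hε.le, ENNReal.one_le_ofReal]
          have h2 : 1 / ε * ε = 1 := by field_simp
          nlinarith
        calc μ S = 1 * μ S := (one_mul _).symm
          _ ≤ (ENNReal.ofReal ε * N) * μ S := by gcongr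
          _ = ENNReal.ofReal ε * (N * μ S) := mul_assoc _ _ _
          _ ≤ ENNReal.ofReal ε * W := by gcongr
          _ = W * ENNReal.ofReal ε := mul_comm _ _
    · have hneg : r p < 0 := lt_of_le_of_ne
        (region_le_zero_of_mem_closure hV hr.continuousOn hpV hpc) hp0
      have h1 : ∀ᶠ x in 𝓝 p, r x < r p / 2 :=
        hrp.continuousAt.eventually (gt_mem_nhds (by linarith))
      let W : ENNReal := μ (Metric.ball p 1)
      have hW : W ≠ ⊤ := measure_ball_lt_top.ne
      have hc : W * ENNReal.ofReal (2 / (-r p)) ≠ ⊤ := ENNReal.mul_ne_top hW ENNReal.ofReal_ne_top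
      refine ⟨_, mem_nhdsWithin_of_mem_nhds (h1.and (Metric.ball_mem_nhds p one_pos)),
        (W * ENNReal.ofReal (2 / (-r p))).toNNReal, fun ε hε => ?_⟩
      rw [ENNReal.coe_toNNReal hc]
      by_cases hε1 : ε ≤ -r p / 2
      · refine le_trans (le_of_eq (measure_mono_null (fun z hz => ?_) (measure_empty (μ := μ))))
          zero_le
        have h2 := hz.1.1
        have h3 := hz.2.2
        linarith
      · push Not at hε1
        rw [mul_assoc, ← ENNReal.ofReal_mul (by have : 0 < -r p := by linarith
                                                positivity)]
        have : 1 ≤ ENNReal.ofReal (2 / (-r p) * ε) := by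
          rw [ENNReal.one_le_ofReal, div_mul_eq_mul_div, le_div_iff₀ (by linarith)]
          linarith
        calc _ ≤ W := measure_mono fun z hz => hz.1.2
          _ = W * 1 := (mul_one _).symm
          _ ≤ _ := by gcongr

end Normed

/-! ### Sesquilinear forms, tangential fields and the Levi form near the boundary -/

theorem sesq_add_left (A : Matrix (Fin n) (Fin n) ℂ) (v v' w : Cn n) :
    sesq A (v + v') w = sesq A v w + sesq A v' w := by
  simp only [sesq, ← Finset.sum_add_distrib, PiLp.add_apply]
  exact Finset.sum_congr rfl fun _ _ => Finset.sum_congr rfl fun _ _ => by ring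

theorem sesq_add_right (A : Matrix (Fin n) (Fin n) ℂ) (v w w' : Cn n) :
    sesq A v (w + w') = sesq A v w + sesq A v w' := by
  simp only [sesq, ← Finset.sum_add_distrib, PiLp.add_apply, map_add]
  exact Finset.sum_congr rfl fun _ _ => Finset.sum_congr rfl fun _ _ => by ring

theorem sesq_smul_left (A : Matrix (Fin n) (Fin n) ℂ) (c : ℂ) (v w : Cn n) :
    sesq A (c • v) w = c * sesq A v w := by
  simp only [sesq, Finset.mul_sum, PiLp.smul_apply, smul_eq_mul]
  exact Finset.sum_congr rfl fun _ _ => Finset.sum_congr rfl fun _ _ => by ring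

theorem sesq_smul_right (A : Matrix (Fin n) (Fin n) ℂ) (c : ℂ) (v w : Cn n) :
    sesq A v (c • w) = (starRingEnd ℂ) c * sesq A v w := by
  simp only [sesq, Finset.mul_sum, PiLp.smul_apply, smul_eq_mul, map_mul]
  exact Finset.sum_congr rfl fun _ _ => Finset.sum_congr rfl fun _ _ => by ring

theorem sesq_sum_left {ι : Type*} (s : Finset ι) (A : Matrix (Fin n) (Fin n) ℂ) (v : ι → Cn n)
    (w : Cn n) : sesq A (∑ i ∈ s, v i) w = ∑ i ∈ s, sesq A (v i) w := by
  classical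
  induction s using Finset.induction_on with
  | empty => simp [sesq]
  | insert a s ha ih => rw [Finset.sum_insert ha, Finset.sum_insert ha, sesq_add_left, ih]

theorem sesq_sum_right {ι : Type*} (s : Finset ι) (A : Matrix (Fin n) (Fin n) ℂ) (v : Cn n)
    (w : ι → Cn n) : sesq A v (∑ i ∈ s, w i) = ∑ i ∈ s, sesq A v (w i) := by
  classical
  induction s using Finset.induction_on with
  | empty => simp [sesq]
  | insert a s ha ih => rw [Finset.sum_insert ha, Finset.sum_insert ha, sesq_add_right, ih]

theorem norm_sesq_le (A : Matrix (Fin n) (Fin n) ℂ) (v w : Cn n) :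
    ‖sesq A v w‖ ≤ (∑ j, ∑ k, ‖A j k‖) * (‖v‖ * ‖w‖) := by
  rw [Finset.sum_mul]
  refine (norm_sum_le _ _).trans (Finset.sum_le_sum fun j _ => ?_)
  rw [Finset.sum_mul]
  refine (norm_sum_le _ _).trans (Finset.sum_le_sum fun k _ => ?_)
  rw [norm_mul, norm_mul, RCLike.norm_conj, mul_assoc]
  gcongr
  · exact PiLp.norm_apply_le v j
  · exact PiLp.norm_apply_le w k

/-- The value `∂f_z(v)`. -/
def del (f : Cn n → ℝ) (z v : Cn n) : ℂ := ∑ j, grad f z j * v j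

/-- The vector conjugate to the gradient. -/
def gradBar (f : Cn n → ℝ) (z : Cn n) : Cn n :=
  WithLp.toLp 2 fun j => (starRingEnd ℂ) (grad f z j)

theorem del_eq_inner (f : Cn n → ℝ) (z v : Cn n) : del f z v = inner ℂ (gradBar f z) v := by
  simp [del, gradBar, PiLp.inner_apply, mul_comm]

theorem norm_del_le (f : Cn n → ℝ) (z v : Cn n) : ‖del f z v‖ ≤ ‖gradBar f z‖ * ‖v‖ := by
  rw [del_eq_inner]
  exact norm_inner_le_norm _ _

theorem del_gradBar (f : Cn n → ℝ) (z : Cn n) :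
    del f z (gradBar f z) = ((‖gradBar f z‖ ^ 2 : ℝ) : ℂ) := by
  rw [del_eq_inner, inner_self_eq_norm_sq_to_K]
  push_cast; rfl

theorem del_sub_smul (f : Cn n → ℝ) (z v w : Cn n) (a b : ℂ) :
    del f z (a • v - b • w) = a * del f z v - b * del f z w := by
  simp only [del, PiLp.sub_apply, PiLp.smul_apply, smul_eq_mul, Finset.mul_sum,
    ← Finset.sum_sub_distrib]
  exact Finset.sum_congr rfl fun _ _ => by ring

/-- A real differential is determined by its (1,0)-part, being twice the real part of it. -/
theorem gradBar_ne_zero {f : Cn n → ℝ} {z : Cn n} (hf : DifferentiableAt ℝ f z)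
    (h : fderiv ℝ f z ≠ 0) : gradBar f z ≠ 0 := by
  intro h0
  apply h
  have hF : HasFDerivAt (fun x => (f x : ℂ)) (Complex.ofRealCLM.comp (fderiv ℝ f z)) z :=
    Complex.ofRealCLM.hasFDerivAt.comp z hf.hasFDerivAt
  have hg : ∀ m, wirt (-Complex.I) m (fun x => (f x : ℂ)) z = 0 := by
    intro m
    have : gradBar f z m = 0 := by rw [h0]; rfl
    simpa [gradBar, grad] using this
  ext w
  have h1 := clm_wirt_neg_eq_sum (Complex.ofRealCLM.comp (fderiv ℝ f z)) w
  have h2 : ∀ m, (Complex.ofRealCLM.comp (fderiv ℝ f z)) (EuclideanSpace.single m 1) +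
      -Complex.I * (Complex.ofRealCLM.comp (fderiv ℝ f z)) (EuclideanSpace.single m Complex.I)
        = 0 := by
    intro m
    have := hg m
    rw [wirt, hF.fderiv] at this
    simpa using this
  simp only [h2, mul_zero, Finset.sum_const_zero] at h1
  have := congrArg Complex.re h1
  simpa using this

/-- A vector field tangent to the kernel of `∂f`. -/
def tangentField (f : Cn n → ℝ) (j : Fin n) (z : Cn n) : Cn n :=
  ((‖gradBar f z‖ ^ 2 : ℝ) : ℂ) • EuclideanSpace.single j 1 - grad f z j • gradBar f z

theorem del_tangentField (f : Cn n → ℝ) (j : Fin n) (z : Cn n) :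
    del f z (tangentField f j z) = 0 := by
  rw [tangentField, del_sub_smul, del_gradBar]
  have : del f z (EuclideanSpace.single j 1) = grad f z j := by
    simp [del]
  rw [this]; ring

/-- The tangential part of v, multiplied by |∂f|². Avoiding the division keeps the fields polynomial
in the gradient and its conjugate, hence differentiable even where the gradient vanishes. -/
theorem sum_smul_tangentField (f : Cn n → ℝ) (z v : Cn n) :
    ∑ j, v j • tangentField f j z =
      ((‖gradBar f z‖ ^ 2 : ℝ) : ℂ) • v - del f z v • gradBar f z := by
  ext k
  simp only [tangentField, PiLp.sub_apply, PiLp.smul_apply, smul_eq_mul, WithLp.ofLp_sum,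
    Finset.sum_apply, del]
  simp only [mul_sub, Finset.sum_sub_distrib]
  congr 1
  · simp [mul_comm]
  · rw [Finset.sum_mul]
    exact Finset.sum_congr rfl fun _ _ => by ring

theorem gradBar_contDiffAt {f : Cn n → ℝ} {z : Cn n} {m k : WithTop ℕ∞} (hf : ContDiffAt ℝ k f z)
    (h : m + 1 ≤ k) : ContDiffAt ℝ m (gradBar f) z := by
  rw [contDiffAt_piLp]
  intro j
  exact Complex.conjCLE.contDiff.contDiffAt.comp z (grad_contDiffAt hf h j)

theorem tangentField_contDiffAt {f : Cn n → ℝ} {z : Cn n} {m k : WithTop ℕ∞}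
    (hf : ContDiffAt ℝ k f z) (h : m + 1 ≤ k) (j : Fin n) :
    ContDiffAt ℝ m (tangentField f j) z := by
  have h1 := gradBar_contDiffAt hf h
  have h2 : ContDiffAt ℝ m (fun z => ((‖gradBar f z‖ ^ 2 : ℝ) : ℂ)) z :=
    Complex.ofRealCLM.contDiff.contDiffAt.comp z (h1.norm_sq ℝ)
  exact (h2.smul contDiffAt_const).sub ((grad_contDiffAt hf h j).smul h1)

theorem sesq_hess_contDiffAt {f : Cn n → ℝ} {v w : Cn n → Cn n} {z : Cn n} {m k : WithTop ℕ∞}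
    (hf : ContDiffAt ℝ k f z) (h : m + 1 + 1 ≤ k) (hv : ContDiffAt ℝ m v z)
    (hw : ContDiffAt ℝ m w z) : ContDiffAt ℝ m (fun z => sesq (hess f z) (v z) (w z)) z := by
  unfold sesq
  refine ContDiffAt.sum fun i _ => ContDiffAt.sum fun j _ => ?_
  rw [contDiffAt_piLp] at hv hw
  exact ((hess_contDiffAt hf h i j).mul (hv i)).mul
    (Complex.conjCLE.contDiff.contDiffAt.comp z (hw j))

theorem exists_bound_on_compact {V K : Set (Cn n)} {f : Cn n → ℝ} (hf : ContinuousOn f V)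
    (hK : IsCompact K) (hKV : K ⊆ V) : ∃ C : ℝ, 0 ≤ C ∧ ∀ z ∈ K, f z ≤ C := by
  obtain ⟨C, hC⟩ := hK.exists_bound_of_continuousOn (hf.mono hKV)
  exact ⟨|C|, abs_nonneg _, fun z hz => (le_abs_self _).trans ((hC z hz).trans (le_abs_self C))⟩

theorem continuousOn_hess {V : Set (Cn n)} {r : Cn n → ℝ} (hV : IsOpen V)
    (hr : ContDiffOn ℝ 2 r V) (j k : Fin n) : ContinuousOn (fun z => hess r z j k) V := fun z hz =>
  (hess_contDiffAt (m := 0) (hr.contDiffAt (hV.mem_nhds hz)) (by norm_num)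
    j k).continuousAt.continuousWithinAt

theorem continuousOn_gradBar {V : Set (Cn n)} {r : Cn n → ℝ} (hV : IsOpen V)
    (hr : ContDiffOn ℝ 1 r V) : ContinuousOn (gradBar r) V := fun z hz =>
  (gradBar_contDiffAt (m := 0) (hr.contDiffAt (hV.mem_nhds hz))
    (by norm_num)).continuousAt.continuousWithinAt

/-- Near a Levi-flat boundary the complex Hessian of a defining function is small in complex
tangential directions. -/
theorem levi_form_bound {V K : Set (Cn n)} {r : Cn n → ℝ} (hV : IsOpen V)
    (hr : ContDiffOn ℝ 3 r V)
    (hd : ∀ z ∈ V, z ∈ closure (region V r) → r z = 0 → fderiv ℝ r z ≠ 0)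
    (hL : ∀ z ∈ V, z ∈ closure (region V r) → r z = 0 → ∀ v w, del r z v = 0 → del r z w = 0 →
      sesq (hess r z) v w = 0)
    (hK : IsCompact K) (hKV : K ⊆ V) :
    ∃ C : ℝ, 0 ≤ C ∧ ∀ z ∈ K, z ∈ region V r → ∀ v,
      ‖sesq (hess r z) v v‖ ≤ C * (|r z| * ‖v‖ ^ 2 + ‖del r z v‖ * ‖v‖) := by
  have hr1 : ContDiffOn ℝ 1 r V := hr.of_le (by norm_num)
  have hr2 : ContDiffOn ℝ 2 r V := hr.of_le (by norm_num)
  -- The Levi form on a spanning family of tangential fields. It is C¹ because r is C³, and it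
  -- vanishes on the boundary by Levi-flatness, so it is O(|r|).
  let g : Cn n → Fin n → Fin n → ℂ := fun z j k =>
    sesq (hess r z) (tangentField r j z) (tangentField r k z)
  have hg : ContDiffOn ℝ 1 g V := by
    intro z hz
    have hz' := hr.contDiffAt (hV.mem_nhds hz)
    refine ContDiffAt.contDiffWithinAt (contDiffAt_pi.2 fun j => contDiffAt_pi.2 fun k => ?_)
    exact sesq_hess_contDiffAt hz' (by norm_num) (tangentField_contDiffAt hz' (by norm_num) j)
      (tangentField_contDiffAt hz' (by norm_num) k)
  obtain ⟨C₁, hC₁, hgb⟩ := norm_le_mul_abs_of_vanish hV hr1 hd hg (fun z hz hzc hz0 => by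
    ext j k
    exact hL z hz hzc hz0 _ _ (del_tangentField r j z) (del_tangentField r k z)) hK hKV
  obtain ⟨H, hH0, hH⟩ := exists_bound_on_compact (f := fun z => ∑ j, ∑ k, ‖hess r z j k‖)
    (continuousOn_finsetSum _ fun j _ => continuousOn_finsetSum _ fun k _ =>
      (continuousOn_hess hV hr2 j k).norm) hK hKV
  obtain ⟨A, hA0, hA⟩ := exists_bound_on_compact (f := fun z => ‖gradBar r z‖)
    (continuousOn_gradBar hV hr1).norm hK hKV
  -- The gradient may vanish away from the boundary, but there |r| is positive; compactness bounds
  -- the sum from below. It lets the final inequality be divided by c, the part with |r| being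
  -- harmless.
  obtain ⟨c, hc0, hc⟩ : ∃ c : ℝ, 0 < c ∧ ∀ z ∈ K ∩ closure (region V r),
      c ≤ ‖gradBar r z‖ ^ 4 + |r z| := by
    have hcomp : IsCompact (K ∩ closure (region V r)) := hK.inter_right isClosed_closure
    have hcont : ContinuousOn (fun z => ‖gradBar r z‖ ^ 4 + |r z|) (K ∩ closure (region V r)) :=
      (((continuousOn_gradBar hV hr1).norm.pow 4).add hr1.continuousOn.abs).mono
        (Set.inter_subset_left.trans hKV)
    rcases (K ∩ closure (region V r)).eq_empty_or_nonempty with he | hne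
    · exact ⟨1, one_pos, by simp [he]⟩
    · obtain ⟨z₀, hz₀, hmin⟩ := hcomp.exists_isMinOn hne hcont
      refine ⟨_, ?_, fun z hz => hmin hz⟩
      by_cases h0 : r z₀ = 0
      · have := gradBar_ne_zero ((hr1.contDiffAt (hV.mem_nhds (hKV hz₀.1))).differentiableAt
          (by norm_num)) (hd z₀ (hKV hz₀.1) hz₀.2 h0)
        have := norm_pos_iff.2 this
        positivity
      · have := abs_pos.2 h0
        positivity
  refine ⟨(n * n * C₁ + 5 * (H * A ^ 3) + H) / c, by positivity, fun z hz hzr v => ?_⟩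
  have hcz := hc z ⟨hz, subset_closure hzr⟩
  have hHz := hH z hz
  have hAz := hA z hz
  have hgz := hgb z hz hzr
  set a := gradBar r z with ha
  set s := del r z v with hs
  set h := hess r z with hh
  set v' : Cn n := ((‖a‖ ^ 2 : ℝ) : ℂ) • v - s • a with hv'
  have hnv := norm_nonneg v
  have hns := norm_nonneg s
  have hna := norm_nonneg a
  have hsb : ‖s‖ ≤ A * ‖v‖ := (norm_del_le r z v).trans (by gcongr)
  have hv'n : ‖v'‖ ≤ 2 * A ^ 2 * ‖v‖ := by
    have h1 := norm_sub_le (((‖a‖ ^ 2 : ℝ) : ℂ) • v) (s • a)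
    rw [norm_smul, norm_smul, Complex.norm_real, Real.norm_eq_abs, abs_of_nonneg (by positivity)]
      at h1
    have h2 : ‖a‖ ^ 2 * ‖v‖ ≤ A ^ 2 * ‖v‖ := by gcongr
    have h3 : ‖s‖ * ‖a‖ ≤ (A * ‖v‖) * A := by gcongr
    calc ‖v'‖ ≤ _ := h1
      _ ≤ _ := by nlinarith
  have hsesq : ∀ x y : Cn n, ‖sesq h x y‖ ≤ H * (‖x‖ * ‖y‖) := fun x y =>
    (norm_sesq_le h x y).trans (by gcongr)
  have e1 : ‖sesq h v' v'‖ ≤ n * n * C₁ * (|r z| * ‖v‖ ^ 2) := by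
    have h1 : sesq h v' v' = sesq (Matrix.of (g z)) v v := by
      rw [hv', ← sum_smul_tangentField, sesq_sum_left]
      refine Finset.sum_congr rfl fun j _ => ?_
      rw [sesq_sum_right]
      refine Finset.sum_congr rfl fun k _ => ?_
      rw [sesq_smul_left, sesq_smul_right]
      simp only [Matrix.of_apply, g]
      ring
    rw [h1]
    refine (norm_sesq_le _ _ _).trans ?_
    have h2 : ∑ j, ∑ k, ‖Matrix.of (g z) j k‖ ≤ n * n * (C₁ * |r z|) := by
      calc ∑ j, ∑ k, ‖Matrix.of (g z) j k‖ ≤ ∑ _j : Fin n, ∑ _k : Fin n, C₁ * |r z| :=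
            Finset.sum_le_sum fun j _ => Finset.sum_le_sum fun k _ =>
              ((norm_le_pi_norm (g z j) k).trans (norm_le_pi_norm (g z) j)).trans hgz
        _ = n * n * (C₁ * |r z|) := by simp; ring
    calc _ ≤ n * n * (C₁ * |r z|) * (‖v‖ * ‖v‖) := by gcongr
      _ = _ := by ring
  have e2 : ‖a‖ ^ 4 * ‖sesq h v v‖ ≤
      n * n * C₁ * (|r z| * ‖v‖ ^ 2) + 5 * (H * A ^ 3) * (‖s‖ * ‖v‖) := by
    -- Here v' is tangential and s a is normal. Expanding the Hessian along this splitting, every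
    -- term except that of (v', v') contains s = ∂r(v); their constants 2 + 2 + 1 give the 5.
    have hx : ((‖a‖ ^ 2 : ℝ) : ℂ) • v = v' + s • a := by rw [hv']; abel
    have h1 : sesq h (((‖a‖ ^ 2 : ℝ) : ℂ) • v) (((‖a‖ ^ 2 : ℝ) : ℂ) • v) =
        sesq h v' v' + (starRingEnd ℂ) s * sesq h v' a + s * sesq h a v'
          + s * (starRingEnd ℂ) s * sesq h a a := by
      rw [hx]
      simp only [sesq_add_left, sesq_add_right, sesq_smul_left, sesq_smul_right]
      ring
    have h2 : ‖sesq h (((‖a‖ ^ 2 : ℝ) : ℂ) • v) (((‖a‖ ^ 2 : ℝ) : ℂ) • v)‖ =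
        ‖a‖ ^ 4 * ‖sesq h v v‖ := by
      rw [sesq_smul_left, sesq_smul_right, Complex.conj_ofReal, norm_mul, norm_mul,
        Complex.norm_real, Real.norm_eq_abs, abs_of_nonneg (by positivity)]
      ring
    rw [← h2, h1]
    have b1 : ‖(starRingEnd ℂ) s * sesq h v' a‖ ≤ 2 * (H * A ^ 3) * (‖s‖ * ‖v‖) := by
      rw [norm_mul, RCLike.norm_conj]
      calc ‖s‖ * ‖sesq h v' a‖ ≤ ‖s‖ * (H * ((2 * A ^ 2 * ‖v‖) * A)) := by
            gcongr
            exact (hsesq _ _).trans (by gcongr)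
        _ = _ := by ring
    have b2 : ‖s * sesq h a v'‖ ≤ 2 * (H * A ^ 3) * (‖s‖ * ‖v‖) := by
      rw [norm_mul]
      calc ‖s‖ * ‖sesq h a v'‖ ≤ ‖s‖ * (H * (A * (2 * A ^ 2 * ‖v‖))) := by
            gcongr
            exact (hsesq _ _).trans (by gcongr)
        _ = _ := by ring
    have b3 : ‖s * (starRingEnd ℂ) s * sesq h a a‖ ≤ H * A ^ 3 * (‖s‖ * ‖v‖) := by
      rw [norm_mul, norm_mul, RCLike.norm_conj]
      calc ‖s‖ * ‖s‖ * ‖sesq h a a‖ ≤ ‖s‖ * (A * ‖v‖) * (H * (A * A)) := by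
            gcongr
            exact (hsesq _ _).trans (by gcongr)
        _ = _ := by ring
    have t1 := norm_add_le (sesq h v' v' + (starRingEnd ℂ) s * sesq h v' a + s * sesq h a v')
      (s * (starRingEnd ℂ) s * sesq h a a)
    have t2 := norm_add_le (sesq h v' v' + (starRingEnd ℂ) s * sesq h v' a) (s * sesq h a v')
    have t3 := norm_add_le (sesq h v' v') ((starRingEnd ℂ) s * sesq h v' a)
    linarith
  rw [div_mul_eq_mul_div, le_div_iff₀ hc0]
  have e3 : ‖sesq h v v‖ * |r z| ≤ H * (|r z| * ‖v‖ ^ 2) := by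
    calc ‖sesq h v v‖ * |r z| ≤ H * (‖v‖ * ‖v‖) * |r z| := by gcongr; exact hsesq v v
      _ = _ := by ring
  have e4 : ‖sesq h v v‖ * c ≤ ‖sesq h v v‖ * (‖a‖ ^ 4 + |r z|) := by gcongr
  have p1 : 0 ≤ |r z| * ‖v‖ ^ 2 := by positivity
  have p2 : 0 ≤ ‖s‖ * ‖v‖ := by positivity
  have p3 : 0 ≤ n * n * C₁ * (‖s‖ * ‖v‖) := by positivity
  have p4 : 0 ≤ 5 * (H * A ^ 3) * (|r z| * ‖v‖ ^ 2) := by positivity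
  have p5 : 0 ≤ H * (‖s‖ * ‖v‖) := by positivity
  nlinarith

/-! ### The mixed Monge--Ampère operator -/

/-- The mixed Monge--Ampère operator: the mixed discriminant of the complex Hessians. -/
def mixedMA (u : Fin n → Cn n → ℝ) (z : Cn n) : ℝ := (mixedDisc fun i => hess (u i) z).re

theorem update_hess (u : Fin n → Cn n → ℝ) (i₀ : Fin n) (ζ : Cn n → ℝ) (z : Cn n) :
    Function.update (fun i => hess (u i) z) i₀ (hess ζ z) =
      fun i => hess (Function.update u i₀ ζ i) z := by
  ext1 i
  by_cases hi : i = i₀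
  · subst hi; simp
  · simp [hi]

theorem setIntegral_mul_mixedMA {G K : Set (Cn n)} (hG : IsOpen G) (hK : IsCompact K)
    (hKG : K ⊆ G) (i₀ : Fin n) {ζ : Cn n → ℝ} {u : Fin n → Cn n → ℝ} (hζ : ContDiffOn ℝ 2 ζ G)
    (hζK : ∀ z ∈ G, z ∉ K → ζ z = 0) (hu : ∀ i, ContDiffOn ℝ 2 (u i) G) :
    ∫ z in G, ζ z * mixedMA u z = ∫ z in G, u i₀ z * mixedMA (Function.update u i₀ ζ) z := by
  have := setIntegral_mul_mixedDisc hG hK hKG i₀ hζ hζK hu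
  simp only [update_hess] at this
  exact this

theorem continuousOn_mixedMA {G : Set (Cn n)} (hG : IsOpen G) {u : Fin n → Cn n → ℝ}
    (hu : ∀ i, ContDiffOn ℝ 2 (u i) G) : ContinuousOn (mixedMA u) G := by
  refine Complex.continuous_re.comp_continuousOn (continuous_mixedDisc.comp_continuousOn ?_)
  exact continuousOn_pi.2 fun i => continuousOn_pi.2 fun j => continuousOn_pi.2 fun k =>
    continuousOn_hess hG (hu i) j k

theorem contDiffOn_update {G : Set (Cn n)} {u : Fin n → Cn n → ℝ} {ζ : Cn n → ℝ} (i₀ : Fin n)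
    (hu : ∀ i, ContDiffOn ℝ 2 (u i) G) (hζ : ContDiffOn ℝ 2 ζ G) (i : Fin n) :
    ContDiffOn ℝ 2 (Function.update u i₀ ζ i) G := by
  by_cases hi : i = i₀
  · subst hi; simpa using hζ
  · simpa [hi] using hu i

theorem mixedMA_nonneg {u : Fin n → Cn n → ℝ} {z : Cn n} (hu : ∀ i, (hess (u i) z).PosSemidef) :
    0 ≤ mixedMA u z := mixedDisc_re_nonneg hu

/-- The form inequality makes C·∂∂̄w ± ∂∂̄ζ positive, and the mixed discriminant with positive
matrices in the other slots is monotone. No sign of ∂∂̄ζ is required. -/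
theorem abs_mixedMA_update_le {u : Fin n → Cn n → ℝ} {ζ w : Cn n → ℝ} {z : Cn n} {C : ℝ}
    (i₀ : Fin n) (hu : ∀ i, i ≠ i₀ → (hess (u i) z).PosSemidef)
    (hζ : (hess ζ z).IsHermitian) (hw : (hess w z).IsHermitian)
    (h : ∀ v, ‖sesq (hess ζ z) v v‖ ≤ C * (sesq (hess w z) v v).re) :
    |mixedMA (Function.update u i₀ ζ) z| ≤ C * mixedMA (Function.update u i₀ w) z := by
  have hCw : ((C : ℂ) • hess w z).IsHermitian := by
    rw [Matrix.IsHermitian, Matrix.conjTranspose_smul, hw.eq]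
    simp
  have key := mixedDisc_abs_le (A := fun i => hess (u i) z) i₀ (B := hess ζ z)
    (C := (C : ℂ) • hess w z) hu
    (posSemidef_of_sesq (hCw.sub hζ) fun v => ?_) (posSemidef_of_sesq (hCw.add hζ) fun v => ?_)
  · rw [mixedDisc_update_smul, Complex.re_ofReal_mul] at key
    simpa only [mixedMA, ← update_hess] using key
  · rw [sesq_sub, sesq_smul, Complex.sub_re, Complex.re_ofReal_mul]
    linarith [h v, Complex.re_le_norm (sesq (hess ζ z) v v)]
  · rw [sesq_add, sesq_smul, Complex.add_re, Complex.re_ofReal_mul]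
    linarith [h v, (abs_le.1 (Complex.abs_re_le_norm (sesq (hess ζ z) v v))).1]

/-- Exchange the entries one at a time; every intermediate family is still positive semidefinite. -/
theorem mixedDisc_mono {A B : Fin n → Matrix (Fin n) (Fin n) ℂ} (hA : ∀ i, (A i).PosSemidef)
    (hB : ∀ i, (B i).PosSemidef) (h : ∀ i, (B i - A i).PosSemidef) :
    (mixedDisc A).re ≤ (mixedDisc B).re := by
  have key : ∀ s : Finset (Fin n), (mixedDisc A).re ≤ (mixedDisc (s.piecewise B A)).re := by
    intro s
    induction s using Finset.induction_on with
    | empty => simp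
    | insert a s ha ih =>
      refine ih.trans ?_
      have hP : ∀ k, ((s.piecewise B A) k).PosSemidef := fun k => by
        by_cases hk : k ∈ s
        · simpa [hk] using hB k
        · simpa [hk] using hA k
      have h1 : Function.update (s.piecewise B A) a (A a) = s.piecewise B A := by
        conv_rhs => rw [← Function.update_eq_self a (s.piecewise B A)]
        simp [ha]
      have h2 : (insert a s).piecewise B A = Function.update (s.piecewise B A) a (B a) :=
        Finset.piecewise_insert s B A a
      have := mixedDisc_abs_le (A := s.piecewise B A) a (fun k _ => hP k) (h a)
        ((hB a).add (hA a))
      rw [h1, ← h2] at this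
      exact (le_abs_self _).trans this
  simpa using key Finset.univ

/-- The matrix determinant lemma. Applied with t = ε⁻², it shows that stretching one complex
direction costs ε⁻² in the determinant, whatever the dimension. -/
theorem det_one_add_vecMulVec (t : ℝ) (a : Fin n → ℂ) :
    (1 + (t : ℂ) • Matrix.vecMulVec a (fun k => (starRingEnd ℂ) (a k))).det =
      1 + t * ∑ j, a j * (starRingEnd ℂ) (a j) := by
  have h : (t : ℂ) • Matrix.vecMulVec a (fun k => (starRingEnd ℂ) (a k)) =
      Matrix.replicateCol Unit ((t : ℂ) • a) *
        Matrix.replicateRow Unit (fun k => (starRingEnd ℂ) (a k)) := by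
    rw [← Matrix.smul_vecMulVec, Matrix.vecMulVec_eq Unit]
  rw [h, Matrix.det_one_add_mul_comm]
  simp [Matrix.mul_apply, Finset.mul_sum]
  exact Finset.sum_congr rfl fun _ _ => by ring

theorem hess_norm_sq (z : Cn n) : hess (fun x : Cn n => ‖x‖ ^ 2) z = 1 := by
  have hre : ∀ (x : Cn n) (k : Fin n) (c : ℂ), inner ℝ x (EuclideanSpace.single k c) =
      ((starRingEnd ℂ) (x k) * c).re := by
    intro x k c
    have : inner ℝ x (EuclideanSpace.single k c) = ∑ i, inner ℝ (x i)
        ((EuclideanSpace.single k c : Cn n) i) := PiLp.inner_apply _ _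
    rw [this, Finset.sum_eq_single k]
    · simp [Complex.inner]
      ring
    · intro b _ hb
      simp [hb]
    · simp
  have h1 : ∀ k : Fin n, wirt Complex.I k (fun x : Cn n => ((‖x‖ ^ 2 : ℝ) : ℂ)) =
      fun x => x k := by
    intro k
    ext x
    have hd : HasFDerivAt (fun x : Cn n => ((‖x‖ ^ 2 : ℝ) : ℂ))
        (Complex.ofRealCLM.comp (2 • innerSL ℝ x)) x :=
      Complex.ofRealCLM.hasFDerivAt.comp x (hasStrictFDerivAt_norm_sq x).hasFDerivAt
    rw [wirt, hd.fderiv]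
    simp [hre]
    apply Complex.ext <;> simp
  ext j k
  rw [hess, h1]
  have hd : HasFDerivAt (fun x : Cn n => x k)
      ((EuclideanSpace.proj k : Cn n →L[ℂ] ℂ).restrictScalars ℝ) z :=
    ((EuclideanSpace.proj k : Cn n →L[ℂ] ℂ).restrictScalars ℝ).hasFDerivAt
  rw [wirt, hd.fderiv]
  by_cases hjk : j = k
  · subst hjk
    simp
    norm_num
  · simp [hjk, Ne.symm hjk]

theorem sesq_hess_comp {κ : ℝ → ℝ} {r : Cn n → ℝ} {z : Cn n} (hκ : ContDiff ℝ 2 κ)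
    (hr : ContDiffAt ℝ 2 r z) (v : Cn n) :
    sesq (hess (fun x => κ (r x)) z) v v = ((deriv κ (r z) : ℝ) : ℂ) * sesq (hess r z) v v
      + ((deriv (deriv κ) (r z) : ℝ) : ℂ) * ((‖del r z v‖ ^ 2 : ℝ) : ℂ) := by
  have h : hess (fun x => κ (r x)) z = ((deriv κ (r z) : ℝ) : ℂ) • hess r z
      + ((deriv (deriv κ) (r z) : ℝ) : ℂ) •
        Matrix.vecMulVec (grad r z) (fun k => (starRingEnd ℂ) (grad r z k)) := by
    ext j k
    rw [hess_comp hκ hr]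
    simp [Matrix.vecMulVec_apply]
  rw [h, sesq_add, sesq_smul, sesq_smul, sesq_vecMulVec]
  have : (∑ j, grad r z j * v j) * (starRingEnd ℂ) (∑ j, grad r z j * v j) =
      ((‖del r z v‖ ^ 2 : ℝ) : ℂ) := by
    rw [Complex.mul_conj, Complex.normSq_eq_norm_sq]; rfl
  rw [this]

theorem sesq_hess_mul {f g : Cn n → ℝ} {z : Cn n} (hf : ContDiffAt ℝ 2 f z)
    (hg : ContDiffAt ℝ 2 g z) (v : Cn n) :
    sesq (hess (fun x => f x * g x) z) v v = f z * sesq (hess g z) v v + g z * sesq (hess f z) v v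
      + del f z v * (starRingEnd ℂ) (del g z v) + del g z v * (starRingEnd ℂ) (del f z v) := by
  have h : hess (fun x => f x * g x) z = (f z : ℂ) • hess g z + (g z : ℂ) • hess f z
      + Matrix.vecMulVec (grad f z) (fun k => (starRingEnd ℂ) (grad g z k))
      + Matrix.vecMulVec (grad g z) (fun k => (starRingEnd ℂ) (grad f z k)) := by
    ext j k
    rw [hess_mul hf hg]
    simp [Matrix.vecMulVec_apply]
  rw [h, sesq_add, sesq_add, sesq_add, sesq_smul, sesq_smul, sesq_vecMulVec, sesq_vecMulVec]
  rfl

theorem del_comp {κ : ℝ → ℝ} {r : Cn n → ℝ} {z : Cn n} (hκ : DifferentiableAt ℝ κ (r z))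
    (hr : DifferentiableAt ℝ r z) (v : Cn n) :
    del (fun x => κ (r x)) z v = ((deriv κ (r z) : ℝ) : ℂ) * del r z v := by
  simp only [del, grad_comp hκ hr, Finset.mul_sum, mul_assoc]

/-! ### The anisotropic metric at distance `ε` from the boundary -/

/-- The anisotropic quadratic form `|v|² + ε⁻²|∂r(v)|²`. -/
def stripForm (r : Cn n → ℝ) (ε : ℝ) (z v : Cn n) : ℝ := ‖v‖ ^ 2 + (‖del r z v‖ / ε) ^ 2

theorem stripForm_nonneg (r : Cn n → ℝ) (ε : ℝ) (z v : Cn n) : 0 ≤ stripForm r ε z v := by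
  unfold stripForm; positivity

/-- Write |∂r(v)| = εy and |v| = x. The term with κ' ∼ 1/ε meets ∂∂̄r, which the Levi bound and |r|
≤ 4ε make O(ε(x² + xy)). The term with κ'' ∼ ε⁻² meets ε²y², and the cross terms with θ are O(xy).
All are O(x² + y²). -/
theorem norm_sesq_hess_cutoff_le {θ r : Cn n → ℝ} {κ : ℝ → ℝ} {z v : Cn n} {M C ε : ℝ}
    (hε : 0 < ε) (hM : 0 ≤ M) (hC : 0 ≤ C) (hθ : ContDiffAt ℝ 2 θ z) (hr : ContDiffAt ℝ 2 r z)
    (hκ : ContDiff ℝ 2 κ) (hθ0 : |θ z| ≤ M) (hθ1 : ‖del θ z v‖ ≤ M * ‖v‖)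
    (hθ2 : ‖sesq (hess θ z) v v‖ ≤ M * ‖v‖ ^ 2) (hκ0 : |κ (r z)| ≤ M)
    (hκ1 : |deriv κ (r z)| ≤ M / ε) (hκ2 : |deriv (deriv κ) (r z)| ≤ M / ε ^ 2)
    (hrz : |r z| ≤ 4 * ε)
    (hL : ‖sesq (hess r z) v v‖ ≤ C * (|r z| * ‖v‖ ^ 2 + ‖del r z v‖ * ‖v‖)) :
    ‖sesq (hess (fun x => θ x * κ (r x)) z) v v‖ ≤ M ^ 2 * (5 * C + 4) * stripForm r ε z v := by
  have hκr : ContDiffAt ℝ 2 (fun x => κ (r x)) z := hκ.contDiffAt.comp z hr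
  rw [sesq_hess_mul hθ hκr, sesq_hess_comp hκ hr, del_comp (hκ.differentiable (by norm_num) _)
    (hr.differentiableAt (by norm_num))]
  set s := del r z v
  set t := del θ z v
  set h := sesq (hess r z) v v
  set x := ‖v‖ with hx
  have hx0 : 0 ≤ x := norm_nonneg v
  have hs0 : 0 ≤ ‖s‖ := norm_nonneg s
  obtain ⟨y, hy0, hy⟩ : ∃ y, 0 ≤ y ∧ ‖s‖ = ε * y := ⟨‖s‖ / ε, by positivity, by field_simp⟩
  have hform : stripForm r ε z v = x ^ 2 + y ^ 2 := by
    rw [stripForm, show ‖del r z v‖ / ε = y by rw [show ‖del r z v‖ = ε * y from hy]; field_simp]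
  rw [hform]
  have hh : ‖h‖ ≤ C * (4 * ε * x ^ 2 + ε * y * x) := by
    rw [hy] at hL
    exact hL.trans (by gcongr)
  have b1 : ‖(θ z : ℂ) * (((deriv κ (r z) : ℝ) : ℂ) * h +
      ((deriv (deriv κ) (r z) : ℝ) : ℂ) * ((‖s‖ ^ 2 : ℝ) : ℂ))‖ ≤
      M * (M * (C * (4 * x ^ 2 + y * x)) + M * y ^ 2) := by
    rw [norm_mul, Complex.norm_real, Real.norm_eq_abs]
    have h1 : ‖((deriv κ (r z) : ℝ) : ℂ) * h‖ ≤ M * (C * (4 * x ^ 2 + y * x)) := by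
      rw [norm_mul, Complex.norm_real, Real.norm_eq_abs]
      calc |deriv κ (r z)| * ‖h‖ ≤ M / ε * (C * (4 * ε * x ^ 2 + ε * y * x)) := by gcongr
        _ = _ := by field_simp
    have h2 : ‖((deriv (deriv κ) (r z) : ℝ) : ℂ) * ((‖s‖ ^ 2 : ℝ) : ℂ)‖ ≤ M * y ^ 2 := by
      rw [norm_mul, Complex.norm_real, Complex.norm_real, Real.norm_eq_abs, Real.norm_eq_abs,
        abs_of_nonneg (sq_nonneg ‖s‖), hy]
      calc |deriv (deriv κ) (r z)| * (ε * y) ^ 2 ≤ M / ε ^ 2 * (ε * y) ^ 2 := by gcongr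
        _ = _ := by field_simp
    gcongr
    exact (norm_add_le _ _).trans (add_le_add h1 h2)
  have b2 : ‖((κ (r z) : ℝ) : ℂ) * sesq (hess θ z) v v‖ ≤ M * (M * x ^ 2) := by
    rw [norm_mul, Complex.norm_real, Real.norm_eq_abs]
    gcongr
  have b0 : |deriv κ (r z)| * ‖s‖ ≤ M * y := by
    rw [hy]
    calc |deriv κ (r z)| * (ε * y) ≤ M / ε * (ε * y) := by gcongr
      _ = _ := by field_simp
  have b3 : ‖t * (starRingEnd ℂ) (((deriv κ (r z) : ℝ) : ℂ) * s)‖ ≤ M * x * (M * y) := by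
    rw [norm_mul, RCLike.norm_conj, norm_mul, Complex.norm_real, Real.norm_eq_abs]
    gcongr
  have b4 : ‖((deriv κ (r z) : ℝ) : ℂ) * s * (starRingEnd ℂ) t‖ ≤ M * y * (M * x) := by
    rw [norm_mul, RCLike.norm_conj, norm_mul, Complex.norm_real, Real.norm_eq_abs]
    gcongr
  refine (norm_add_le _ _).trans ((add_le_add ((norm_add_le _ _).trans (add_le_add
    ((norm_add_le _ _).trans (add_le_add b1 b2)) b3)) b4).trans ?_)
  have hxy : y * x ≤ (x ^ 2 + y ^ 2) / 2 := by nlinarith [sq_nonneg (x - y)]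
  have hMC : 0 ≤ M ^ 2 * C := by positivity
  have hM2 : 0 ≤ M ^ 2 := sq_nonneg M
  have e : M * (M * (C * (4 * x ^ 2 + y * x)) + M * y ^ 2) + M * (M * x ^ 2) + M * x * (M * y)
      + M * y * (M * x) = M ^ 2 * C * (4 * x ^ 2 + y * x) + M ^ 2 * (y ^ 2 + x ^ 2 + 2 * (y * x)) := by
    ring
  rw [e]
  have f1 : M ^ 2 * C * (4 * x ^ 2 + y * x) ≤ M ^ 2 * C * (5 * (x ^ 2 + y ^ 2)) := by
    gcongr; nlinarith [sq_nonneg x, sq_nonneg y]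
  have f2 : M ^ 2 * (y ^ 2 + x ^ 2 + 2 * (y * x)) ≤ M ^ 2 * (4 * (x ^ 2 + y ^ 2)) := by
    gcongr; nlinarith [sq_nonneg x, sq_nonneg y]
  calc _ ≤ _ := add_le_add f1 f2
    _ = _ := by ring

/-- A bounded weight with complex Hessian comparable to `stripForm`. -/
def stripWeight (r : Cn n → ℝ) (A ε : ℝ) : Cn n → ℝ := fun z => A * ‖z‖ ^ 2 + (r z / ε) ^ 2

theorem stripWeight_contDiffAt {r : Cn n → ℝ} {A ε : ℝ} {z : Cn n} (hr : ContDiffAt ℝ 2 r z) :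
    ContDiffAt ℝ 2 (stripWeight r A ε) z :=
  (contDiffAt_const.mul (contDiff_norm_sq ℝ).contDiffAt).add ((hr.div_const ε).pow 2)

theorem sesq_hess_stripWeight {r : Cn n → ℝ} {A ε : ℝ} {z : Cn n} (hr : ContDiffAt ℝ 2 r z)
    (v : Cn n) : sesq (hess (stripWeight r A ε) z) v v = ((A * ‖v‖ ^ 2 : ℝ) : ℂ)
      + (((2 * r z / ε ^ 2 : ℝ) : ℂ) * sesq (hess r z) v v
        + ((2 / ε ^ 2 * ‖del r z v‖ ^ 2 : ℝ) : ℂ)) := by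
  have hN : ContDiffAt ℝ 2 (fun x : Cn n => ‖x‖ ^ 2) z := (contDiff_norm_sq ℝ).contDiffAt
  have hκ₁ : ContDiff ℝ 2 (fun t : ℝ => A * t) := by fun_prop
  have hκ₂ : ContDiff ℝ 2 (fun t : ℝ => (t / ε) ^ 2) := by fun_prop
  have h1 : hess (stripWeight r A ε) z = hess (fun x => (fun t : ℝ => A * t) (‖x‖ ^ 2)) z
      + hess (fun x => (fun t : ℝ => (t / ε) ^ 2) (r x)) z :=
    hess_add (hκ₁.contDiffAt.comp z hN) (hκ₂.contDiffAt.comp z hr)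
  have d1 : deriv (fun t : ℝ => A * t) = fun _ => A := by ext t; simp
  have d2 : deriv (fun t : ℝ => (t / ε) ^ 2) = fun t => 2 / ε ^ 2 * t := by
    ext t
    have : HasDerivAt (fun t : ℝ => (t / ε) ^ 2) (2 * (t / ε) ^ 1 * (1 / ε)) t := by
      simpa using ((hasDerivAt_id t).div_const ε).fun_pow 2
    rw [this.deriv]
    ring
  have d3 : deriv (fun t : ℝ => 2 / ε ^ 2 * t) = fun _ => 2 / ε ^ 2 := by ext t; simp
  rw [h1, sesq_add, sesq_hess_comp (r := fun x : Cn n => ‖x‖ ^ 2) hκ₁ hN, sesq_hess_comp hκ₂ hr,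
    hess_norm_sq, sesq_one, d1, d2, d3]
  simp only [deriv_const', Complex.ofReal_zero, zero_mul, add_zero]
  push_cast
  ring

/-- The constant in the definition of the weight which makes it plurisubharmonic. -/
def weightConst (C : ℝ) : ℝ := 32 * C + 16 * C ^ 2 + 1

/-- The square (r/ε)² supplies 2ε⁻²|∂r(v)|². Its error 2rε⁻²∂∂̄r is at most C(32x² + 8xy) with x =
|v| and y = |∂r(v)|/ε. Since 8Cxy ≤ y² + 16C²x², one copy of y² and the term A|z|² absorb it; this
dictates `weightConst`. -/
theorem stripWeight_bounds {r : Cn n → ℝ} {C ε : ℝ} {z v : Cn n} (hε : 0 < ε) (hC : 0 ≤ C)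
    (hr : ContDiffAt ℝ 2 r z) (hrz : |r z| ≤ 4 * ε)
    (hL : ‖sesq (hess r z) v v‖ ≤ C * (|r z| * ‖v‖ ^ 2 + ‖del r z v‖ * ‖v‖)) :
    stripForm r ε z v ≤ (sesq (hess (stripWeight r (weightConst C) ε) z) v v).re ∧
    (sesq (hess (stripWeight r (weightConst C) ε) z) v v).re ≤
      (2 * weightConst C + 2) * stripForm r ε z v := by
  rw [sesq_hess_stripWeight hr, Complex.add_re, Complex.add_re, Complex.ofReal_re,
    Complex.re_ofReal_mul, Complex.ofReal_re]
  set h := sesq (hess r z) v v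
  set x := ‖v‖
  have hx0 : 0 ≤ x := norm_nonneg v
  obtain ⟨y, hy0, hy⟩ : ∃ y, 0 ≤ y ∧ ‖del r z v‖ = ε * y :=
    ⟨‖del r z v‖ / ε, by positivity, by field_simp⟩
  have hform : stripForm r ε z v = x ^ 2 + y ^ 2 := by
    rw [stripForm, show ‖del r z v‖ / ε = y by rw [hy]; field_simp]
  have hq : |2 * r z / ε ^ 2 * h.re| ≤ C * (32 * x ^ 2 + 8 * (y * x)) := by
    rw [abs_mul, abs_div, abs_mul, abs_of_pos (show (0 : ℝ) < 2 by norm_num),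
      abs_of_pos (show (0 : ℝ) < ε ^ 2 by positivity)]
    have h1 : |h.re| ≤ C * (4 * ε * x ^ 2 + ε * y * x) :=
      (Complex.abs_re_le_norm h).trans (hL.trans (by rw [hy]; gcongr))
    calc 2 * |r z| / ε ^ 2 * |h.re| ≤ 2 * (4 * ε) / ε ^ 2 * (C * (4 * ε * x ^ 2 + ε * y * x)) := by
          gcongr
      _ = _ := by field_simp; ring
  have e : 2 / ε ^ 2 * ‖del r z v‖ ^ 2 = 2 * y ^ 2 := by rw [hy]; field_simp
  rw [e, hform, weightConst]
  obtain ⟨q1, q2⟩ := abs_le.1 hq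
  constructor
  · nlinarith [sq_nonneg (4 * C * x - y)]
  · have hxx := sq_nonneg x
    have hyy := sq_nonneg y
    have hCy : 0 ≤ C * y ^ 2 := by positivity
    have hCCy : 0 ≤ C ^ 2 * y ^ 2 := by positivity
    have : C * (8 * (y * x)) ≤ y ^ 2 + 16 * C ^ 2 * x ^ 2 := by nlinarith [sq_nonneg (4 * C * x - y)]
    nlinarith

/-! ### Mass estimates in a chart -/

/-- A chart domain `V` with a defining function `r` whose zero set is Levi-flat, a plurisubharmonic
function `f` on `{r < 0}` of size `|r|^η`, and a compact subset `K` of `V` with uniform bounds. -/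
structure StripChart (V K : Set (Cn n)) (r f : Cn n → ℝ) (η : ℝ) : Prop where
  isOpen : IsOpen V
  isCompact : IsCompact K
  subset : K ⊆ V
  contDiff : ContDiffOn ℝ 3 r V
  contDiff_psh : ContDiffOn ℝ 2 f (region V r)
  psh : ∀ z ∈ region V r, (hess f z).PosSemidef
  levi : ∃ C : ℝ, 0 ≤ C ∧ ∀ z ∈ K, z ∈ region V r → ∀ v,
    ‖sesq (hess r z) v v‖ ≤ C * (|r z| * ‖v‖ ^ 2 + ‖del r z v‖ * ‖v‖)
  growth : ∃ C : ℝ, 0 ≤ C ∧ ∀ z ∈ K, z ∈ region V r → |f z| ≤ C * |r z| ^ η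
  measure_strip : ∃ C : NNReal, ∀ ε : ℝ, 0 < ε →
    volume {z ∈ K | z ∈ region V r ∧ -ε < r z} ≤ C * ENNReal.ofReal ε
  exponent_nonneg : 0 ≤ η

/-- The points of `L` whose depth `-r` lies in `[aε, bε]`. -/
def strip (L : Set (Cn n)) (r : Cn n → ℝ) (a b ε : ℝ) : Set (Cn n) :=
  {z ∈ L | r z ∈ Set.Icc (-(b * ε)) (-(a * ε))}

/-- The family which consists of `k` copies of `f` followed by copies of `w`. -/
def mixedFamily (f w : Cn n → ℝ) (k : ℕ) : Fin n → Cn n → ℝ := fun i => if i.val < k then f else w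

/-- Slot k holds the last of the k + 1 copies of f, so exchanging it for w lowers the count by one.
This is the move on which the mass induction runs. -/
theorem mixedFamily_succ_update (f w : Cn n → ℝ) (k : ℕ) (hk : k < n) :
    Function.update (mixedFamily f w (k + 1)) ⟨k, hk⟩ w = mixedFamily f w k := by
  ext1 i
  by_cases hi : i = ⟨k, hk⟩
  · subst hi; simp [mixedFamily]
  · have : i.val ≠ k := fun h => hi (Fin.ext h)
    simp only [Function.update_of_ne hi, mixedFamily]
    by_cases h : i.val < k
    · simp [h, Nat.lt_succ_of_lt h]
    · rw [if_neg h, if_neg (by omega)]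

theorem strip_isCompact {V L : Set (Cn n)} {r : Cn n → ℝ} (hr : ContinuousOn r V)
    (hL : IsCompact L) (hLV : L ⊆ V) (a b ε : ℝ) : IsCompact (strip L r a b ε) := by
  have : IsClosed (strip L r a b ε) :=
    (hr.mono hLV).preimage_isClosed_of_isClosed hL.isClosed isClosed_Icc
  exact hL.of_isClosed_subset this fun z hz => hz.1

theorem strip_subset_region {V L : Set (Cn n)} {r : Cn n → ℝ} {a b ε : ℝ} (hLV : L ⊆ V)
    (ha : 0 < a) (hε : 0 < ε) : strip L r a b ε ⊆ region V r := fun z hz => by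
  refine ⟨hLV hz.1, ?_⟩
  have := hz.2.2
  have : 0 < a * ε := by positivity
  linarith

theorem strip_abs_le {L : Set (Cn n)} {r : Cn n → ℝ} {a b ε : ℝ} (ha : 0 < a) (hb : b < 4)
    (hε : 0 < ε) {z : Cn n} (hz : z ∈ strip L r a b ε) : |r z| ≤ 4 * ε := by
  have h1 := hz.2.1
  have h2 := hz.2.2
  have h3 : 0 < a * ε := by positivity
  rw [abs_le]
  constructor <;> nlinarith

namespace StripChart

variable {V K : Set (Cn n)} {r f : Cn n → ℝ} {η : ℝ}

theorem region_open (h : StripChart V K r f η) : IsOpen (region V r) :=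
  region_isOpen h.isOpen h.contDiff.continuousOn

theorem contDiffAt (h : StripChart V K r f η) {z : Cn n} (hz : z ∈ V) : ContDiffAt ℝ 2 r z :=
  (h.contDiff.contDiffAt (h.isOpen.mem_nhds hz)).of_le (by norm_num)

theorem contDiffOn_weight (h : StripChart V K r f η) (A ε : ℝ) :
    ContDiffOn ℝ 2 (stripWeight r A ε) (region V r) := fun _ hz =>
  (stripWeight_contDiffAt (h.contDiffAt hz.1)).contDiffWithinAt

theorem contDiffOn_family (h : StripChart V K r f η) (A ε : ℝ) (k : ℕ) (i : Fin n) :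
    ContDiffOn ℝ 2 (mixedFamily f (stripWeight r A ε) k i) (region V r) := by
  unfold mixedFamily
  split
  · exact h.contDiff_psh
  · exact h.contDiffOn_weight A ε

/-- The Levi constant of the chart. -/
def leviConst (h : StripChart V K r f η) : ℝ := h.levi.choose

theorem leviConst_nonneg (h : StripChart V K r f η) : 0 ≤ h.leviConst := h.levi.choose_spec.1

theorem levi_bound (h : StripChart V K r f η) {z : Cn n} (hz : z ∈ K) (hzr : z ∈ region V r)
    (v : Cn n) : ‖sesq (hess r z) v v‖ ≤
      h.leviConst * (|r z| * ‖v‖ ^ 2 + ‖del r z v‖ * ‖v‖) := h.levi.choose_spec.2 z hz hzr v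

/-- The weight of the chart at scale `ε`. -/
def weight (h : StripChart V K r f η) (ε : ℝ) : Cn n → ℝ :=
  stripWeight r (weightConst h.leviConst) ε

theorem weight_bounds (h : StripChart V K r f η) {z : Cn n} {ε : ℝ} (hε : 0 < ε) (hz : z ∈ K)
    (hzr : z ∈ region V r) (hrz : |r z| ≤ 4 * ε) (v : Cn n) :
    stripForm r ε z v ≤ (sesq (hess (h.weight ε) z) v v).re ∧
    (sesq (hess (h.weight ε) z) v v).re ≤
      (2 * weightConst h.leviConst + 2) * stripForm r ε z v :=
  stripWeight_bounds hε h.leviConst_nonneg (h.contDiffAt hzr.1) hrz (h.levi_bound hz hzr v)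

theorem weight_isHermitian (h : StripChart V K r f η) {z : Cn n} (ε : ℝ) (hz : z ∈ V) :
    (hess (h.weight ε) z).IsHermitian :=
  hess_isHermitian (stripWeight_contDiffAt (h.contDiffAt hz))

theorem weight_posSemidef (h : StripChart V K r f η) {z : Cn n} {ε : ℝ} (hε : 0 < ε) (hz : z ∈ K)
    (hzr : z ∈ region V r) (hrz : |r z| ≤ 4 * ε) : (hess (h.weight ε) z).PosSemidef :=
  posSemidef_of_sesq (h.weight_isHermitian ε hzr.1) fun v =>
    (stripForm_nonneg r ε z v).trans (h.weight_bounds hε hz hzr hrz v).1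

theorem family_posSemidef (h : StripChart V K r f η) {z : Cn n} {ε : ℝ} (hε : 0 < ε) (hz : z ∈ K)
    (hzr : z ∈ region V r) (hrz : |r z| ≤ 4 * ε) (k : ℕ) (i : Fin n) :
    (hess (mixedFamily f (h.weight ε) k i) z).PosSemidef := by
  unfold mixedFamily
  split
  · exact h.psh z hzr
  · exact h.weight_posSemidef hε hz hzr hrz

/-- Pointwise bound for the Monge--Ampère density of the weight. -/
theorem exists_mixedMA_weight_le (h : StripChart V K r f η) : ∃ C : ℝ, 0 ≤ C ∧
    ∀ ε : ℝ, 0 < ε → ε ≤ 1 → ∀ z ∈ K, z ∈ region V r → |r z| ≤ 4 * ε →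
      mixedMA (mixedFamily f (h.weight ε) 0) z ≤ C / ε ^ 2 := by
  obtain ⟨A, hA0, hA⟩ := exists_bound_on_compact (f := fun z => ‖gradBar r z‖)
    (continuousOn_gradBar h.isOpen (h.contDiff.of_le (by norm_num))).norm h.isCompact h.subset
  set D : ℝ := 2 * weightConst h.leviConst + 2 with hD
  have hD0 : 0 ≤ D := by
    have := h.leviConst_nonneg
    rw [hD, weightConst]; positivity
  refine ⟨n.factorial * (D ^ n * (1 + A ^ 2)), by positivity, fun ε hε hε1 z hz hzr hrz => ?_⟩
  -- The matrix of `stripForm`: the identity plus a rank-one term of size ε⁻². Comparing the Hessian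
  -- of the weight with D β bounds the density by n! Dⁿ det β, and det β has a single factor ε⁻².
  let β : Matrix (Fin n) (Fin n) ℂ := 1 + (((1 / ε) ^ 2 : ℝ) : ℂ) •
    Matrix.vecMulVec (grad r z) (fun k => (starRingEnd ℂ) (grad r z k))
  have hβ : ∀ v, sesq β v v = ((stripForm r ε z v : ℝ) : ℂ) := by
    intro v
    rw [sesq_add, sesq_one, sesq_smul, sesq_vecMulVec]
    have : (∑ j, grad r z j * v j) * (starRingEnd ℂ) (∑ j, grad r z j * v j) =
        ((‖del r z v‖ ^ 2 : ℝ) : ℂ) := by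
      rw [Complex.mul_conj, Complex.normSq_eq_norm_sq]; rfl
    rw [this, stripForm]
    push_cast
    ring
  have hβh : β.IsHermitian := by
    ext j k
    simp [β, Matrix.vecMulVec_apply, Matrix.one_apply, eq_comm, mul_comm]
  have hDβ : ((D : ℂ) • β).IsHermitian := by
    rw [Matrix.IsHermitian, Matrix.conjTranspose_smul, hβh.eq]
    simp
  have hfam : mixedFamily f (h.weight ε) 0 = fun _ => h.weight ε := by
    ext1 i; simp [mixedFamily]
  have hmono := mixedDisc_mono (A := fun _ : Fin n => hess (h.weight ε) z)
    (B := fun _ => (D : ℂ) • β) (fun _ => h.weight_posSemidef hε hz hzr hrz)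
    (fun _ => posSemidef_of_sesq hDβ fun v => by
      rw [sesq_smul, hβ, ← Complex.ofReal_mul, Complex.ofReal_re]
      exact mul_nonneg hD0 (stripForm_nonneg r ε z v))
    (fun _ => posSemidef_of_sesq (hDβ.sub (h.weight_isHermitian ε hzr.1)) fun v => by
      rw [sesq_sub, sesq_smul, hβ, ← Complex.ofReal_mul, Complex.sub_re, Complex.ofReal_re]
      linarith [(h.weight_bounds hε hz hzr hrz v).2])
  rw [hfam]
  refine le_trans hmono ?_
  have hsum : ∑ j, grad r z j * (starRingEnd ℂ) (grad r z j) = ((‖gradBar r z‖ ^ 2 : ℝ) : ℂ) := by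
    rw [← del_gradBar]; rfl
  rw [mixedDisc_const, Matrix.det_smul, det_one_add_vecMulVec, hsum, Fintype.card_fin]
  have : ((n.factorial : ℂ) * ((D : ℂ) ^ n * (1 + (((1 / ε) ^ 2 : ℝ) : ℂ) *
      ((‖gradBar r z‖ ^ 2 : ℝ) : ℂ)))).re =
      n.factorial * (D ^ n * (1 + (1 / ε) ^ 2 * ‖gradBar r z‖ ^ 2)) := by
    rw [← Complex.ofReal_re (n.factorial * (D ^ n * (1 + (1 / ε) ^ 2 * ‖gradBar r z‖ ^ 2)))]
    push_cast
    rfl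
  rw [this, mul_div_assoc, mul_div_assoc]
  gcongr
  have h1 : 1 ≤ (1 / ε) ^ 2 := one_le_pow₀ (by rw [le_div_iff₀ hε]; linarith)
  have h2 : ‖gradBar r z‖ ^ 2 ≤ A ^ 2 := by
    have := hA z hz
    gcongr
  calc 1 + (1 / ε) ^ 2 * ‖gradBar r z‖ ^ 2 ≤ (1 / ε) ^ 2 + (1 / ε) ^ 2 * A ^ 2 := by gcongr
    _ = _ := by ring

theorem integrableOn_mixedMA (h : StripChart V K r f η) {u : Fin n → Cn n → ℝ} {S : Set (Cn n)}
    (hu : ∀ i, ContDiffOn ℝ 2 (u i) (region V r)) (hS : IsCompact S) (hSr : S ⊆ region V r) :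
    IntegrableOn (mixedMA u) S :=
  ((continuousOn_mixedMA h.region_open hu).mono hSr).integrableOn_compact hS

/-- Comparison of the integrand obtained by one integration by parts. -/
theorem setIntegral_abs_le (h : StripChart V K r f η) : ∃ C : ℝ, 0 ≤ C ∧
    ∀ (k : ℕ) (hk : k < n) (ε a b D : ℝ) (L : Set (Cn n)) (ζ : Cn n → ℝ), 0 < ε → 0 < a → b < 4 →
      IsCompact L → L ⊆ K → ContDiffOn ℝ 2 ζ (region V r) → 0 ≤ D →
      (∀ z ∈ strip L r a b ε, ∀ v, ‖sesq (hess ζ z) v v‖ ≤ D * stripForm r ε z v) →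
      ∫ z in strip L r a b ε, |f z * mixedMA (Function.update
        (mixedFamily f (h.weight ε) (k + 1)) ⟨k, hk⟩ ζ) z| ≤
      C * D * ε ^ η * ∫ z in strip L r a b ε, mixedMA (mixedFamily f (h.weight ε) k) z := by
  obtain ⟨C, hC, hgrowth⟩ := h.growth
  -- On the strip |r| ≤ 4ε, so the growth bound gives |f| ≤ C 4^η ε^η; the other factor is
  -- controlled by monotonicity of the mixed discriminant.
  refine ⟨C * 4 ^ η, by positivity, fun k hk ε a b D L ζ hε ha hb hL hLK hζ hD hbd => ?_⟩
  have hLV := hLK.trans h.subset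
  have hS := strip_isCompact h.contDiff.continuousOn hL hLV a b ε
  have hSr : strip L r a b ε ⊆ region V r := strip_subset_region hLV ha hε
  rw [← integral_const_mul]
  refine setIntegral_mono_on ?_ ((h.integrableOn_mixedMA
    (h.contDiffOn_family _ ε k) hS hSr).const_mul _) hS.measurableSet fun z hz => ?_
  · refine ContinuousOn.integrableOn_compact hS (ContinuousOn.abs (ContinuousOn.mono ?_ hSr))
    exact h.contDiff_psh.continuousOn.mul (continuousOn_mixedMA h.region_open
      (contDiffOn_update _ (h.contDiffOn_family _ ε _) hζ))
  · have hzr := hSr hz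
    have hzK := hLK hz.1
    have hrz := strip_abs_le ha hb hε hz
    have h1 : |f z| ≤ C * 4 ^ η * ε ^ η := by
      refine (hgrowth z hzK hzr).trans ?_
      rw [mul_assoc, ← Real.mul_rpow (by norm_num) hε.le]
      gcongr
      exact h.exponent_nonneg
    have h2 : |mixedMA (Function.update (mixedFamily f (h.weight ε) (k + 1)) ⟨k, hk⟩ ζ) z| ≤
        D * mixedMA (mixedFamily f (h.weight ε) k) z := by
      rw [← mixedFamily_succ_update f (h.weight ε) k hk]
      refine abs_mixedMA_update_le _ (fun i _ => h.family_posSemidef hε hzK hzr hrz _ i)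
        (hess_isHermitian (hζ.contDiffAt (h.region_open.mem_nhds hzr)))
        (h.weight_isHermitian ε hzr.1) fun v => (hbd z hz v).trans ?_
      gcongr
      exact (h.weight_bounds hε hzK hzr hrz v).1
    rw [abs_mul]
    calc |f z| * |_| ≤ (C * 4 ^ η * ε ^ η) * (D * mixedMA (mixedFamily f (h.weight ε) k) z) := by
          gcongr
      _ = _ := by ring

end StripChart

/-! ### Cutoff profiles and the mass estimate on strips -/

theorem exists_profile_bound {κ : ℝ → ℝ} (hκ : ContDiff ℝ 2 κ) (h1 : ∀ t, |κ t| ≤ 1)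
    (hs : HasCompactSupport (deriv κ)) : ∃ M : ℝ, 1 ≤ M ∧
      ∀ t, |κ t| ≤ M ∧ |deriv κ t| ≤ M ∧ |deriv (deriv κ) t| ≤ M := by
  have hκ' : ContDiff ℝ 1 (deriv κ) := hκ.deriv'
  obtain ⟨M₁, hM₁⟩ := hs.exists_bound_of_continuous hκ'.continuous
  obtain ⟨M₂, hM₂⟩ := hs.deriv.exists_bound_of_continuous (hκ'.continuous_deriv (by norm_num))
  refine ⟨1 + |M₁| + |M₂|, by linarith [abs_nonneg M₁, abs_nonneg M₂], fun t => ⟨?_, ?_, ?_⟩⟩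
  · linarith [h1 t, abs_nonneg M₁, abs_nonneg M₂]
  · have := hM₁ t
    rw [Real.norm_eq_abs] at this
    linarith [le_abs_self M₁, abs_nonneg M₂]
  · have := hM₂ t
    rw [Real.norm_eq_abs] at this
    linarith [le_abs_self M₂, abs_nonneg M₁]

theorem deriv_comp_neg_div (κ : ℝ → ℝ) (hκ : Differentiable ℝ κ) (ε : ℝ) :
    deriv (fun t => κ (-t / ε)) = fun t => -(1 / ε) * deriv κ (-t / ε) := by
  ext t
  have h1 : HasDerivAt (fun t : ℝ => -t / ε) (-1 / ε) t := (hasDerivAt_neg t).div_const ε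
  have h2 := (hκ (-t / ε)).hasDerivAt.comp t h1
  rw [show (fun t => κ (-t / ε)) = κ ∘ fun t => -t / ε from rfl, h2.deriv]
  ring

/-- Bounds for a profile rescaled to depth `ε`. -/
theorem scaled_profile_bounds {κ : ℝ → ℝ} {M ε : ℝ} (hκ : ContDiff ℝ 2 κ) (hε : 0 < ε)
    (hM : ∀ t, |κ t| ≤ M ∧ |deriv κ t| ≤ M ∧ |deriv (deriv κ) t| ≤ M) (t : ℝ) :
    |κ (-t / ε)| ≤ M ∧ |deriv (fun t => κ (-t / ε)) t| ≤ M / ε ∧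
      |deriv (deriv (fun t => κ (-t / ε))) t| ≤ M / ε ^ 2 := by
  have hκ' : ContDiff ℝ 1 (deriv κ) := hκ.deriv'
  have hd := deriv_comp_neg_div κ (hκ.differentiable (by norm_num)) ε
  have hd2 := deriv_comp_neg_div (deriv κ) (hκ'.differentiable (by norm_num)) ε
  refine ⟨(hM _).1, ?_, ?_⟩
  · rw [hd, abs_mul, abs_neg, abs_of_pos (by positivity : (0 : ℝ) < 1 / ε)]
    calc 1 / ε * |deriv κ (-t / ε)| ≤ 1 / ε * M := by gcongr; exact (hM _).2.1
      _ = _ := by ring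
  · have h3 : deriv (fun t => -(1 / ε) * deriv κ (-t / ε)) t =
        -(1 / ε) * (-(1 / ε) * deriv (deriv κ) (-t / ε)) := by
      rw [deriv_const_mul_field, hd2]
    rw [hd, h3, ← mul_assoc, abs_mul, abs_of_nonneg (by nlinarith [sq_nonneg (1 / ε)])]
    calc -(1 / ε) * -(1 / ε) * |deriv (deriv κ) (-t / ε)| = (1 / ε) ^ 2 * |deriv (deriv κ) (-t / ε)| := by
          ring
      _ ≤ (1 / ε) ^ 2 * M := by gcongr; exact (hM _).2.2
      _ = _ := by field_simp

/-- A smooth bump on the line, equal to `1` on `[a, b]` and supported in `[a', b']`. -/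
theorem exists_interval_bump {a' a b b' : ℝ} (ha : a' < a) (hb : b < b') :
    ∃ κ : ℝ → ℝ, ContDiff ℝ 2 κ ∧ (∀ t, 0 ≤ κ t) ∧ (∀ t, |κ t| ≤ 1) ∧
      (∀ t ∈ Set.Icc a b, κ t = 1) ∧ (∀ t, t ∉ Set.Icc a' b' → κ t = 0) := by
  refine ⟨fun t => Real.smoothTransition ((t - a') / (a - a')) *
    Real.smoothTransition ((b' - t) / (b' - b)), ?_, fun t => ?_, fun t => ?_, fun t ht => ?_,
    fun t ht => ?_⟩
  · exact (Real.smoothTransition.contDiff.comp (by fun_prop)).mul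
      (Real.smoothTransition.contDiff.comp (by fun_prop))
  · exact mul_nonneg (Real.smoothTransition.nonneg _) (Real.smoothTransition.nonneg _)
  · rw [abs_of_nonneg (mul_nonneg (Real.smoothTransition.nonneg _)
      (Real.smoothTransition.nonneg _))]
    exact mul_le_one₀ (Real.smoothTransition.le_one _) (Real.smoothTransition.nonneg _)
      (Real.smoothTransition.le_one _)
  · dsimp only
    rw [Real.smoothTransition.one_of_one_le, Real.smoothTransition.one_of_one_le, one_mul]
    · rw [le_div_iff₀ (by linarith)]; linarith [ht.2]
    · rw [le_div_iff₀ (by linarith)]; linarith [ht.1]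
  · dsimp only
    rw [Set.mem_Icc, not_and_or, not_le, not_le] at ht
    rcases ht with ht | ht
    · rw [Real.smoothTransition.zero_of_nonpos, zero_mul]
      exact div_nonpos_of_nonpos_of_nonneg (by linarith) (by linarith)
    · rw [mul_comm, Real.smoothTransition.zero_of_nonpos, zero_mul]
      exact div_nonpos_of_nonpos_of_nonneg (by linarith) (by linarith)

namespace StripChart

variable {V K : Set (Cn n)} {r f : Cn n → ℝ} {η : ℝ}

/-- Bound for the complex Hessian of a cutoff function adapted to the strip. -/
theorem exists_cutoff_bound (h : StripChart V K r f η) {θ : Cn n → ℝ} {κ : ℝ → ℝ}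
    (hθ : ContDiff ℝ 2 θ) (hκ : ContDiff ℝ 2 κ) (h1 : ∀ t, |κ t| ≤ 1)
    (hs : HasCompactSupport (deriv κ)) : ∃ D : ℝ, 0 ≤ D ∧ ∀ ε : ℝ, 0 < ε →
      ∀ z ∈ K, z ∈ region V r → |r z| ≤ 4 * ε → ∀ v,
        ‖sesq (hess (fun x => θ x * κ (-r x / ε)) z) v v‖ ≤ D * stripForm r ε z v := by
  obtain ⟨M₀, hM₀1, hM₀⟩ := exists_profile_bound hκ h1 hs
  have hθV : ContDiffOn ℝ 2 θ V := hθ.contDiffOn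
  obtain ⟨M₁, hM₁0, hM₁⟩ := exists_bound_on_compact (f := fun z => |θ z|)
    hθV.continuousOn.abs h.isCompact h.subset
  obtain ⟨M₂, hM₂0, hM₂⟩ := exists_bound_on_compact (f := fun z => ‖gradBar θ z‖)
    (continuousOn_gradBar h.isOpen (hθV.of_le (by norm_num))).norm h.isCompact h.subset
  obtain ⟨M₃, hM₃0, hM₃⟩ := exists_bound_on_compact (f := fun z => ∑ j, ∑ k, ‖hess θ z j k‖)
    (continuousOn_finsetSum _ fun j _ => continuousOn_finsetSum _ fun k _ =>
      (continuousOn_hess h.isOpen hθV j k).norm) h.isCompact h.subset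
  set M := M₀ + M₁ + M₂ + M₃ with hM
  have hM0 : 0 ≤ M := by positivity
  have hprof : ∀ t, |κ t| ≤ M ∧ |deriv κ t| ≤ M ∧ |deriv (deriv κ) t| ≤ M := fun t =>
    ⟨(hM₀ t).1.trans (by linarith), (hM₀ t).2.1.trans (by linarith),
      (hM₀ t).2.2.trans (by linarith)⟩
  have hC := h.leviConst_nonneg
  refine ⟨M ^ 2 * (5 * h.leviConst + 4), by positivity, fun ε hε z hz hzr hrz v => ?_⟩
  obtain ⟨k0, k1, k2⟩ := scaled_profile_bounds hκ hε hprof (r z)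
  refine norm_sesq_hess_cutoff_le (κ := fun t => κ (-t / ε)) hε hM0 hC hθ.contDiffAt
    (h.contDiffAt hzr.1) (hκ.comp (by fun_prop)) ?_ ?_ ?_ k0 k1 k2 hrz (h.levi_bound hz hzr v)
  · exact (hM₁ z hz).trans (by linarith)
  · refine (norm_del_le θ z v).trans ?_
    gcongr
    exact (hM₂ z hz).trans (by linarith)
  · refine (norm_sesq_le _ v v).trans ?_
    rw [← sq]
    gcongr
    exact (hM₃ z hz).trans (by linarith)

theorem contDiffOn_cutoff (h : StripChart V K r f η) {θ : Cn n → ℝ} {κ : ℝ → ℝ}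
    (hθ : ContDiff ℝ 2 θ) (hκ : ContDiff ℝ 2 κ) (ε : ℝ) :
    ContDiffOn ℝ 2 (fun x => θ x * κ (-r x / ε)) (region V r) := by
  have hr : ContDiffOn ℝ 2 r (region V r) := (h.contDiff.of_le (by norm_num)).mono fun z hz => hz.1
  exact hθ.contDiffOn.mul (hκ.comp_contDiffOn (hr.neg.div_const ε))

/-- Mass estimate of Chern--Levine--Nirenberg type for the mixed Monge--Ampère measures on the
strip at depth `ε`. -/
theorem mass_le (h : StripChart V K r f η) (k : ℕ) (hk : k ≤ n) : ∀ L : Set (Cn n), IsCompact L →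
    L ⊆ interior K → ∀ a b : ℝ, 0 < a → b < 4 → ∃ C : ℝ, 0 ≤ C ∧ ∀ ε : ℝ, 0 < ε → ε ≤ 1 →
      ∫ z in strip L r a b ε, mixedMA (mixedFamily f (h.weight ε) k) z ≤ C * ε ^ (k * η - 1) := by
  induction k with
  | zero =>
    intro L hL hLK a b ha hb
    have hLK' := hLK.trans interior_subset
    have hLV := hLK'.trans h.subset
    obtain ⟨C₁, hC₁, hMA⟩ := h.exists_mixedMA_weight_le
    obtain ⟨C₂, hvol⟩ := h.measure_strip
    refine ⟨C₁ * (C₂ * 5), by positivity, fun ε hε hε1 => ?_⟩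
    have hS := strip_isCompact h.contDiff.continuousOn hL hLV a b ε
    have hSr : strip L r a b ε ⊆ region V r := strip_subset_region hLV ha hε
    -- Volume O(ε) against density O(ε⁻²) gives the starting exponent -1. Depth on the strip is at
    -- most bε < 4ε, so the open bound with 5ε contains it.
    have hm : (volume (strip L r a b ε)).toReal ≤ C₂ * (5 * ε) := by
      have h1 : volume (strip L r a b ε) ≤ C₂ * ENNReal.ofReal (5 * ε) := by
        refine le_trans (measure_mono ?_) (hvol (5 * ε) (by positivity))
        intro z hz
        refine ⟨hLK' hz.1, hSr hz, ?_⟩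
        have := hz.2.1
        nlinarith
      have h2 := ENNReal.toReal_mono (ENNReal.mul_ne_top ENNReal.coe_ne_top
        ENNReal.ofReal_ne_top) h1
      rwa [ENNReal.toReal_mul, ENNReal.coe_toReal, ENNReal.toReal_ofReal (by positivity)] at h2
    calc ∫ z in strip L r a b ε, mixedMA (mixedFamily f (h.weight ε) 0) z
        ≤ ∫ _z in strip L r a b ε, C₁ / ε ^ 2 := by
          refine setIntegral_mono_on (h.integrableOn_mixedMA (h.contDiffOn_family _ ε 0) hS hSr)
            (integrableOn_const hS.measure_lt_top.ne) hS.measurableSet fun z hz => ?_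
          exact hMA ε hε hε1 z (hLK' hz.1) (hSr hz) (strip_abs_le ha hb hε hz)
      _ = (volume (strip L r a b ε)).toReal * (C₁ / ε ^ 2) := by
          rw [setIntegral_const, smul_eq_mul]; rfl
      _ ≤ C₂ * (5 * ε) * (C₁ / ε ^ 2) := by gcongr
      _ = C₁ * (C₂ * 5) * ε ^ (((0 : ℕ) : ℝ) * η - 1) := by
          rw [Nat.cast_zero, zero_mul, zero_sub, Real.rpow_neg_one]
          field_simp
  | succ k ih =>
    intro L hL hLK a b ha hb
    have hk' : k < n := hk
    -- The estimate passes to a larger compact set, the support of θ, and to the wider range of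
    -- depths from a/2 to (b + 4)/2. Both remain admissible, inside the interior of K and below 4,
    -- which is why the induction quantifies over L, a and b.
    obtain ⟨θ, hθ, hθc, hθs, hθ1, hθ01⟩ := exists_cutoff hL isOpen_interior hLK
    have hθ2 : ContDiff ℝ 2 θ := contDiff_infty.1 hθ 2
    obtain ⟨κ, hκ, hκ0, hκ1, hκI, hκs⟩ := exists_interval_bump (a' := a / 2) (a := a) (b := b)
      (b' := (b + 4) / 2) (by linarith) (by linarith)
    have ha' : 0 < a / 2 := by linarith
    have hb' : (b + 4) / 2 < 4 := by linarith
    obtain ⟨C, hC, ihC⟩ := ih hk'.le (tsupport θ) hθc hθs (a / 2) ((b + 4) / 2) ha' hb'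
    obtain ⟨D, hD, hDb⟩ := h.exists_cutoff_bound hθ2 hκ hκ1
      ((HasCompactSupport.intro isCompact_Icc hκs).deriv)
    obtain ⟨E, hE, hEb⟩ := h.setIntegral_abs_le
    refine ⟨E * D * C, by positivity, fun ε hε hε1 => ?_⟩
    have hLK' := hLK.trans interior_subset
    have hLV := hLK'.trans h.subset
    have hθK := hθs.trans interior_subset
    have hθV := hθK.trans h.subset
    set S := strip L r a b ε
    set S' := strip (tsupport θ) r (a / 2) ((b + 4) / 2) ε
    have hS' : IsCompact S' := strip_isCompact h.contDiff.continuousOn hθc hθV _ _ ε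
    have hS'r : S' ⊆ region V r := strip_subset_region hθV ha' hε
    have hS : IsCompact S := strip_isCompact h.contDiff.continuousOn hL hLV _ _ ε
    have hSS' : S ⊆ S' := by
      intro z hz
      refine ⟨subset_tsupport _ ?_, ?_, ?_⟩
      · rw [Function.mem_support, (hθ1 z hz.1).self_of_nhds]; exact one_ne_zero
      · have := hz.2.1; nlinarith
      · have := hz.2.2; nlinarith
    set ζ : Cn n → ℝ := fun x => θ x * κ (-r x / ε) with hζ
    have hζ2 := h.contDiffOn_cutoff hθ2 hκ ε
    have hζ0 : ∀ z ∈ region V r, z ∉ S' → ζ z = 0 := by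
      intro z hz hzS
      by_cases hzθ : z ∈ tsupport θ
      · have : -r z / ε ∉ Set.Icc (a / 2) ((b + 4) / 2) := by
          intro hmem
          refine hzS ⟨hzθ, ?_, ?_⟩
          · have := hmem.2
            rw [div_le_iff₀ hε] at this
            linarith
          · have := hmem.1
            rw [le_div_iff₀ hε] at this
            linarith
        simp only [hζ, hκs _ this, mul_zero]
      · simp only [hζ, image_eq_zero_of_notMem_tsupport hzθ, zero_mul]
    have hζ1 : ∀ z ∈ S, ζ z = 1 := by
      intro z hz
      have : -r z / ε ∈ Set.Icc a b := by
        constructor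
        · rw [le_div_iff₀ hε]; linarith [hz.2.2]
        · rw [div_le_iff₀ hε]; linarith [hz.2.1]
      simp only [hζ, hκI _ this, (hθ1 z hz.1).self_of_nhds, mul_one]
    set u := mixedFamily f (h.weight ε) (k + 1) with hu
    have hu2 : ∀ i, ContDiffOn ℝ 2 (u i) (region V r) := h.contDiffOn_family _ ε (k + 1)
    -- Slot k contains f. The integration by parts puts the Hessian of the cutoff there and leaves f
    -- undifferentiated: f gives ε^η, and the cutoff's Hessian is dominated by that of the weight.
    have hibp := setIntegral_mul_mixedMA h.region_open hS' hS'r ⟨k, hk'⟩ hζ2 hζ0 hu2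
    have huk : u ⟨k, hk'⟩ = f := by simp [hu, mixedFamily]
    rw [huk] at hibp
    have hl : ∫ z in region V r, ζ z * mixedMA u z = ∫ z in S', ζ z * mixedMA u z :=
      (setIntegral_eq_of_subset_of_forall_sdiff_eq_zero h.region_open.measurableSet hS'r
        (fun z hz => mul_eq_zero_of_left (hζ0 z hz.1 hz.2) _))
    have hr : ∫ z in region V r, f z * mixedMA (Function.update u ⟨k, hk'⟩ ζ) z =
        ∫ z in S', f z * mixedMA (Function.update u ⟨k, hk'⟩ ζ) z := by
      refine (setIntegral_eq_of_subset_of_forall_sdiff_eq_zero h.region_open.measurableSet hS'r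
        fun z hz => ?_)
      have hz0 : hess ζ z = 0 := by
        rw [← hess_const 0 z]
        refine hess_congr ?_
        filter_upwards [h.region_open.mem_nhds hz.1, hS'.isClosed.isOpen_compl.mem_nhds hz.2]
          with x hx hx' using hζ0 x hx hx'
      rw [mixedMA, ← update_hess, hz0, mixedDisc_update_zero]
      simp
    have hnn : ∀ z ∈ S', 0 ≤ mixedMA u z := fun z hz => mixedMA_nonneg fun i =>
      h.family_posSemidef hε (hθK hz.1) (hS'r hz) (strip_abs_le ha' hb' hε hz) _ i
    have hint : IntegrableOn (fun z => ζ z * mixedMA u z) S' :=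
      ((hζ2.continuousOn.mul (continuousOn_mixedMA h.region_open hu2)).mono
        hS'r).integrableOn_compact hS'
    calc ∫ z in S, mixedMA u z = ∫ z in S, ζ z * mixedMA u z :=
          setIntegral_congr_fun hS.measurableSet fun z hz => by
            simp only [hζ1 z hz, one_mul]
      _ ≤ ∫ z in S', ζ z * mixedMA u z := by
          refine setIntegral_mono_set hint ?_ hSS'.eventuallyLE
          refine (ae_restrict_iff' hS'.measurableSet).2 (Eventually.of_forall fun z hz => ?_)
          exact mul_nonneg (mul_nonneg (hθ01 z).1 (hκ0 _)) (hnn z hz)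
      _ = ∫ z in S', f z * mixedMA (Function.update u ⟨k, hk'⟩ ζ) z := by rw [← hl, hibp, hr]
      _ ≤ ∫ z in S', |f z * mixedMA (Function.update u ⟨k, hk'⟩ ζ) z| :=
          (le_abs_self _).trans abs_integral_le_integral_abs
      _ ≤ E * D * ε ^ η * ∫ z in S', mixedMA (mixedFamily f (h.weight ε) k) z :=
          hEb k hk' ε _ _ D _ ζ hε ha' hb' hθc hθK hζ2 hD fun z hz v =>
            hDb ε hε z (hθK hz.1) (hS'r hz) (strip_abs_le ha' hb' hε hz) v
      _ ≤ E * D * ε ^ η * (C * ε ^ (k * η - 1)) := by gcongr; exact ihC ε hε hε1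
      _ = E * D * C * (ε ^ η * ε ^ (k * η - 1)) := by ring
      _ = E * D * C * ε ^ (((k + 1 : ℕ) : ℝ) * η - 1) := by
          rw [← Real.rpow_add hε]
          congr 2
          push_cast
          ring

/-- The contribution of one chart to the boundary term of the global integration by parts. -/
theorem boundary_term_le (h : StripChart V K r f η) (hn : n - 1 < n) {θ : Cn n → ℝ}
    {L : Set (Cn n)} (hL : IsCompact L) (hLK : L ⊆ interior K)
    (hθ : ContinuousOn θ (region V r)) (hθ1 : ∀ z, |θ z| ≤ 1)
    (hθ0 : ∀ z ∈ region V r, z ∉ L → θ z = 0) {κ : ℝ → ℝ} (hκ : ContDiff ℝ 2 κ)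
    (hκ1 : ∀ t, |κ t| ≤ 1) (hκl : ∀ t, t ≤ 1 → κ t = 0) (hκr : ∀ t, 2 ≤ t → κ t = 1) :
    ∃ C : ℝ, 0 ≤ C ∧ ∀ ε : ℝ, 0 < ε → ε ≤ 1 →
      |∫ z in region V r, θ z * (f z * mixedMA (Function.update (fun _ => f) ⟨n - 1, hn⟩
        (fun x => κ (-r x / ε))) z)| ≤ C * ε ^ (n * η - 1) := by
  have hκc : HasCompactSupport (deriv κ) := by
    refine HasCompactSupport.intro (isCompact_Icc (a := (1 : ℝ)) (b := 2)) fun t ht => ?_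
    rw [Set.mem_Icc, not_and_or, not_le, not_le] at ht
    rcases ht with ht | ht
    · have : κ =ᶠ[𝓝 t] fun _ => 0 := by
        filter_upwards [gt_mem_nhds ht] with x hx using hκl x hx.le
      rw [this.deriv_eq, deriv_const]
    · have : κ =ᶠ[𝓝 t] fun _ => 1 := by
        filter_upwards [lt_mem_nhds ht] with x hx using hκr x hx.le
      rw [this.deriv_eq, deriv_const]
  -- Only the profile of r is differentiated here. The function θ of the statement multiplies the
  -- integrand from outside, so continuity and |θ| ≤ 1 are enough for it.
  obtain ⟨D, hD, hDb⟩ := h.exists_cutoff_bound (θ := fun _ => 1) contDiff_const hκ hκ1 hκc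
  simp only [one_mul] at hDb
  obtain ⟨E, hE, hEb⟩ := h.setIntegral_abs_le
  obtain ⟨C, hC, hCb⟩ := h.mass_le (n - 1) hn.le L hL hLK 1 2 one_pos (by norm_num)
  refine ⟨E * D * C, by positivity, fun ε hε hε1 => ?_⟩
  have hLK' := hLK.trans interior_subset
  have hLV := hLK'.trans h.subset
  set S := strip L r 1 2 ε
  have hS : IsCompact S := strip_isCompact h.contDiff.continuousOn hL hLV _ _ ε
  have hSr : S ⊆ region V r := strip_subset_region hLV one_pos hε
  set ζ : Cn n → ℝ := fun x => κ (-r x / ε) with hζ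
  have hζ2 : ContDiffOn ℝ 2 ζ (region V r) := by
    have := h.contDiffOn_cutoff (θ := fun _ => 1) contDiff_const hκ ε
    simpa only [one_mul] using this
  have hfam : mixedFamily f (h.weight ε) (n - 1 + 1) = fun _ => f := by
    ext1 i
    rw [mixedFamily, if_pos]
    omega
  set g : Cn n → ℝ := fun z => f z * mixedMA (Function.update (fun _ => f) ⟨n - 1, hn⟩ ζ) z
    with hg
  have hgc : ContinuousOn g (region V r) :=
    h.contDiff_psh.continuousOn.mul (continuousOn_mixedMA h.region_open
      (contDiffOn_update _ (fun _ => h.contDiff_psh) hζ2))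
  -- The profile is locally constant at depths below ε and above 2ε, so its Hessian lives on the
  -- strip between them.
  have hred : ∫ z in region V r, θ z * g z = ∫ z in S, θ z * g z := by
    refine (setIntegral_eq_of_subset_of_forall_sdiff_eq_zero h.region_open.measurableSet hSr
      fun z hz => ?_)
    by_cases hzL : z ∈ L
    · have hcont : ContinuousAt (fun x => -r x / ε) z :=
        ((h.contDiffAt hz.1.1).continuousAt.neg).div_const ε
      have hz0 : hess ζ z = 0 := by
        by_cases hlt : -r z / ε < 1
        · rw [← hess_const 0 z]
          refine hess_congr ?_
          filter_upwards [hcont.eventually (gt_mem_nhds hlt)] with x hx using hκl _ hx.le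
        · by_cases hgt : 2 < -r z / ε
          · rw [← hess_const 1 z]
            refine hess_congr ?_
            filter_upwards [hcont.eventually (lt_mem_nhds hgt)] with x hx using hκr _ hx.le
          · push Not at hlt hgt
            rw [le_div_iff₀ hε] at hlt
            rw [div_le_iff₀ hε] at hgt
            exact absurd ⟨hzL, by linarith, by linarith⟩ hz.2
      rw [hg]
      simp only [mixedMA]
      rw [← update_hess, hz0, mixedDisc_update_zero]
      simp
    · exact mul_eq_zero_of_left (hθ0 z hz.1 hzL) _
  have hn1 : ((n - 1 : ℕ) : ℝ) = n - 1 := by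
    rw [Nat.cast_sub (by omega)]; simp
  rw [hred]
  calc |∫ z in S, θ z * g z| ≤ ∫ z in S, |θ z * g z| := abs_integral_le_integral_abs
    _ ≤ ∫ z in S, |g z| := by
        refine setIntegral_mono_on ?_ ?_ hS.measurableSet fun z hz => ?_
        · exact ((hθ.mul hgc).mono hSr).abs.integrableOn_compact hS
        · exact (hgc.mono hSr).abs.integrableOn_compact hS
        · rw [abs_mul]
          exact mul_le_of_le_one_left (abs_nonneg _) (hθ1 z)
    _ ≤ E * D * ε ^ η * ∫ z in S, mixedMA (mixedFamily f (h.weight ε) (n - 1)) z := by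
        have := hEb (n - 1) hn ε 1 2 D L ζ hε one_pos (by norm_num) hL hLK' hζ2 hD fun z hz v =>
          hDb ε hε z (hLK' hz.1) (hSr hz) (strip_abs_le one_pos (by norm_num) hε hz) v
        rw [hfam] at this
        exact this
    _ ≤ E * D * ε ^ η * (C * ε ^ (((n - 1 : ℕ) : ℝ) * η - 1)) := by gcongr; exact hCb ε hε hε1
    _ = E * D * C * (ε ^ η * ε ^ (((n - 1 : ℕ) : ℝ) * η - 1)) := by ring
    _ = E * D * C * ε ^ (n * η - 1) := by
        rw [← Real.rpow_add hε, hn1]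
        congr 2
        ring

end StripChart

/-! ### Regularity and differentials read in holomorphic charts -/

section ChartCalculus

variable {X : Type*} [TopologicalSpace X] [ChartedSpace (Cn n) X]
  [IsManifold 𝓘(ℂ, Cn n) ω X]

theorem contDiffOn_transition {e e' : OpenPartialHomeomorph X (Cn n)}
    (he : e ∈ atlas (Cn n) X) (he' : e' ∈ atlas (Cn n) X) :
    ContDiffOn ℂ ω (e' ∘ e.symm) (e.target ∩ e.symm ⁻¹' e'.source) := by
  have h := (contDiffGroupoid ω 𝓘(ℂ, Cn n)).compatible he he'
  rw [contDiffGroupoid, mem_groupoid_of_pregroupoid] at h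
  simpa [contDiffPregroupoid] using h.1

variable (n X) in
theorem isManifold_real : IsManifold 𝓘(ℝ, Cn n) ∞ X := by
  refine isManifold_of_contDiffOn _ _ _ fun e e' he he' => ?_
  have h := ((contDiffOn_transition he he').restrict_scalars ℝ).of_le (m := ∞) le_top
  simpa using h

theorem CkOn.contDiffOn_chart {k : ℕ∞} {u : X → ℝ} {s : Set X} (hu : CkOn n k u s)
    {e : OpenPartialHomeomorph X (Cn n)} (he : e ∈ atlas (Cn n) X) :
    ContDiffOn ℝ k (u ∘ e.symm) (e.target ∩ e.symm ⁻¹' s) := by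
  have := isManifold_real n X
  have h := contMDiffOn_symm_of_mem_maximalAtlas
    (IsManifold.subset_maximalAtlas (I := 𝓘(ℝ, Cn n)) (n := ∞) he)
  rw [← contMDiffOn_iff_contDiffOn]
  exact ContMDiffOn.comp hu ((h.of_le (by exact_mod_cast le_top)).mono Set.inter_subset_left)
    (fun z hz => hz.2)

theorem diffNeZero_iff_chart {u : X → ℝ} {p : X}
    (hu : MDifferentiableAt 𝓘(ℝ, Cn n) 𝓘(ℝ, ℝ) u p)
    {e : OpenPartialHomeomorph X (Cn n)} (he : e ∈ atlas (Cn n) X) (hp : p ∈ e.source) :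
    DiffNeZero n u p ↔ fderiv ℝ (u ∘ e.symm) (e p) ≠ 0 := by
  have := isManifold_real n X
  have hm := IsManifold.subset_maximalAtlas (I := 𝓘(ℝ, Cn n)) (n := ∞) he
  have h1 : MDifferentiableAt 𝓘(ℝ, Cn n) 𝓘(ℝ, Cn n) e p :=
    (contMDiffAt_of_mem_maximalAtlas hm hp).mdifferentiableAt (by simp)
  have h2 : MDifferentiableAt 𝓘(ℝ, Cn n) 𝓘(ℝ, Cn n) e.symm (e p) :=
    (contMDiffAt_symm_of_mem_maximalAtlas hm (e.map_source hp)).mdifferentiableAt (by simp)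
  have hpp : e.symm (e p) = p := e.left_inv hp
  have hu' : MDifferentiableAt 𝓘(ℝ, Cn n) 𝓘(ℝ, ℝ) u (e.symm (e p)) := by rwa [hpp]
  have h3 : MDifferentiableAt 𝓘(ℝ, Cn n) 𝓘(ℝ, ℝ) (u ∘ e.symm) (e p) := hu'.comp (e p) h2
  rw [DiffNeZero, not_iff_not, ← mfderiv_eq_fderiv]
  constructor
  · intro h
    rw [mfderiv_comp (e p) hu' h2]
    have : mfderiv 𝓘(ℝ, Cn n) 𝓘(ℝ, ℝ) u (e.symm (e p)) = 0 := by rw [hpp]; exact h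
    rw [this]
    exact ContinuousLinearMap.zero_comp _
  · intro h
    have h4 : u =ᶠ[𝓝 p] (u ∘ e.symm) ∘ e := by
      filter_upwards [e.open_source.mem_nhds hp] with x hx
      simp [e.left_inv hx]
    rw [h4.mfderiv_eq, mfderiv_comp p h3 h1, h]
    exact ContinuousLinearMap.zero_comp _

end ChartCalculus

/-! ### Gluing a global defining function -/

theorem eq_zero_of_mem_closure {Y : Type*} [TopologicalSpace Y] {Ω : Set Y} {g : Y → ℝ} {p : Y}
    (hc : ContinuousAt g p) (hp : p ∈ closure Ω) (h : ∀ᶠ x in 𝓝 p, x ∈ Ω → g x < 0)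
    (h0 : 0 ≤ g p) : g p = 0 := by
  have : (𝓝[Ω] p).NeBot := mem_closure_iff_nhdsWithin_neBot.1 hp
  refine le_antisymm (le_of_tendsto (hc.tendsto.mono_left (nhdsWithin_le_nhds (s := Ω))) ?_) h0
  exact eventually_nhdsWithin_iff.2 (h.mono fun x hx hxΩ => (hx hxΩ).le)

theorem eventually_neg_of_hasDerivAt {φ : ℝ → ℝ} {c : ℝ} (h : HasDerivAt φ c 0) (h0 : φ 0 = 0)
    (hc : c < 0) : ∀ᶠ t in 𝓝[>] (0 : ℝ), φ t < 0 := by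
  filter_upwards [h.tendsto_slope_zero_right.eventually (gt_mem_nhds hc), self_mem_nhdsWithin]
    with t ht ht0
  simp only [zero_add, h0, sub_zero, smul_eq_mul] at ht
  have ht0 : 0 < t := ht0
  exact (pos_iff_neg_of_mul_neg ht).1 (inv_pos.2 ht0)

theorem hasDerivAt_line {E : Type*} [NormedAddCommGroup E] [NormedSpace ℝ E] {R : E → ℝ} {z₀ : E}
    (hR : DifferentiableAt ℝ R z₀) (v : E) :
    HasDerivAt (fun t : ℝ => R (z₀ + t • v)) (fderiv ℝ R z₀ v) 0 := by
  have h1 : HasDerivAt (fun t : ℝ => z₀ + t • v) v 0 := by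
    simpa using ((hasDerivAt_id (0 : ℝ)).smul_const v).const_add z₀
  have h2 : HasFDerivAt R (fderiv ℝ R z₀) (z₀ + (0 : ℝ) • v) := by simpa using hR.hasFDerivAt
  exact h2.comp_hasDerivAt (0 : ℝ) h1

/-- Along a direction in which G decreases, F·G decreases at a linear rate, and R lies below it. If
the differential of R were zero, R would exceed F·G for small positive times. -/
theorem fderiv_ne_zero_of_le_mul {E : Type*} [NormedAddCommGroup E] [NormedSpace ℝ E]
    {R F G : E → ℝ} {z₀ : E} (hR : DifferentiableAt ℝ R z₀) (hF : DifferentiableAt ℝ F z₀)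
    (hG : DifferentiableAt ℝ G z₀) (hR0 : R z₀ = 0) (hG0 : G z₀ = 0) (hF0 : 0 < F z₀)
    (hd : fderiv ℝ G z₀ ≠ 0) (h : ∀ᶠ z in 𝓝 z₀, G z < 0 → R z ≤ F z * G z) :
    fderiv ℝ R z₀ ≠ 0 := by
  intro hR'
  obtain ⟨v, hv⟩ : ∃ v, fderiv ℝ G z₀ v < 0 := by
    obtain ⟨v, hv⟩ : ∃ v, fderiv ℝ G z₀ v ≠ 0 := by
      by_contra hcon
      push Not at hcon
      exact hd (ContinuousLinearMap.ext hcon)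
    rcases lt_or_gt_of_ne hv with hv | hv
    · exact ⟨v, hv⟩
    · exact ⟨-v, by simpa using hv⟩
  have h1 := hasDerivAt_line hG v
  have h2 := (hasDerivAt_line hF v).fun_mul h1
  have h3 := h2.fun_sub (hasDerivAt_line hR v)
  have hneg : fderiv ℝ F z₀ v * G (z₀ + (0 : ℝ) • v) + F (z₀ + (0 : ℝ) • v) * fderiv ℝ G z₀ v
      - fderiv ℝ R z₀ v < 0 := by
    simp only [zero_smul, add_zero, hG0, hR', mul_zero, zero_add, zero_apply,
      sub_zero]
    exact mul_neg_of_pos_of_neg hF0 hv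
  have e1 := eventually_neg_of_hasDerivAt h1 (by simp [hG0]) hv
  have e2 := eventually_neg_of_hasDerivAt h3 (by simp [hG0, hR0]) hneg
  have hline : Tendsto (fun t : ℝ => z₀ + t • v) (𝓝[>] 0) (𝓝 z₀) := by
    have : Continuous fun t : ℝ => z₀ + t • v := by fun_prop
    simpa using (this.tendsto 0).mono_left nhdsWithin_le_nhds
  obtain ⟨t, h1, h2, h3⟩ := (e1.and (e2.and (hline.eventually h))).exists
  linarith [h3 h1]

section DefiningFunction

variable {X : Type*} [TopologicalSpace X] [ChartedSpace (Cn n) X]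

theorem CkOn.mdifferentiableAt {k : ℕ∞} (hk : 1 ≤ k) {u : X → ℝ} {s : Set X} (hu : CkOn n k u s)
    (hs : IsOpen s) {p : X} (hp : p ∈ s) : MDifferentiableAt 𝓘(ℝ, Cn n) 𝓘(ℝ, ℝ) u p := by
  have hk0 : k ≠ 0 := by
    rintro rfl
    simp at hk
  exact (ContMDiffOn.contMDiffAt hu (hs.mem_nhds hp)).mdifferentiableAt
    (by exact_mod_cast hk0)

theorem CkOn.continuousAt {k : ℕ∞} {u : X → ℝ} {s : Set X} (hu : CkOn n k u s)
    (hs : IsOpen s) {p : X} (hp : p ∈ s) : ContinuousAt u p :=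
  (ContMDiffOn.contMDiffAt hu (hs.mem_nhds hp)).continuousAt

variable [IsManifold 𝓘(ℂ, Cn n) ω X]

theorem CkOn.contDiffAt_chart {k : ℕ∞} {u : X → ℝ} {s : Set X}
    (hu : CkOn n k u s) (hs : IsOpen s) {p : X} (hp : p ∈ s)
    {e : OpenPartialHomeomorph X (Cn n)} (he : e ∈ atlas (Cn n) X) (hpe : p ∈ e.source) :
    ContDiffAt ℝ k (u ∘ e.symm) (e p) := by
  refine (hu.contDiffOn_chart he).contDiffAt
    ((e.isOpen_inter_preimage_symm hs).mem_nhds ⟨e.map_source hpe, ?_⟩)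
  simpa [e.left_inv hpe] using hp

/-- A differential that is nonzero at a point is nonzero nearby. -/
theorem CkOn.eventually_diffNeZero {k : ℕ∞} (hk : 1 ≤ k) {u : X → ℝ} {s : Set X}
    (hu : CkOn n k u s) (hs : IsOpen s) {p : X} (hp : p ∈ s) (hd : DiffNeZero n u p) :
    ∀ᶠ q in 𝓝 p, DiffNeZero n u q := by
  have he := chart_mem_atlas (Cn n) p
  set e := chartAt (Cn n) p
  have hpe : p ∈ e.source := mem_chart_source _ p
  have hc := hu.contDiffAt_chart hs hp he hpe
  have h1 : ContinuousAt (fderiv ℝ (u ∘ e.symm)) (e p) :=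
    ((hc.of_le (m := 1) (by exact_mod_cast hk)).fderiv_right (m := 0) (by simp)).continuousAt
  have h2 := (h1.comp (e.continuousAt hpe)).eventually_ne
    ((diffNeZero_iff_chart (hu.mdifferentiableAt hk hs hp) he hpe).1 hd)
  filter_upwards [h2, hs.mem_nhds hp, e.open_source.mem_nhds hpe] with q hq hqs hqe
  exact (diffNeZero_iff_chart (hu.mdifferentiableAt hk hs hqs) he hqe).2 hq

/-- Away from the boundary the constants -1 and 1 serve. At a boundary point, U is shrunk so that
the differential is nonzero at all of its boundary points, since gluing tests it away from the
centre. -/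
theorem exists_local_defining {Ω : Set X} (hΩ : IsOpen Ω) (hb : HasCkBoundary n 3 Ω) (x : X) :
    ∃ (U : Set X) (g : X → ℝ), IsOpen U ∧ x ∈ U ∧ CkOn n 3 g U ∧ (∀ y ∈ U, g y < 0 ↔ y ∈ Ω) ∧
      ∀ p ∈ U, p ∈ frontier Ω → DiffNeZero n g p := by
  by_cases hx : x ∈ Ω
  · refine ⟨Ω, fun _ => -1, hΩ, hx, contMDiffOn_const, fun y hy => by simpa using hy,
      fun p hp hpf => ?_⟩
    rw [hΩ.frontier_eq] at hpf
    exact absurd hp hpf.2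
  by_cases hx' : x ∈ closure Ω
  · have hxf : x ∈ frontier Ω := by rw [hΩ.frontier_eq]; exact ⟨hx', hx⟩
    obtain ⟨U, r, h⟩ := hb x hxf
    obtain ⟨V, hV, hVo, hxV⟩ := eventually_nhds_iff.1
      (h.contDiff.eventually_diffNeZero (by norm_num) h.isOpen h.mem h.diff_ne_zero)
    refine ⟨U ∩ V, r, h.isOpen.inter hVo, ⟨h.mem, hxV⟩,
      ContMDiffOn.mono h.contDiff Set.inter_subset_left, fun y hy => ?_, fun p hp _ => hV p hp.2⟩
    have : y ∈ Ω ∩ U ↔ y ∈ {x ∈ U | r x < 0} := by rw [h.inter_eq]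
    simpa [hy.1] using this.symm
  · refine ⟨(closure Ω)ᶜ, fun _ => 1, isClosed_closure.isOpen_compl, hx', contMDiffOn_const,
      fun y hy => ?_, fun p hp hpf => absurd (frontier_subset_closure hpf) hp⟩
    have : y ∉ Ω := fun h => hy (subset_closure h)
    simp only [this, iff_false, not_lt]
    exact zero_le_one

/-- A convex combination of local defining functions keeps the sign. On Ω all terms are nonpositive,
so the sum lies below each single term f_i g_i; at a boundary point where f_i > 0 this comparison
forces the differential to be nonzero. -/
theorem exists_global_defining [T2Space X] [SecondCountableTopology X] {Ω : Set X}
    (hΩ : IsOpen Ω) (hb : HasCkBoundary n 3 Ω) :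
    ∃ r : X → ℝ, CkOn n 3 r Set.univ ∧ (∀ x, r x < 0 ↔ x ∈ Ω) ∧
      ∀ p ∈ frontier Ω, DiffNeZero n r p := by
  classical
  have := isManifold_real n X
  have : LocallyCompactSpace X := ChartedSpace.locallyCompactSpace (Cn n) X
  choose U g hU hmem hg hlt hd using exists_local_defining (n := n) hΩ hb
  obtain ⟨f, hf⟩ := SmoothPartitionOfUnity.exists_isSubordinate 𝓘(ℝ, Cn n) isClosed_univ U hU
    (fun x _ => Set.mem_iUnion.2 ⟨x, hmem x⟩)
  have hsupp : ∀ i x, f i x ≠ 0 → x ∈ U i := fun i x h => hf i (subset_tsupport _ h)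
  set r : X → ℝ := fun x => ∑ᶠ i, f i x • g i x with hr
  have hrC : CkOn n 3 r Set.univ := (hf.contMDiff_finsum_smul hU hg).contMDiffOn
  have hneg : ∀ x, r x < 0 ↔ x ∈ Ω := by
    intro x
    constructor
    · intro h
      by_contra hx
      have : r x ∈ Set.Ici (0 : ℝ) := f.finsum_smul_mem_convex (Set.mem_univ x)
        (fun i hi => not_lt.1 fun hlt' => hx ((hlt i x (hsupp i x hi)).1 hlt')) (convex_Ici 0)
      exact absurd h (not_lt.2 this)
    · intro hx
      exact f.finsum_smul_mem_convex (t := Set.Iio (0 : ℝ)) (Set.mem_univ x)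
        (fun i hi => (hlt i x (hsupp i x hi)).2 hx) (convex_Iio 0)
  have hle : ∀ x ∈ Ω, ∀ i, r x ≤ f i x * g i x := by
    intro x hx i
    have hterm : ∀ j, f j x * g j x ≤ 0 := by
      intro j
      by_cases hj : f j x = 0
      · simp [hj]
      · exact mul_nonpos_of_nonneg_of_nonpos (f.nonneg j x)
          ((hlt j x (hsupp j x hj)).2 hx).le
    by_cases hi : f i x = 0
    · rw [hi, zero_mul]
      exact ((hneg x).2 hx).le
    · have hs : r x = ∑ j ∈ f.finsupport x, f j x * g j x := by
        simpa [hr] using (f.sum_finsupport_smul_eq_finsum x g).symm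
      have hi' : i ∈ f.finsupport x := (f.mem_finsupport x).2 hi
      rw [hs, ← Finset.add_sum_erase _ _ hi']
      linarith [Finset.sum_nonpos fun j (_ : j ∈ (f.finsupport x).erase i) => hterm j]
  refine ⟨r, hrC, hneg, fun p hp => ?_⟩
  have hpc : p ∈ closure Ω := frontier_subset_closure hp
  have hpΩ : p ∉ Ω := by rw [hΩ.frontier_eq] at hp; exact hp.2
  obtain ⟨i, hi⟩ := f.exists_pos_of_mem (Set.mem_univ p)
  have hpU : p ∈ U i := hsupp i p hi.ne'
  have he := chart_mem_atlas (Cn n) p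
  set e := chartAt (Cn n) p
  have hpe : p ∈ e.source := mem_chart_source _ p
  have hfi : CkOn n 3 (f i) Set.univ :=
    ((f i).contMDiff.of_le (by exact_mod_cast le_top)).contMDiffOn
  have hcd : ∀ {u : X → ℝ} {s : Set X}, CkOn n 3 u s → IsOpen s → p ∈ s →
      DifferentiableAt ℝ (u ∘ e.symm) (e p) := fun hu hs hps =>
    (hu.contDiffAt_chart hs hps he hpe).differentiableAt (by norm_num)
  have hpp : e.symm (e p) = p := e.left_inv hpe
  rw [diffNeZero_iff_chart (hrC.mdifferentiableAt (by norm_num) isOpen_univ trivial) he hpe]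
  refine fderiv_ne_zero_of_le_mul (F := f i ∘ e.symm) (G := g i ∘ e.symm)
    (hcd hrC isOpen_univ trivial) (hcd hfi isOpen_univ trivial) (hcd (hg i) (hU i) hpU)
    ?_ ?_ ?_ ?_ ?_
  · simp only [Function.comp_apply, hpp]
    exact eq_zero_of_mem_closure (hrC.continuousAt isOpen_univ trivial) hpc
      (Eventually.of_forall fun x => (hneg x).2) (not_lt.1 fun h => hpΩ ((hneg p).1 h))
  · simp only [Function.comp_apply, hpp]
    refine eq_zero_of_mem_closure ((hg i).continuousAt (hU i) hpU) hpc ?_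
      (not_lt.1 fun h => hpΩ ((hlt i p hpU).1 h))
    filter_upwards [(hU i).mem_nhds hpU] with x hx using (hlt i x hx).2
  · simpa [hpp] using hi
  · exact (diffNeZero_iff_chart ((hg i).mdifferentiableAt (by norm_num) (hU i) hpU) he hpe).1
      (hd i p hpU hp)
  · have hopen := (e.isOpen_inter_preimage_symm (hU i)).mem_nhds
      (x := e p) ⟨e.map_source hpe, by simpa [hpp] using hpU⟩
    filter_upwards [hopen] with z hz hz0
    exact hle _ ((hlt i _ hz.2).1 hz0) i

end DefiningFunction

/-! ### The strip estimates inside a holomorphic chart -/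

section StripChartOfChart

variable {X : Type*} [TopologicalSpace X]

theorem region_chart {Ω : Set X} {r : X → ℝ} (hneg : ∀ x, r x < 0 ↔ x ∈ Ω)
    (e : OpenPartialHomeomorph X (Cn n)) :
    region e.target (r ∘ e.symm) = e.target ∩ e.symm ⁻¹' Ω := by
  ext z
  simp [region, hneg]

theorem mem_frontier_of_mem_closure_region {Ω : Set X} (hΩ : IsOpen Ω) {r : X → ℝ}
    (hneg : ∀ x, r x < 0 ↔ x ∈ Ω) {e : OpenPartialHomeomorph X (Cn n)} {z : Cn n}
    (hz : z ∈ e.target) (hc : z ∈ closure (region e.target (r ∘ e.symm)))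
    (h0 : (r ∘ e.symm) z = 0) : e.symm z ∈ frontier Ω := by
  rw [hΩ.frontier_eq]
  refine ⟨?_, fun h => ?_⟩
  · refine (e.continuousAt_symm hz).continuousWithinAt.mem_closure hc ?_
    rw [region_chart hneg]
    exact fun x hx => hx.2
  · have := (hneg _).2 h
    simp only [Function.comp_apply] at h0
    linarith

variable [ChartedSpace (Cn n) X]

theorem hess_chart_sesq_pos {Ω : Set X} {φ : X → ℝ} (hpsh : StrictlyPSHOn n φ Ω)
    {e : OpenPartialHomeomorph X (Cn n)} (he : e ∈ atlas (Cn n) X) {z : Cn n}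
    (hz : z ∈ e.target ∩ e.symm ⁻¹' Ω) {v : Cn n} (hv : v ≠ 0) :
    0 < (sesq (hess (φ ∘ e.symm) z) v v).re := by
  have h := hpsh.2 (e.symm z) hz.2 e he (e.map_target hz.1) v hv
  rwa [complexHessian_eq_sesq, e.right_inv hz.1] at h

variable [IsManifold 𝓘(ℂ, Cn n) ω X]

theorem hess_chart_isHermitian {Ω : Set X} (hΩ : IsOpen Ω) {φ : X → ℝ}
    (hφ : CkOn n 2 φ Ω) {e : OpenPartialHomeomorph X (Cn n)} (he : e ∈ atlas (Cn n) X) {z : Cn n}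
    (hz : z ∈ e.target ∩ e.symm ⁻¹' Ω) : (hess (φ ∘ e.symm) z).IsHermitian :=
  hess_isHermitian ((hφ.contDiffOn_chart he).contDiffAt
    ((e.isOpen_inter_preimage_symm hΩ).mem_nhds hz))

/-- Two defining functions meet here. The geometry uses the C³ function r, while φ is built from the
C² function ρ. They are linked by growth alone: ρ is C¹ and vanishes on the boundary, so |ρ| ≤ C|r|
on the Ω-side of the compact set, whence |φ| ≤ C^η |r|^η. -/
theorem stripChart_of_chart {Ω : Set X} (hΩ : IsOpen Ω) {r ρ : X → ℝ} {η : ℝ}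
    (hr : CkOn n 3 r Set.univ) (hneg : ∀ x, r x < 0 ↔ x ∈ Ω)
    (hd : ∀ p ∈ frontier Ω, DiffNeZero n r p)
    (hlevi : ∀ p ∈ frontier Ω, LeviFormVanishesAt n r p)
    (hρ : IsDefiningFunction n ρ Ω) (hη : 0 < η)
    (hpsh : StrictlyPSHOn n (fun x => -((-ρ x) ^ η)) Ω)
    {e : OpenPartialHomeomorph X (Cn n)} (he : e ∈ atlas (Cn n) X) {K : Set (Cn n)}
    (hK : IsCompact K) (hKV : K ⊆ e.target) :
    StripChart e.target K (r ∘ e.symm) ((fun x => -((-ρ x) ^ η)) ∘ e.symm) η := by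
  have hrV : ContDiffOn ℝ 3 (r ∘ e.symm) e.target := by
    simpa using hr.contDiffOn_chart he
  have hr1 : ContDiffOn ℝ 1 (r ∘ e.symm) e.target := hrV.of_le (by norm_num)
  have hdV : ∀ z ∈ e.target, z ∈ closure (region e.target (r ∘ e.symm)) → (r ∘ e.symm) z = 0 →
      fderiv ℝ (r ∘ e.symm) z ≠ 0 := by
    intro z hz hc h0
    have := (diffNeZero_iff_chart (hr.mdifferentiableAt (by norm_num) isOpen_univ trivial) he
      (e.map_target hz)).1 (hd _ (mem_frontier_of_mem_closure_region hΩ hneg hz hc h0))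
    rwa [e.right_inv hz] at this
  have hreg := region_chart hneg e
  refine ⟨e.open_target, hK, hKV, hrV, ?_, ?_, ?_, ?_, ?_, hη.le⟩
  · rw [hreg]
    exact hpsh.1.contDiffOn_chart he
  · rw [hreg]
    intro z hz
    refine posSemidef_of_sesq (hess_chart_isHermitian hΩ hpsh.1 he hz) fun v => ?_
    by_cases hv : v = 0
    · simp [hv, sesq]
    · exact (hess_chart_sesq_pos hpsh he hz hv).le
  · refine levi_form_bound e.open_target hrV hdV (fun z hz hc h0 v w hv hw => ?_) hK hKV
    have h := hlevi _ (mem_frontier_of_mem_closure_region hΩ hneg hz hc h0) e he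
      (e.map_target hz) v w
    rw [e.right_inv hz, delForm_eq_grad, delForm_eq_grad, complexHessian_eq_sesq] at h
    exact h hv hw
  · obtain ⟨U, hU, hΩU, hρU⟩ := hρ.contDiff
    have hV' : IsOpen (e.target ∩ e.symm ⁻¹' U) := e.isOpen_inter_preimage_symm hU
    have hsub : region (e.target ∩ e.symm ⁻¹' U) (r ∘ e.symm) ⊆ region e.target (r ∘ e.symm) :=
      fun z hz => ⟨hz.1.1, hz.2⟩
    -- ρ is regular only on a neighbourhood of the closure of Ω, so K is cut down to that closure
    -- before the comparison.
    have hK' : IsCompact (K ∩ e.symm ⁻¹' closure Ω) :=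
      hK.of_isClosed_subset ((e.continuousOn_symm.mono hKV).preimage_isClosed_of_isClosed
        hK.isClosed isClosed_closure) Set.inter_subset_left
    obtain ⟨C, hC, hle⟩ := norm_le_mul_abs_of_vanish hV' (hr1.mono Set.inter_subset_left)
      (fun z hz hc h0 => hdV z hz.1 (closure_mono hsub hc) h0)
      (g := ρ ∘ e.symm) ((hρU.contDiffOn_chart he).of_le (by norm_num))
      (fun z hz hc h0 => by
        have hf := mem_frontier_of_mem_closure_region hΩ hneg hz.1 (closure_mono hsub hc) h0
        have hcl := frontier_subset_closure hf
        have hnot : e.symm z ∉ Ω := by rw [hΩ.frontier_eq] at hf; exact hf.2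
        change ρ (e.symm z) = 0
        refine eq_zero_of_mem_closure (hρU.continuousAt hU (hΩU hcl)) hcl
          (Eventually.of_forall fun x hx => ?_) (not_lt.1 fun h => hnot ?_)
        · rw [hρ.eq_neg] at hx
          exact hx.2
        · rw [hρ.eq_neg]
          exact ⟨hcl, h⟩)
      hK' (fun z hz => ⟨hKV hz.1, hΩU hz.2⟩)
    refine ⟨C ^ η, by positivity, fun z hz hzr => ?_⟩
    have hzΩ : e.symm z ∈ Ω := by rw [hreg] at hzr; exact hzr.2
    have hzc := subset_closure hzΩ
    have h1 := hle z ⟨hz, hzc⟩ ⟨⟨hKV hz, hΩU hzc⟩, hzr.2⟩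
    have hρneg : ρ (e.symm z) < 0 := by
      rw [hρ.eq_neg] at hzΩ
      exact hzΩ.2
    simp only [Function.comp_apply, Real.norm_eq_abs, abs_of_neg hρneg] at h1
    have h2 : 0 ≤ -ρ (e.symm z) := by linarith
    simp only [Function.comp_apply, abs_neg, abs_of_nonneg (Real.rpow_nonneg h2 η)]
    rw [← Real.mul_rpow hC (abs_nonneg _)]
    exact Real.rpow_le_rpow h2 h1 hη.le
  · exact measure_strip_le volume e.open_target hr1 hdV hK hKV

end StripChartOfChart

/-! ### Chart independence of Monge–Ampère integrals -/

theorem mixedMA_congr {u v : Fin n → Cn n → ℝ} {z : Cn n} (h : ∀ i, u i =ᶠ[𝓝 z] v i) :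
    mixedMA u z = mixedMA v z := by
  simp only [mixedMA, fun i => hess_congr (h i)]

/-- The real determinant of a complex linear map is the squared modulus of its complex determinant;
the matrix displayed is the transpose of the usual one. -/
theorem det_restrictScalars_fderiv (A : Cn n →L[ℂ] Cn n) :
    (A.restrictScalars ℝ).det
      = Complex.normSq (Matrix.of fun j a => A (EuclideanSpace.single j 1) a).det := by
  have h1 : (A.restrictScalars ℝ).det = Algebra.norm ℝ (LinearMap.det (A : Cn n →ₗ[ℂ] Cn n)) := by
    rw [← LinearMap.det_restrictScalars]
    rfl
  rw [h1, Algebra.norm_complex_apply,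
    ← LinearMap.det_toMatrix (EuclideanSpace.basisFun (Fin n) ℂ).toBasis, ← Matrix.det_transpose]
  congr 2

/-- Each Hessian becomes J A J*, so the mixed discriminant gains |det J|², exactly the real
Jacobian. The density therefore transforms like a volume form. -/
theorem mixedMA_comp_holo {T : Cn n → Cn n} {u : Fin n → Cn n → ℝ} {z : Cn n}
    (hT : ContDiffAt ℂ 2 T z) (hu : ∀ i, ContDiffAt ℝ 2 (u i) (T z)) :
    mixedMA (fun i => u i ∘ T) z
      = |((fderiv ℂ T z).restrictScalars ℝ).det| * mixedMA u (T z) := by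
  set J : Matrix (Fin n) (Fin n) ℂ :=
    Matrix.of fun j a => fderiv ℂ T z (EuclideanSpace.single j 1) a with hJ
  have h1 : ∀ i, hess (u i ∘ T) z = J * (hess (u i) (T z) * J.conjTranspose) := by
    intro i
    ext j k
    rw [← Matrix.mul_assoc, show u i ∘ T = fun x => u i (T x) from rfl,
      hess_comp_holo hT (hu i)]
    simp [Matrix.mul_apply, hJ, Finset.sum_mul]
  rw [det_restrictScalars_fderiv, abs_of_nonneg (Complex.normSq_nonneg _)]
  simp only [mixedMA, h1]
  rw [mixedDisc_mul_left, mixedDisc_mul_right, Matrix.det_conjTranspose, ← mul_assoc,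
    RCLike.star_def, Complex.mul_conj, Complex.re_ofReal_mul]

section ChartIntegral

variable {X : Type*} [TopologicalSpace X]

/-- The integrand of a mixed Monge–Ampère integral, read in a chart. -/
def chartDensity (e : OpenPartialHomeomorph X (Cn n)) (a : X → ℝ) (u : Fin n → X → ℝ)
    (z : Cn n) : ℝ :=
  a (e.symm z) * mixedMA (fun i => u i ∘ e.symm) z

/-- The integral of `a` against a mixed Monge–Ampère density over the part of `W` in a chart. -/
def chartIntegral (e : OpenPartialHomeomorph X (Cn n)) (W : Set X) (a : X → ℝ)
    (u : Fin n → X → ℝ) : ℝ :=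
  ∫ z in e.target ∩ e.symm ⁻¹' W, chartDensity e a u z

theorem comp_eventuallyEq {e : OpenPartialHomeomorph X (Cn n)} {z : Cn n} (hz : z ∈ e.target)
    {f g : X → ℝ} (h : f =ᶠ[𝓝 (e.symm z)] g) : f ∘ e.symm =ᶠ[𝓝 z] g ∘ e.symm :=
  (e.continuousAt_symm hz).eventually h

theorem mixedMA_eq_zero {u : Fin n → Cn n → ℝ} {z : Cn n} {i : Fin n}
    (h : u i =ᶠ[𝓝 z] fun _ => 0) : mixedMA u z = 0 := by
  have h1 : (fun j => hess (u j) z) = Function.update (fun j => hess (u j) z) i 0 := by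
    rw [eq_comm, Function.update_eq_self_iff, hess_congr h, hess_const]
  rw [mixedMA, h1, mixedDisc_update_zero, Complex.zero_re]

theorem chartDensity_eq_zero {e : OpenPartialHomeomorph X (Cn n)} {a : X → ℝ}
    {u : Fin n → X → ℝ} {z : Cn n} (hz : z ∈ e.target)
    (h : a (e.symm z) = 0 ∨ ∃ i, u i =ᶠ[𝓝 (e.symm z)] fun _ => 0) : chartDensity e a u z = 0 := by
  rcases h with h | ⟨i, h⟩
  · rw [chartDensity, h, zero_mul]
  · rw [chartDensity, mixedMA_eq_zero (i := i) (comp_eventuallyEq hz h), mul_zero]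

theorem chartIntegral_mono_set {e : OpenPartialHomeomorph X (Cn n)} {Ω W : Set X}
    (hΩ : IsOpen Ω) (hWΩ : W ⊆ Ω) {a : X → ℝ} {u : Fin n → X → ℝ}
    (h : ∀ x ∈ Ω, x ∈ e.source → x ∉ W → a x = 0 ∨ ∃ i, u i =ᶠ[𝓝 x] fun _ => 0) :
    chartIntegral e Ω a u = chartIntegral e W a u := by
  refine setIntegral_eq_of_subset_of_forall_sdiff_eq_zero
    (e.isOpen_inter_preimage_symm hΩ).measurableSet (fun z hz => ⟨hz.1, hWΩ hz.2⟩) fun z hz => ?_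
  exact chartDensity_eq_zero hz.1.1
    (h _ hz.1.2 (e.map_target hz.1.1) fun hW => hz.2 ⟨hz.1.1, hW⟩)

theorem chart_image_isCompact {e : OpenPartialHomeomorph X (Cn n)} {Ω S : Set X}
    (hS : IsCompact S) (hSe : S ⊆ e.source) (hSΩ : S ⊆ Ω) :
    IsCompact (e '' S) ∧ e '' S ⊆ e.target ∩ e.symm ⁻¹' Ω := by
  refine ⟨hS.image_of_continuousOn (e.continuousOn.mono hSe), ?_⟩
  rintro _ ⟨x, hx, rfl⟩
  refine ⟨e.map_source (hSe hx), ?_⟩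
  simpa [e.left_inv (hSe hx)] using hSΩ hx

variable [ChartedSpace (Cn n) X] [IsManifold 𝓘(ℂ, Cn n) ω X]

theorem chartIntegral_change {e e' : OpenPartialHomeomorph X (Cn n)} (he : e ∈ atlas (Cn n) X)
    (he' : e' ∈ atlas (Cn n) X) {W : Set X} (hW : IsOpen W) (hWe : W ⊆ e.source)
    (hWe' : W ⊆ e'.source) (a : X → ℝ) {u : Fin n → X → ℝ} (hu : ∀ i, CkOn n 2 (u i) W) :
    chartIntegral e' W a u = chartIntegral e W a u := by
  have hG := e.isOpen_inter_preimage_symm hW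
  have hT : ∀ z ∈ e.target ∩ e.symm ⁻¹' W, ContDiffAt ℂ 2 (e' ∘ e.symm) z := fun z hz =>
    ((contDiffOn_transition he he').contDiffAt ((e.isOpen_inter_preimage_symm
      e'.open_source).mem_nhds ⟨hz.1, hWe' hz.2⟩)).of_le le_top
  have hback : ∀ z ∈ e.target ∩ e.symm ⁻¹' W, e'.symm (e' (e.symm z)) = e.symm z := fun z hz =>
    e'.left_inv (hWe' hz.2)
  have himage : (e' ∘ e.symm) '' (e.target ∩ e.symm ⁻¹' W) = e'.target ∩ e'.symm ⁻¹' W := by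
    ext w
    constructor
    · rintro ⟨z, hz, rfl⟩
      refine ⟨e'.map_source (hWe' hz.2), ?_⟩
      simpa [hback z hz] using hz.2
    · rintro ⟨hw, hwW⟩
      refine ⟨e (e'.symm w), ⟨e.map_source (hWe hwW), ?_⟩, ?_⟩
      · simpa [e.left_inv (hWe hwW)] using hwW
      · simp [e.left_inv (hWe hwW), e'.right_inv hw]
  have hinj : Set.InjOn (e' ∘ e.symm) (e.target ∩ e.symm ⁻¹' W) := by
    intro z hz w hw h
    have h1 : e.symm z = e.symm w := by
      rw [← hback z hz, ← hback w hw]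
      exact congrArg e'.symm h
    rw [← e.right_inv hz.1, h1, e.right_inv hw.1]
  rw [chartIntegral, ← himage, integral_image_eq_integral_abs_det_fderiv_smul volume
    hG.measurableSet (f' := fun z => (fderiv ℂ (e' ∘ e.symm) z).restrictScalars ℝ)
    (fun z hz => (((hT z hz).differentiableAt
      (by norm_num)).hasFDerivAt.restrictScalars ℝ).hasFDerivWithinAt) hinj]
  refine setIntegral_congr_fun hG.measurableSet fun z hz => ?_
  have hTz : (e' ∘ e.symm) z ∈ e'.target ∩ e'.symm ⁻¹' W := himage ▸ Set.mem_image_of_mem _ hz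
  have h1 : mixedMA (fun i => u i ∘ e.symm) z
      = mixedMA (fun i => (u i ∘ e'.symm) ∘ (e' ∘ e.symm)) z := by
    refine mixedMA_congr fun i => ?_
    filter_upwards [hG.mem_nhds hz] with y hy
    simp [hback y hy]
  have h2 := mixedMA_comp_holo (u := fun i => u i ∘ e'.symm) (hT z hz) fun i =>
    ((hu i).contDiffOn_chart he').contDiffAt ((e'.isOpen_inter_preimage_symm hW).mem_nhds hTz)
  simp only [chartDensity, h1, h2, smul_eq_mul, Function.comp_apply, hback z hz]
  ring

/-- Both integrals reduce to the common domain of the charts, where the change of variables applies.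
-/
theorem chartIntegral_transfer {e e' : OpenPartialHomeomorph X (Cn n)}
    (he : e ∈ atlas (Cn n) X) (he' : e' ∈ atlas (Cn n) X) {Ω : Set X} (hΩ : IsOpen Ω)
    {a : X → ℝ} {u : Fin n → X → ℝ} (hu : ∀ i, CkOn n 2 (u i) Ω)
    (h : ∀ x ∈ Ω, x ∉ e.source ∨ x ∉ e'.source → a x = 0 ∨ ∃ i, u i =ᶠ[𝓝 x] fun _ => 0) :
    chartIntegral e Ω a u = chartIntegral e' Ω a u := by
  have hW : IsOpen (Ω ∩ (e.source ∩ e'.source)) := hΩ.inter (e.open_source.inter e'.open_source)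
  rw [chartIntegral_mono_set hΩ (W := Ω ∩ (e.source ∩ e'.source)) Set.inter_subset_left,
    chartIntegral_mono_set (e := e') hΩ (W := Ω ∩ (e.source ∩ e'.source)) Set.inter_subset_left,
    chartIntegral_change he he' hW (fun x hx => hx.2.1) (fun x hx => hx.2.2)]
  · exact fun i => ContMDiffOn.mono (hu i) Set.inter_subset_left
  · intro x hx hxe hxW
    exact h x hx (Or.inl fun h' => hxW ⟨hx, h', hxe⟩)
  · intro x hx hxe hxW
    exact h x hx (Or.inr fun h' => hxW ⟨hx, hxe, h'⟩)

theorem continuousOn_chartDensity {e : OpenPartialHomeomorph X (Cn n)}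
    (he : e ∈ atlas (Cn n) X) {Ω : Set X} (hΩ : IsOpen Ω) {a : X → ℝ} (ha : ContinuousOn a Ω)
    {u : Fin n → X → ℝ} (hu : ∀ i, CkOn n 2 (u i) Ω) :
    ContinuousOn (chartDensity e a u) (e.target ∩ e.symm ⁻¹' Ω) :=
  (ha.comp (e.continuousOn_symm.mono Set.inter_subset_left) fun _ hz => hz.2).mul
    (continuousOn_mixedMA (e.isOpen_inter_preimage_symm hΩ) fun i => (hu i).contDiffOn_chart he)

theorem integrableOn_chartDensity {e : OpenPartialHomeomorph X (Cn n)}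
    (he : e ∈ atlas (Cn n) X) {Ω S : Set X} (hΩ : IsOpen Ω) (hS : IsCompact S)
    (hSe : S ⊆ e.source) (hSΩ : S ⊆ Ω) {a : X → ℝ} (ha : ContinuousOn a Ω)
    {u : Fin n → X → ℝ} (hu : ∀ i, CkOn n 2 (u i) Ω)
    (h : ∀ x ∈ Ω, x ∈ e.source → x ∉ S → a x = 0 ∨ ∃ i, u i =ᶠ[𝓝 x] fun _ => 0) :
    IntegrableOn (chartDensity e a u) (e.target ∩ e.symm ⁻¹' Ω) := by
  obtain ⟨hK, hKG⟩ := chart_image_isCompact hS hSe hSΩ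
  have hc := continuousOn_chartDensity he hΩ ha hu
  refine IntegrableOn.of_forall_sdiff_eq_zero ((hc.mono hKG).integrableOn_compact hK)
    (e.isOpen_inter_preimage_symm hΩ).measurableSet fun z hz => ?_
  refine chartDensity_eq_zero hz.1.1 (h _ hz.1.2 (e.map_target hz.1.1) fun hzS => hz.2 ?_)
  exact ⟨_, hzS, e.right_inv hz.1.1⟩

end ChartIntegral

/-! ### Global integration by parts with a partition of unity -/

theorem mixedMA_update_sum {ι : Type*} (s : Finset ι) (u : Fin n → Cn n → ℝ) (i₀ : Fin n)
    {ζ : ι → Cn n → ℝ} {z : Cn n} (hζ : ∀ j, ContDiffAt ℝ 2 (ζ j) z) :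
    mixedMA (Function.update u i₀ fun x => ∑ j ∈ s, ζ j x) z
      = ∑ j ∈ s, mixedMA (Function.update u i₀ (ζ j)) z := by
  classical
  induction s using Finset.induction_on with
  | empty =>
    simp only [Finset.sum_empty]
    exact mixedMA_eq_zero (i := i₀) (by simp)
  | insert j s hj ih =>
    rw [Finset.sum_insert hj, ← ih]
    simp only [Finset.sum_insert hj, mixedMA, ← update_hess]
    rw [hess_add (hζ j) (ContDiffAt.sum fun i _ => hζ i), mixedDisc_update_add, Complex.add_re]

theorem comp_update {X : Type*} (u : Fin n → X → ℝ) (i₀ : Fin n) (ζ : X → ℝ) (f : Cn n → X) :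
    (fun i => Function.update u i₀ ζ i ∘ f) = Function.update (fun i => u i ∘ f) i₀ (ζ ∘ f) := by
  ext1 i
  by_cases hi : i = i₀
  · subst hi; simp
  · simp [hi]

section GlobalParts

variable {X : Type*} [TopologicalSpace X] [ChartedSpace (Cn n) X]

theorem CkOn.update {k : ℕ∞} {Ω : Set X} {u : Fin n → X → ℝ} (hu : ∀ i, CkOn n k (u i) Ω)
    {ζ : X → ℝ} (hζ : CkOn n k ζ Ω) (i₀ i : Fin n) : CkOn n k (Function.update u i₀ ζ i) Ω := by
  by_cases hi : i = i₀
  · subst hi; simpa using hζ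
  · simpa [hi] using hu i

variable [IsManifold 𝓘(ℂ, Cn n) ω X]

theorem chartIntegral_parts {e : OpenPartialHomeomorph X (Cn n)} (he : e ∈ atlas (Cn n) X)
    {Ω S : Set X} (hΩ : IsOpen Ω) (hS : IsCompact S) (hSe : S ⊆ e.source) (hSΩ : S ⊆ Ω)
    {u : Fin n → X → ℝ} (hu : ∀ i, CkOn n 2 (u i) Ω) {ζ : X → ℝ} (hζ : CkOn n 2 ζ Ω)
    (hζS : ∀ x ∈ Ω, x ∉ S → ζ x = 0) (i₀ : Fin n) :
    chartIntegral e Ω ζ u = chartIntegral e Ω (u i₀) (Function.update u i₀ ζ) := by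
  obtain ⟨hK, hKG⟩ := chart_image_isCompact hS hSe hSΩ
  have h := setIntegral_mul_mixedMA (e.isOpen_inter_preimage_symm hΩ) hK hKG i₀
    (ζ := ζ ∘ e.symm) (u := fun i => u i ∘ e.symm) (hζ.contDiffOn_chart he)
    (fun z hz hzK => hζS _ hz.2 fun hzS => hzK ⟨_, hzS, e.right_inv hz.1⟩)
    (fun i => (hu i).contDiffOn_chart he)
  simpa only [chartIntegral, chartDensity, comp_update, Function.comp_apply] using h

/-- Integration by parts for the mixed Monge–Ampère operator, globalized by a partition of unity
subordinate to holomorphic charts. -/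
theorem sum_chartIntegral_parts [T2Space X] {ι : Type*} [Fintype ι]
    {e : ι → OpenPartialHomeomorph X (Cn n)} (he : ∀ i, e i ∈ atlas (Cn n) X)
    {θ : ι → X → ℝ} (hθ : ∀ i, CkOn n 2 (θ i) Set.univ)
    (hθe : ∀ i, tsupport (θ i) ⊆ (e i).source) {Ω S : Set X} (hΩ : IsOpen Ω)
    (hsum : ∀ x ∈ Ω, ∑ i, θ i x = 1) (hS : IsCompact S) (hSΩ : S ⊆ Ω)
    {u : Fin n → X → ℝ} (hu : ∀ i, CkOn n 2 (u i) Ω) {χ : X → ℝ} (hχ : CkOn n 2 χ Ω)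
    (hχS : ∀ x ∈ Ω, x ∉ S → χ x = 0) (i₀ : Fin n) :
    ∑ i, chartIntegral (e i) Ω (fun x => θ i x * χ x) u
      = ∑ i, chartIntegral (e i) Ω (fun x => θ i x * u i₀ x) (Function.update u i₀ χ) := by
  set ζ : ι → X → ℝ := fun j x => θ j x * χ x with hζdef
  have hθΩ : ∀ i, CkOn n 2 (θ i) Ω := fun i => ContMDiffOn.mono (hθ i) (Set.subset_univ _)
  have hζ : ∀ j, CkOn n 2 (ζ j) Ω := fun j => ContMDiffOn.mul (hθΩ j) hχ
  have hupd : ∀ j i, CkOn n 2 (Function.update u i₀ (ζ j) i) Ω := fun j i =>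
    CkOn.update hu (hζ j) i₀ i
  have hcont : ∀ {f : X → ℝ}, CkOn n 2 f Ω → ContinuousOn f Ω := fun hf =>
    ContMDiffOn.continuousOn hf
  have hcompact : ∀ j, IsCompact (S ∩ tsupport (θ j)) := fun j =>
    hS.inter_right (isClosed_tsupport _)
  have hzero : ∀ j, ∀ x ∈ Ω, x ∉ S ∩ tsupport (θ j) → ζ j =ᶠ[𝓝 x] fun _ => 0 := by
    intro j x hx hxS
    by_cases h : x ∈ S
    · have h' : x ∉ tsupport (θ j) := fun ht => hxS ⟨h, ht⟩
      filter_upwards [notMem_tsupport_iff_eventuallyEq.1 h'] with y hy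
      simp [hζdef, hy]
    · filter_upwards [(hΩ.sdiff hS.isClosed).mem_nhds ⟨hx, h⟩] with y hy
      simp [hζdef, hχS y hy.1 hy.2]
  have hθ0 : ∀ i x, x ∉ (e i).source → θ i x = 0 := fun i x hx =>
    image_eq_zero_of_notMem_tsupport fun h => hx (hθe i h)
  have hupd0 : ∀ j, ∀ x ∈ Ω, x ∉ S ∩ tsupport (θ j) →
      ∃ i, Function.update u i₀ (ζ j) i =ᶠ[𝓝 x] fun _ => 0 := fun j x hx hxS =>
    ⟨i₀, by simpa using hzero j x hx hxS⟩
  have hlocal : ∀ j, chartIntegral (e j) Ω (ζ j) u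
      = ∑ i, chartIntegral (e i) Ω (fun x => θ i x * u i₀ x) (Function.update u i₀ (ζ j)) := by
    intro j
    rw [chartIntegral_parts (he j) hΩ (hcompact j) (fun x hx => hθe j hx.2) (fun x hx => hSΩ hx.1)
      hu (hζ j) (fun x hx hxS => (hzero j x hx hxS).eq_of_nhds) i₀]
    -- In the integrand with indices i and j, θ i vanishes off the i-th chart, and ζ j vanishes near
    -- every point of Ω off the j-th. The integral may thus be read in either chart, and in the j-th
    -- one the θ i sum to 1.
    have h1 : ∀ i, chartIntegral (e i) Ω (fun x => θ i x * u i₀ x) (Function.update u i₀ (ζ j))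
        = chartIntegral (e j) Ω (fun x => θ i x * u i₀ x) (Function.update u i₀ (ζ j)) := by
      intro i
      refine chartIntegral_transfer (he i) (he j) hΩ (hupd j) fun x hx hxe => ?_
      rcases hxe with hxe | hxe
      · exact Or.inl (by rw [hθ0 i x hxe, zero_mul])
      · exact Or.inr (hupd0 j x hx fun h => hxe (hθe j h.2))
    simp only [h1]
    simp only [chartIntegral]
    rw [← integral_finsetSum]
    · refine setIntegral_congr_fun ((e j).isOpen_inter_preimage_symm hΩ).measurableSet
        fun z hz => ?_
      simp only [chartDensity, ← Finset.sum_mul, hsum _ hz.2, one_mul]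
    · intro i _
      exact integrableOn_chartDensity (he j) hΩ (hcompact j) (fun x hx => hθe j hx.2)
        (fun x hx => hSΩ hx.1) ((hcont (hθΩ i)).mul (hcont (hu i₀))) (hupd j)
        fun x hx _ hxS => Or.inr (hupd0 j x hx hxS)
  -- Now j is summed first, inside slot i₀. The mixed discriminant is additive there and the ζ j add
  -- up to χ, so no derivative of the partition of unity survives.
  rw [Finset.sum_congr rfl fun j _ => hlocal j, Finset.sum_comm]
  refine Finset.sum_congr rfl fun i _ => ?_
  simp only [chartIntegral]
  rw [← integral_finsetSum]
  · have hG := (e i).isOpen_inter_preimage_symm hΩ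
    refine setIntegral_congr_fun hG.measurableSet fun z hz => ?_
    simp only [chartDensity, ← Finset.mul_sum, comp_update]
    congr 1
    rw [← mixedMA_update_sum Finset.univ _ i₀ fun j =>
      ((hζ j).contDiffOn_chart (he i)).contDiffAt (hG.mem_nhds hz)]
    refine mixedMA_congr fun k => ?_
    by_cases hk : k = i₀
    · subst hk
      simp only [Function.update_self]
      filter_upwards [hG.mem_nhds hz] with y hy
      simp only [hζdef, Function.comp_apply, ← Finset.sum_mul, hsum _ hy.2, one_mul]
    · simp only [Function.update_of_ne hk]
      exact EventuallyEq.rfl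
  · intro j _
    refine integrableOn_chartDensity (he i) hΩ (hcompact i) (fun x hx => hθe i hx.2)
      (fun x hx => hSΩ hx.1) ((hcont (hθΩ i)).mul (hcont (hu i₀))) (hupd j) fun x hx _ hxS => ?_
    by_cases h : x ∈ tsupport (θ i)
    · exact Or.inr (hupd0 j x hx fun h' => hxS ⟨h'.1, h⟩)
    · exact Or.inl (by rw [Pi.mul_apply, image_eq_zero_of_notMem_tsupport h, zero_mul])

end GlobalParts

/-! ### Lower bound for the mass and the contradiction -/

theorem mixedMA_const_pos {f : Cn n → ℝ} {z : Cn n} (h : (hess f z).PosDef) :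
    0 < mixedMA (fun _ => f) z := by
  have hdet := (Complex.lt_def.1 h.det_pos).1
  rw [mixedMA, mixedDisc_const, ← Complex.ofReal_natCast, Complex.re_ofReal_mul]
  exact mul_pos (by exact_mod_cast n.factorial_pos) hdet

/-- A smooth step, from `0` on `(-∞, 1]` to `1` on `[2, ∞)`. -/
def step (t : ℝ) : ℝ := Real.smoothTransition (t - 1)

theorem step_contDiff : ContDiff ℝ 2 step :=
  (Real.smoothTransition.contDiff (n := 2)).comp (contDiff_id.sub contDiff_const)

theorem step_nonneg (t : ℝ) : 0 ≤ step t := Real.smoothTransition.nonneg _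

theorem abs_step_le (t : ℝ) : |step t| ≤ 1 := by
  rw [abs_of_nonneg (step_nonneg t)]
  exact Real.smoothTransition.le_one _

theorem step_of_le {t : ℝ} (h : t ≤ 1) : step t = 0 :=
  Real.smoothTransition.zero_of_nonpos (by linarith)

theorem step_of_ge {t : ℝ} (h : 2 ≤ t) : step t = 1 :=
  Real.smoothTransition.one_of_one_le (by linarith)

theorem step_monotone : Monotone step := fun _ _ h =>
  Real.smoothTransition.monotone (by linarith)

section FinalArgument

variable {X : Type*} [TopologicalSpace X] [ChartedSpace (Cn n) X]

theorem CkOn.step_cutoff {r : X → ℝ} (hr : CkOn n 3 r Set.univ) (Ω : Set X) (ε : ℝ) :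
    CkOn n 2 (fun x => step (-r x / ε)) Ω := by
  have h1 : ContDiff ℝ 2 fun t : ℝ => step (-t / ε) :=
    step_contDiff.comp (contDiff_id.neg.div_const ε)
  exact (h1.contMDiff.comp_contMDiffOn
    (ContMDiffOn.of_le hr (by norm_num))).mono (Set.subset_univ _)

theorem exists_exponent_of_lt_dfIndex {Ω : Set X} {a : ℝ} (ha : 0 ≤ a) (h : a < dfIndex n Ω) :
    ∃ (ρ : X → ℝ) (η : ℝ), IsDefiningFunction n ρ Ω ∧ a < η ∧
      StrictlyPSHOn n (fun x => -((-ρ x) ^ η)) Ω := by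
  have hne : ∀ {s : Set ℝ}, a < sSup s → ∃ b ∈ s, a < b := by
    intro s hs
    refine exists_lt_of_lt_csSup (Set.nonempty_iff_ne_empty.2 ?_) hs
    -- The supremum of the empty set of reals is 0, which cannot exceed a ≥ 0.
    rintro rfl
    rw [Real.sSup_empty] at hs
    linarith
  obtain ⟨_, ⟨ρ, hρ, rfl⟩, hlt⟩ := hne h
  obtain ⟨η, hη, hlt'⟩ := hne hlt
  exact ⟨ρ, η, hρ, hlt', hη.2.2.1⟩

variable [IsManifold 𝓘(ℂ, Cn n) ω X]

theorem mixedMA_chart_pos {Ω : Set X} (hΩ : IsOpen Ω) {φ : X → ℝ} (hpsh : StrictlyPSHOn n φ Ω)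
    {e : OpenPartialHomeomorph X (Cn n)} (he : e ∈ atlas (Cn n) X) {z : Cn n}
    (hz : z ∈ e.target ∩ e.symm ⁻¹' Ω) : 0 < mixedMA (fun _ => φ ∘ e.symm) z :=
  mixedMA_const_pos (posDef_of_sesq (hess_chart_isHermitian hΩ hpsh.1 he hz)
    fun _ hv => hess_chart_sesq_pos hpsh he hz hv)

/-- A finite smooth partition of unity on a compact set, each member supported in a relatively
compact part of a chart. -/
theorem exists_chart_partition [T2Space X] [SecondCountableTopology X] {Y : Set X}
    (hY : IsCompact Y) :
    ∃ (t : Finset X) (e : t → OpenPartialHomeomorph X (Cn n))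
      (L K : t → Set (Cn n)) (θ : t → X → ℝ),
      (∀ i, e i ∈ atlas (Cn n) X) ∧ (∀ i, IsCompact (L i)) ∧ (∀ i, IsCompact (K i)) ∧
      (∀ i, L i ⊆ interior (K i)) ∧ (∀ i, K i ⊆ (e i).target) ∧
      (∀ i, CkOn n 2 (θ i) Set.univ) ∧ (∀ i x, 0 ≤ θ i x) ∧ (∀ i x, θ i x ≤ 1) ∧
      (∀ x ∈ Y, ∑ i, θ i x = 1) ∧
      ∀ i, tsupport (θ i) ⊆ (e i).source ∩ e i ⁻¹' L i := by
  have := isManifold_real n X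
  have : LocallyCompactSpace X := ChartedSpace.locallyCompactSpace (Cn n) X
  have hK : ∀ x : X, ∃ K : Set (Cn n), IsCompact K ∧ chartAt (Cn n) x x ∈ interior K ∧
      K ⊆ (chartAt (Cn n) x).target := fun x =>
    exists_compact_subset (chartAt (Cn n) x).open_target (mem_chart_target _ x)
  choose K hKc hxK hKt using hK
  have hL : ∀ x : X, ∃ L : Set (Cn n), IsCompact L ∧ chartAt (Cn n) x x ∈ interior L ∧
      L ⊆ interior (K x) := fun x => exists_compact_subset isOpen_interior (hxK x)
  choose L hLc hxL hLK using hL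
  let U : X → Set X := fun x =>
    (chartAt (Cn n) x).source ∩ chartAt (Cn n) x ⁻¹' interior (L x)
  have hU : ∀ x, IsOpen (U x) := fun x =>
    (chartAt (Cn n) x).isOpen_inter_preimage isOpen_interior
  obtain ⟨t, -, ht⟩ := hY.elim_nhds_subcover U fun x _ =>
    (hU x).mem_nhds ⟨mem_chart_source _ x, hxL x⟩
  obtain ⟨f, hf⟩ := SmoothPartitionOfUnity.exists_isSubordinate 𝓘(ℝ, Cn n) hY.isClosed
    (fun x : t => U x) (fun x => hU x) fun y hy => by
      obtain ⟨x, hx, hyx⟩ := Set.mem_iUnion₂.1 (ht hy)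
      exact Set.mem_iUnion.2 ⟨⟨x, hx⟩, hyx⟩
  refine ⟨t, fun x => chartAt (Cn n) (x : X), fun x => L x, fun x => K x,
    fun x => f x, fun x => chart_mem_atlas _ _, fun x => hLc x, fun x => hKc x, fun x => hLK x,
    fun x => hKt x, fun x => ?_, fun x y => f.nonneg x y, fun x y => f.le_one x y, fun y hy => ?_,
    fun x y hy => ⟨(hf x hy).1, (interior_subset : interior (L x) ⊆ L x) (hf x hy).2⟩⟩
  · exact ((f x).contMDiff.of_le (by exact_mod_cast le_top)).contMDiffOn
  · rw [← finsum_eq_sum_of_fintype]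
    exact f.sum_eq_one hy

theorem isCompact_sublevel {Ω : Set X} (hc : IsCompact (closure Ω)) {r : X → ℝ}
    (hr : Continuous r) (hneg : ∀ x, r x < 0 ↔ x ∈ Ω) {ε : ℝ} (hε : 0 < ε) :
    IsCompact {x | r x ≤ -ε} ∧ {x | r x ≤ -ε} ⊆ Ω := by
  have hsub : {x | r x ≤ -ε} ⊆ Ω := fun x hx => (hneg x).1 (lt_of_le_of_lt hx (by linarith))
  exact ⟨hc.of_isClosed_subset (isClosed_le hr continuous_const) (hsub.trans subset_closure), hsub⟩

theorem step_cutoff_eq_zero {ε t : ℝ} (hε : 0 < ε) (h : ¬ t ≤ -ε) : step (-t / ε) = 0 :=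
  step_of_le (by rw [div_le_one hε]; linarith)

/-- The Monge–Ampère masses of a strictly plurisubharmonic function against the cutoffs at depth
`ε` stay away from zero as `ε → 0`. -/
theorem exists_mass_lower_bound [T2Space X] {ι : Type*} [Fintype ι]
    {e : ι → OpenPartialHomeomorph X (Cn n)} (he : ∀ i, e i ∈ atlas (Cn n) X)
    {θ : ι → X → ℝ} (hθ : ∀ i, CkOn n 2 (θ i) Set.univ) (hθ0 : ∀ i x, 0 ≤ θ i x)
    (hθe : ∀ i, tsupport (θ i) ⊆ (e i).source) {Ω : Set X} (hΩ : IsOpen Ω)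
    (hsum : ∀ x ∈ Ω, ∑ i, θ i x = 1) (hne : Ω.Nonempty) (hc : IsCompact (closure Ω))
    {r φ : X → ℝ} (hr : CkOn n 3 r Set.univ) (hneg : ∀ x, r x < 0 ↔ x ∈ Ω)
    (hpsh : StrictlyPSHOn n φ Ω) :
    ∃ c ε₀ : ℝ, 0 < c ∧ 0 < ε₀ ∧ ∀ ε, 0 < ε → ε ≤ ε₀ →
      c ≤ ∑ i, chartIntegral (e i) Ω (fun x => θ i x * step (-r x / ε)) fun _ => φ := by
  obtain ⟨x₀, hx₀⟩ := hne
  have hr0 : r x₀ < 0 := (hneg x₀).2 hx₀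
  have hrc : Continuous r := continuousOn_univ.1 (ContMDiffOn.continuousOn hr)
  have hcont : ∀ i ε, ContinuousOn (fun x => θ i x * step (-r x / ε)) Ω := fun i ε =>
    ((ContMDiffOn.continuousOn (hθ i)).mono (Set.subset_univ _)).mul
      (ContMDiffOn.continuousOn (hr.step_cutoff Ω ε))
  have hint : ∀ i ε, 0 < ε → IntegrableOn
      (chartDensity (e i) (fun x => θ i x * step (-r x / ε)) fun _ => φ)
      ((e i).target ∩ (e i).symm ⁻¹' Ω) := by
    intro i ε hε
    obtain ⟨hS, hSΩ⟩ := isCompact_sublevel hc hrc hneg hε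
    refine integrableOn_chartDensity (he i) hΩ (hS.inter_right (isClosed_tsupport (θ i)))
      (fun x hx => hθe i hx.2) (fun x hx => hSΩ hx.1) (hcont i ε) (fun _ => hpsh.1)
      fun x _ _ hxS => Or.inl ?_
    by_cases h : r x ≤ -ε
    · rw [image_eq_zero_of_notMem_tsupport fun h' => hxS ⟨h, h'⟩, zero_mul]
    · rw [step_cutoff_eq_zero hε h, mul_zero]
  have hmeas : ∀ i, MeasurableSet ((e i).target ∩ (e i).symm ⁻¹' Ω) := fun i =>
    ((e i).isOpen_inter_preimage_symm hΩ).measurableSet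
  have hdens : ∀ i ε, ∀ z ∈ (e i).target ∩ (e i).symm ⁻¹' Ω,
      0 ≤ chartDensity (e i) (fun x => θ i x * step (-r x / ε)) (fun _ => φ) z :=
    fun i ε z hz => mul_nonneg (mul_nonneg (hθ0 i _) (step_nonneg _))
      (mixedMA_chart_pos hΩ hpsh (he i) hz).le
  -- At this scale the cutoff equals 1 at x₀, so the mass there is positive and serves as c. For
  -- smaller ε the argument -r/ε is larger on Ω and the step is monotone, so the mass does not
  -- decrease.
  have hε₀ : 0 < -r x₀ / 2 := by linarith
  refine ⟨_, -r x₀ / 2, ?_, hε₀, fun ε hε hle => Finset.sum_le_sum fun i _ =>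
    setIntegral_mono_on (hint i _ hε₀) (hint i ε hε) (hmeas i) fun z hz => ?_⟩
  · obtain ⟨i, hi⟩ : ∃ i, 0 < θ i x₀ := by
      by_contra! hcon
      have := hsum x₀ hx₀
      linarith [Finset.sum_nonpos fun i (_ : i ∈ Finset.univ) => hcon i]
    have hxe : x₀ ∈ (e i).source := hθe i (subset_tsupport _ hi.ne')
    have hz₀ : e i x₀ ∈ (e i).target ∩ (e i).symm ⁻¹' Ω :=
      ⟨(e i).map_source hxe, by simpa [(e i).left_inv hxe] using hx₀⟩
    refine Finset.sum_pos' (fun j _ => setIntegral_nonneg (hmeas j) (hdens j _))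
      ⟨i, Finset.mem_univ i, ?_⟩
    refine (setIntegral_pos_iff_support_of_nonneg_ae
      (ae_restrict_of_forall_mem (hmeas i) (hdens i _)) (hint i _ hε₀)).2 ?_
    have hopen := (continuousOn_chartDensity (he i) hΩ (hcont i (-r x₀ / 2))
      (u := fun _ => φ) fun _ => hpsh.1).isOpen_inter_preimage
        ((e i).isOpen_inter_preimage_symm hΩ) isOpen_Ioi (t := Set.Ioi 0)
    refine (hopen.measure_pos volume ⟨e i x₀, hz₀, ?_⟩).trans_le (measure_mono ?_)
    · refine mul_pos ?_ (mixedMA_chart_pos hΩ hpsh (he i) hz₀)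
      have hstep : step (-r x₀ / (-r x₀ / 2)) = 1 := by
        refine step_of_ge (le_of_eq ?_)
        have : r x₀ ≠ 0 := hr0.ne
        field_simp
      simp only [(e i).left_inv hxe, hstep, mul_one]
      exact hi
    · exact fun z hz => ⟨ne_of_gt hz.2, hz.1⟩
  · refine mul_le_mul_of_nonneg_right (mul_le_mul_of_nonneg_left (step_monotone ?_) (hθ0 i _))
      (mixedMA_chart_pos hΩ hpsh (he i) hz).le
    have : r ((e i).symm z) < 0 := (hneg _).2 hz.2
    exact div_le_div_of_nonneg_left (by linarith) hε hle

/-- No strictly plurisubharmonic function `-(-ρ)^η` with `η > 1 / n` exists on a relatively compact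
domain whose boundary has vanishing Levi form. -/
theorem false_of_levi_flat [T2Space X] [SecondCountableTopology X] (hn : 0 < n) {Ω : Set X}
    (hΩ : IsOpen Ω) (hne : Ω.Nonempty) (hc : IsCompact (closure Ω)) {r ρ : X → ℝ} {η : ℝ}
    (hr : CkOn n 3 r Set.univ) (hneg : ∀ x, r x < 0 ↔ x ∈ Ω)
    (hd : ∀ p ∈ frontier Ω, DiffNeZero n r p)
    (hlevi : ∀ p ∈ frontier Ω, LeviFormVanishesAt n r p)
    (hρ : IsDefiningFunction n ρ Ω) (hη : 1 / (n : ℝ) < η)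
    (hpsh : StrictlyPSHOn n (fun x => -((-ρ x) ^ η)) Ω) : False := by
  obtain ⟨t, e, L, K, θ, he, hL, hK, hLK, hKe, hθ, hθ0, hθ1, hsum, hsupp⟩ :=
    exists_chart_partition (n := n) hc
  have hn' : n - 1 < n := by omega
  have hn0 : (0 : ℝ) < n := by exact_mod_cast hn
  have hη0 : 0 < η := lt_trans (by positivity) hη
  have hrc : Continuous r := continuousOn_univ.1 (ContMDiffOn.continuousOn hr)
  have hθe : ∀ i, tsupport (θ i) ⊆ (e i).source := fun i x hx => (hsupp i hx).1
  have hsumΩ : ∀ x ∈ Ω, ∑ i, θ i x = 1 := fun x hx => hsum x (subset_closure hx)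
  set φ : X → ℝ := fun x => -((-ρ x) ^ η) with hφ
  obtain ⟨c, ε₀, hc0, hε₀, hlow⟩ :=
    exists_mass_lower_bound he hθ hθ0 hθe hΩ hsumΩ hne hc hr hneg hpsh
  have hup : ∀ i, ∃ C : ℝ, 0 ≤ C ∧ ∀ ε, 0 < ε → ε ≤ 1 →
      |chartIntegral (e i) Ω (fun x => θ i x * φ x)
        (Function.update (fun _ => φ) ⟨n - 1, hn'⟩ fun x => step (-r x / ε))|
        ≤ C * ε ^ (n * η - 1) := by
    intro i
    have hreg := region_chart hneg (e i)
    obtain ⟨C, hC, hb⟩ := (stripChart_of_chart hΩ hr hneg hd hlevi hρ hη0 hpsh (he i) (hK i)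
      (hKe i)).boundary_term_le hn' (θ := θ i ∘ (e i).symm) (hL i) (hLK i)
      ((continuousOn_univ.1 (ContMDiffOn.continuousOn (hθ i))).comp_continuousOn
        ((e i).continuousOn_symm.mono fun z hz => hz.1))
      (fun z => by
        rw [Function.comp_apply, abs_of_nonneg (hθ0 i _)]
        exact hθ1 i _)
      (fun z hz hzL => image_eq_zero_of_notMem_tsupport (f := θ i) fun h => hzL <| by
        have := (hsupp i h).2
        rwa [Set.mem_preimage, (e i).right_inv hz.1] at this)
      step_contDiff abs_step_le (fun _ => step_of_le) (fun _ => step_of_ge)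
    refine ⟨C, hC, fun ε hε hε1 => ?_⟩
    have h := hb ε hε hε1
    rw [hreg] at h
    simp only [← mul_assoc] at h
    simp only [chartIntegral, chartDensity, comp_update]
    exact h
  choose C hC hbound using hup
  have hkey : ∀ ε, 0 < ε → ε ≤ ε₀ → ε ≤ 1 → c ≤ (∑ i, C i) * ε ^ (n * η - 1) := by
    intro ε hε hε0 hε1
    obtain ⟨hS, hSΩ⟩ := isCompact_sublevel hc hrc hneg hε
    refine (hlow ε hε hε0).trans ?_
    -- All slots hold φ, so any slot could receive the cutoff. The last one matches
    -- `boundary_term_le`, where n - 1 copies of φ occupy the first slots.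
    rw [sum_chartIntegral_parts he hθ hθe hΩ hsumΩ hS hSΩ (fun _ => hpsh.1)
      (hr.step_cutoff Ω ε) (fun x _ hxS => step_cutoff_eq_zero hε hxS) ⟨n - 1, hn'⟩,
      Finset.sum_mul]
    exact Finset.sum_le_sum fun i _ => (le_abs_self _).trans (hbound i ε hε hε1)
  have hs : 0 < n * η - 1 := by
    rw [div_lt_iff₀ hn0] at hη
    linarith
  have hlim : Tendsto (fun ε : ℝ => (∑ i, C i) * ε ^ (n * η - 1)) (𝓝[>] 0) (𝓝 0) := by
    have h := (Real.continuousAt_rpow_const 0 (n * η - 1) (Or.inr hs.le)).tendsto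
    rw [Real.zero_rpow hs.ne'] at h
    simpa using (h.mono_left nhdsWithin_le_nhds).const_mul (∑ i, C i)
  have hsmall : ∀ᶠ ε in 𝓝[>] (0 : ℝ), ε ∈ Set.Ioc 0 (min ε₀ 1) :=
    Ioc_mem_nhdsGT (lt_min hε₀ one_pos)
  obtain ⟨ε, h1, h2, h3⟩ := ((hlim.eventually (gt_mem_nhds hc0)).and hsmall).exists
  exact absurd h1 (not_lt.2 (hkey ε h2 (h3.trans (min_le_left _ _)) (h3.trans (min_le_right _ _))))

end FinalArgument

end DF

end

theorem mainTheorem2 (n : ℕ) (hn : 2 ≤ n)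
    (X : Type*) [TopologicalSpace X] [T2Space X] [SecondCountableTopology X]
    [ChartedSpace (DF.Cn n) X] [IsManifold 𝓘(ℂ, DF.Cn n) ω X]
    (Ω : Set X) (hΩ_open : IsOpen Ω) (hΩ_conn : IsConnected Ω)
    (hΩ_cpt : IsCompact (closure Ω)) (hΩ_bdry : DF.HasCkBoundary n 3 Ω)
    (hη : 1 / (n : ℝ) < DF.dfIndex n Ω) :
    ¬ DF.IsLeviFlatBoundary n Ω := by
  intro hflat
  obtain ⟨r, hr, hneg, hd⟩ := DF.exists_global_defining hΩ_open hΩ_bdry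
  obtain ⟨ρ, η, hρ, hlt, hpsh⟩ := DF.exists_exponent_of_lt_dfIndex (by positivity) hη
  -- The glued function r is a local defining function at every boundary point, with the whole
  -- manifold as neighbourhood, so Levi-flatness applies to it directly.
  refine DF.false_of_levi_flat (by omega) hΩ_open hΩ_conn.nonempty hΩ_cpt hr hneg hd
    (fun p hp => hflat p hp Set.univ r ⟨isOpen_univ, trivial, ?_, ?_, hd p hp⟩) hρ hlt hpsh
  · exact ContMDiffOn.of_le hr (by norm_num)
  · ext x
    simp [hneg]
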